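/- Let $n\ge 1$, let $1=\sigma_1\le\dots\le\sigma_n$ be real numbers and $\delta_\lambda(x)=(\lambda^{\sigma_1}x_1,\dots,\lambda^{\sigma_n}x_n)$ for $\lambda>0$. Let $X_1,\dots,X_m$ be $C^\infty$ vector fields on $\mathbb R^n$ which are linearly independent over $\mathbb R$ (as differential operators), $\delta_\lambda$-homogeneous of degree $1$, and satisfy Hörmander's condition at $0$: $\dim\{X(0):X\in\mathfrak a\}=n$, where $\mathfrak a=\mathrm{Lie}\{X_1,\dots,X_m\}$. (A vector field $V$ is homogeneous of degree $d$ with respect to dilations $\delta_\lambda$ if $V(f\circ\delta_\lambda)=\lambda^d (Vf)\circ\delta_\lambda$ for all $\lambda>0$ and all smooth $f$.) Put $\mathfrak a_1=\mathrm{span}\{X_1,\dots,X_m\}$ and $\mathfrak a_{k+1}=[\mathfrak a_1,\mathfrak a_k]$. Then $\mathfrak a$ has finite dimension $N=n+p$ with $p\ge 0$, every $V\in\mathfrak a$ is complete, $r:=\sigma_n$ is an integer, and one can choose - a basis $X_1,\dots,X_N$ of $\mathfrak a$ extending $X_1,\dots,X_m$, and integers $1\le s_1\le\dots\le s_N$,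 such that $\mathfrak a_k=\mathrm{span}\{X_l: s_l=k\}$ for every $k\ge1$; - indices $i_1<\dots<i_n$ in $\{1,\dots,N\}$ such that $X_{i_1}(0),\dots,X_{i_n}(0)$ is a basis of $\mathbb R^n$; let $j_1<\dots<j_p$ be the remaining indices. Fix any such choice. For $a,b\in\mathbb R^N$ put $a\cdot X=\sum_l a_lX_l$; let $a*b$ be the element of $\mathbb R^N$ with $(a*b)\cdot X=(a\cdot X)\diamond(b\cdot X)$, where $\diamond$ is the Campbell–Baker–Hausdorff operation of $\mathfrak a$; let $D_\lambda(a)=(\lambda^{s_1}a_1,\dots,\lambda^{s_N}a_N)$; let $\pi(a)\in\mathbb R^n$ be the value at time $1$ of the integral curve of $a\cdot X$ starting from $0$; and let $J_l(a)=\frac{d}{dt}\big|_{t=0}\,a*(te_l)$ $(1\le l\le N)$. Define $$T(a)=(\pi(a),a_{j_1},\dots,a_{j_p}),\qquad d_\lambda(x,\xi)=(\delta_\lambda(x),\lambda^{s_{j_1}}\xi_1,\dots,\lambda^{s_{j_p}}\xi_p)\quad (x\in\mathbb R^n,\ \xi\in\mathbb R^p).$$ Then: 1. $(\mathbb R^N,*,D_\lambda)$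 is a homogeneous Carnot group with $m$ generators, nilpotent of step $r$. 2. $T$ is a $C^\infty$-diffeomorphism of $\mathbb R^N$ onto $\mathbb R^N=\mathbb R^n\times\mathbb R^p$, and $T\circ D_\lambda=d_\lambda\circ T$ for all $\lambda>0$. 3. With $z\star w=T(T^{-1}(z)*T^{-1}(w))$, one has $T(a*b)=T(a)\star T(b)$, and $\mathbb G=(\mathbb R^N,\star,d_\lambda)$ is a homogeneous Carnot group with $m$ generators, nilpotent of step $r$. 4. The push-forwards $Z_l=dT(J_l)$, that is $Z_l(z)=d_{T^{-1}(z)}T\big(J_l(T^{-1}(z))\big)$, $1\le l\le N$, are smooth vector fields and form a basis of $\mathrm{Lie}(\mathbb G)$, the Lie algebra of left-invariant vector fields; $Z_1,\dots,Z_m$ generate $\mathrm{Lie}(\mathbb G)$ and span the same space as the left-invariant fields which agree at $0$ with a coordinate derivative in a direction of weight $1$, so that $\sum_{k=1}^m Z_k^2$ is a sub-Laplacian on $\mathbb G$. 5. $Z_l$ is $d_\lambda$-homogeneous of degree $s_l$ for $l=1,\dots,N$. 6. For $l=1,\dots,N$ one has $Z_l=X_l+R_l$, where $R_l$ is a smooth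 vector field on $\mathbb R^N$ which operates only in the $\xi$ variables (its coefficients may depend on $(x,\xi)$). Thus $Z_l$ is a lifting of $X_l$, and $\sum_{k=1}^m Z_k^2$ is a lifting of $\sum_{k=1}^m X_k^2$. Here a differential operator $\widetilde P$ on $\mathbb R^n\times\mathbb R^p$ is a lifting of $P$ if it has smooth coefficients and $\widetilde P\big((x,\xi)\mapsto f(x)\big)(x,\xi)=(Pf)(x)$ for all $f\in C^\infty(\mathbb R^n)$ and all $(x,\xi)$. A homogeneous Carnot group on $\mathbb R^N$ with $m$ generators and step $r$ is a Lie group on the manifold $\mathbb R^N$ with identity $0$ whose automorphisms include the dilations $x\mapsto(\lambda^{w_k}x_k)_k$, $\lambda>0$, where $\{w_1,\dots,w_N\}=\{1,\dots,r\}$, exactly $m$ of the $w_k$ equal $1$, the left-invariant fields which agree at $0$ with $\partial_k$ for some $k$ with $w_k=1$ generate its Lie algebra, and this Lie algebra is nilpotent of step $r$ (the coordinates need not be listed by increasing weight). -/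

import Mathlib

open scoped ContDiff

noncomputable section

/-! ### Smooth vector fields on `ℝ^ι` and their Lie algebra -/

/-- The space of `C^∞` vector fields on `ℝ^ι`; the field `∑ k, V_k ∂_k` is the map
`x ↦ (V_k(x))_k`. -/
def smoothFields (ι : Type*) [Fintype ι] : Submodule ℝ ((ι → ℝ) → (ι → ℝ)) where
  carrier := {V | ContDiff ℝ ∞ V}
  add_mem' := by
    intro V W hV hW
    exact ContDiff.add (show ContDiff ℝ ∞ V from hV) (show ContDiff ℝ ∞ W from hW)
  zero_mem' := by
    change ContDiff ℝ ∞ fun _ : ι → ℝ => (0 : ι → ℝ)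
    exact contDiff_const
  smul_mem' := by
    intro c V hV
    exact ContDiff.const_smul c (show ContDiff ℝ ∞ V from hV)

/-- A smooth vector field on `ℝ^ι`. -/
abbrev SmoothVF (ι : Type*) [Fintype ι] : Type _ := ↥(smoothFields ι)

theorem SmoothVF.contDiff {ι : Type*} [Fintype ι] (V : SmoothVF ι) : ContDiff ℝ ∞ V.1 := V.2

theorem SmoothVF.differentiableAt {ι : Type*} [Fintype ι] (V : SmoothVF ι) (x : ι → ℝ) :
    DifferentiableAt ℝ V.1 x :=
  (V.contDiff.differentiable (by simp)).differentiableAt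

/-- The commutator `[V, W] = VW - WV`. -/
instance smoothVFBracket {ι : Type*} [Fintype ι] : Bracket (SmoothVF ι) (SmoothVF ι) where
  bracket V W := ⟨VectorField.lieBracket ℝ V.1 W.1, by
    have h1 : ContDiff ℝ ∞ (fderiv ℝ V.1) := V.contDiff.fderiv_right (by simp)
    have h2 : ContDiff ℝ ∞ (fderiv ℝ W.1) := W.contDiff.fderiv_right (by simp)
    exact (h2.clm_apply V.contDiff).sub (h1.clm_apply W.contDiff)⟩

instance smoothVFLieRing {ι : Type*} [Fintype ι] : LieRing (SmoothVF ι) where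
  add_lie U V W := Subtype.ext <| funext fun x =>
    VectorField.lieBracket_add_left (U.differentiableAt x) (V.differentiableAt x)
  lie_add U V W := Subtype.ext <| funext fun x =>
    VectorField.lieBracket_add_right (V.differentiableAt x) (W.differentiableAt x)
  lie_self U := Subtype.ext VectorField.lieBracket_self
  leibniz_lie U V W := Subtype.ext <| funext fun x =>
    VectorField.leibniz_identity_lieBracket (n := ∞)
      (by rw [minSmoothness_of_isRCLikeNormedField]; exact WithTop.coe_le_coe.2 le_top)
      U.contDiff.contDiffAt V.contDiff.contDiffAt W.contDiff.contDiffAt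

instance smoothVFLieAlgebra {ι : Type*} [Fintype ι] : LieAlgebra ℝ (SmoothVF ι) where
  lie_smul c _ W := Subtype.ext <| funext fun x =>
    VectorField.lieBracket_const_smul_right (c := c) (W.differentiableAt x)

/-- The vector field `V` as a first-order differential operator, `f ↦ ∑ k, V_k ∂_k f`. -/
def SmoothVF.op {ι : Type*} [Fintype ι] (V : SmoothVF ι) (f : (ι → ℝ) → ℝ) : (ι → ℝ) → ℝ :=
  fun x => fderiv ℝ f x (V.1 x)

/-- The sum of squares `f ↦ ∑ k, V_k (V_k f)`. -/
def sumSq {ι : Type*} [Fintype ι] {m : ℕ} (V : Fin m → SmoothVF ι) (f : (ι → ℝ) → ℝ) :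
    (ι → ℝ) → ℝ :=
  fun x => ∑ k, (V k).op ((V k).op f) x

/-- `γ` is an integral curve of `V`, defined for all times, with `γ 0 = x`. -/
def IsGlobalCurveFrom {ι : Type*} [Fintype ι] (V : SmoothVF ι) (x : ι → ℝ) (γ : ℝ → ι → ℝ) :
    Prop :=
  γ 0 = x ∧ IsIntegralCurve γ (fun _ => V.1)

open Classical in
/-- `exp(V)(x)`: the value at time `1` of the integral curve of `V` that starts at `x` at
time `0` (the value `x` is a default, used only if there is no such curve). -/
def SmoothVF.exp {ι : Type*} [Fintype ι] (V : SmoothVF ι) (x : ι → ℝ) : ι → ℝ :=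
  if h : ∃ γ : ℝ → ι → ℝ, IsGlobalCurveFrom V x γ then h.choose 1 else x

/-! ### Dilations and homogeneity -/

/-- The dilation `x ↦ (λ^{w_k} x_k)_k`. -/
def dil {ι : Type*} (w : ι → ℝ) (lam : ℝ) (x : ι → ℝ) : ι → ℝ := fun k => lam ^ (w k) * x k

/-- `V` is homogeneous of degree `d` with respect to the dilations `dil w`:
`V (f ∘ δ_λ) = λ^d (V f) ∘ δ_λ` for all `λ > 0` and all smooth `f`. -/
def IsHomogeneousVF {ι : Type*} [Fintype ι] (w : ι → ℝ) (d : ℝ) (V : SmoothVF ι) : Prop :=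
  ∀ lam : ℝ, 0 < lam → ∀ f : (ι → ℝ) → ℝ, ContDiff ℝ ∞ f →
    ∀ x, V.op (f ∘ dil w lam) x = lam ^ d * V.op f (dil w lam x)

/-! ### The Lie algebra generated by a family of fields, and its layers -/

/-- `Lie{X_1, …, X_m}`. -/
def lieGen {ι : Type*} [Fintype ι] {m : ℕ} (X : Fin m → SmoothVF ι) :
    LieSubalgebra ℝ (SmoothVF ι) :=
  LieSubalgebra.lieSpan ℝ (SmoothVF ι) (Set.range X)

/-- The layers `𝔞_1 = span{X_1, …, X_m}`, `𝔞_{k+1} = [𝔞_1, 𝔞_k]`; by convention `𝔞_0 = 0`. -/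
def layer {ι : Type*} [Fintype ι] {m : ℕ} (X : Fin m → SmoothVF ι) :
    ℕ → Submodule ℝ (SmoothVF ι)
  | 0 => ⊥
  | 1 => Submodule.span ℝ (Set.range X)
  | k + 2 => Submodule.span ℝ
      {W | ∃ U ∈ Submodule.span ℝ (Set.range X), ∃ V ∈ layer X (k + 1), W = ⁅U, V⁆}

/-- Hörmander's rank condition at `x`: `dim {V(x) : V ∈ Lie{X_1, …, X_m}} = n`. -/
def HormanderAt {n m : ℕ} (X : Fin m → SmoothVF (Fin n)) (x : Fin n → ℝ) : Prop :=
  Module.finrank ℝ (Submodule.span ℝ {v : Fin n → ℝ | ∃ V ∈ lieGen X, V.1 x = v}) = n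

/-! ### The Campbell-Baker-Hausdorff operation (Dynkin's formula) -/

/-- `[a_1, [a_2, … [a_{d-1}, a_d] … ]]`. -/
def nestedBracket {L : Type*} [LieRing L] : List L → L
  | [] => 0
  | [a] => a
  | a :: b :: l => ⁅a, nestedBracket (b :: l)⁆

/-- The word `x^{p_1} y^{q_1} ⋯ x^{p_k} y^{q_k}`. -/
def bchWord {L : Type*} (x y : L) {k : ℕ} (c : Fin k → ℕ × ℕ) : List L :=
  (List.ofFn c).flatMap fun t => List.replicate t.1 x ++ List.replicate t.2 y

/-- The term of degree `d` of the Campbell-Baker-Hausdorff series: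
`∑_{k} (-1)^{k+1}/k ∑ [x^{p_1} y^{q_1} ⋯ x^{p_k} y^{q_k}] / (d ∏ p_i! q_i!)`, where the inner sum
is over the `(p_i, q_i)_{i ≤ k}` with `p_i + q_i > 0` and `∑ (p_i + q_i) = d`. -/
def bchTerm {L : Type*} [LieRing L] [LieAlgebra ℝ L] (d : ℕ) (x y : L) : L :=
  ∑ k ∈ Finset.Icc 1 d, ((-1 : ℝ) ^ (k + 1) / (k : ℝ)) •
    ∑ c ∈ (Fintype.piFinset
        (fun _ : Fin k => Finset.range (d + 1) ×ˢ Finset.range (d + 1))).filter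
        (fun c => (∀ i, 0 < (c i).1 + (c i).2) ∧ ∑ i, ((c i).1 + (c i).2) = d),
      (1 / ((d : ℝ) * ∏ i, (((c i).1.factorial : ℝ) * ((c i).2.factorial : ℝ)))) •
        nestedBracket (bchWord x y c)

/-- `x ⋄ y = x + y + [x,y]/2 + [x,[x,y]]/12 - [y,[x,y]]/12 + ⋯`; a finite sum in a nilpotent Lie
algebra. -/
def bch {L : Type*} [LieRing L] [LieAlgebra ℝ L] (x y : L) : L :=
  ∑ᶠ d : ℕ, bchTerm d x y

/-! ### Homogeneous Carnot groups on `ℝ^ι` -/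

/-- The left-invariant smooth vector fields of `(ℝ^ι, ∘)`. -/
def leftInvariant {ι : Type*} [Fintype ι] (mul : (ι → ℝ) → (ι → ℝ) → (ι → ℝ)) :
    Submodule ℝ (SmoothVF ι) where
  carrier := {V | ∀ a b, fderiv ℝ (mul a) b (V.1 b) = V.1 (mul a b)}
  add_mem' := by
    intro V W hV hW a b
    simp [hV a b, hW a b]
  zero_mem' := by
    intro a b
    simp
  smul_mem' := by
    intro c V hV a b
    simp [hV a b]

/-- The left-invariant fields that agree at `0` with some `∂_k`, where `k` is a coordinate of
weight `1`. -/
def jacobianGenerators {ι : Type*} [Fintype ι] [DecidableEq ι]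
    (mul : (ι → ℝ) → (ι → ℝ) → (ι → ℝ)) (w : ι → ℝ) : Set (SmoothVF ι) :=
  {V | V ∈ leftInvariant mul ∧ ∃ k, w k = 1 ∧ V.1 0 = Pi.single k 1}

/-- `(ℝ^ι, ∘, dil w)` is a homogeneous Carnot group with `m` generators, nilpotent of step `r`
(the coordinates need not be listed by increasing weight). -/
structure IsHomogeneousCarnotGroup {ι : Type*} [Fintype ι] [DecidableEq ι]
    (mul : (ι → ℝ) → (ι → ℝ) → (ι → ℝ)) (w : ι → ℝ) (m r : ℕ) : Prop where
  smooth_mul : ContDiff ℝ ∞ (fun z : (ι → ℝ) × (ι → ℝ) => mul z.1 z.2)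
  assoc : ∀ a b c, mul (mul a b) c = mul a (mul b c)
  zero_mul : ∀ a, mul 0 a = a
  mul_zero : ∀ a, mul a 0 = a
  exists_inv : ∃ inv : (ι → ℝ) → (ι → ℝ), ContDiff ℝ ∞ inv ∧
    ∀ a, mul (inv a) a = 0 ∧ mul a (inv a) = 0
  dil_mul : ∀ lam : ℝ, 0 < lam → ∀ a b,
    dil w lam (mul a b) = mul (dil w lam a) (dil w lam b)
  weights : Set.range w = (fun k : ℕ => (k : ℝ)) '' Set.Icc 1 r
  card_generators : {k | w k = 1}.ncard = m
  generates :
    (LieSubalgebra.lieSpan ℝ (SmoothVF ι) (jacobianGenerators mul w)).toSubmodule =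
      leftInvariant mul
  nilpotent :
    LieRing.IsNilpotent ↥(LieSubalgebra.lieSpan ℝ (SmoothVF ι) (jacobianGenerators mul w))
  step : LieModule.nilpotencyLength
    ↥(LieSubalgebra.lieSpan ℝ (SmoothVF ι) (jacobianGenerators mul w))
    ↥(LieSubalgebra.lieSpan ℝ (SmoothVF ι) (jacobianGenerators mul w)) = r

/-! ### Liftings -/

/-- The projection `ℝ^n × ℝ^p → ℝ^n`; a point `(x, ξ)` is a function on `Fin n ⊕ Fin p`. -/
def projX {n p : ℕ} (z : Fin n ⊕ Fin p → ℝ) : Fin n → ℝ := fun k => z (Sum.inl k)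

/-- The operator `P` is, on smooth functions, a linear differential operator with smooth
coefficients: a finite sum of smooth functions times iterated partial derivatives. -/
def IsSmoothPDO {ι : Type*} [Fintype ι] [DecidableEq ι]
    (P : ((ι → ℝ) → ℝ) → ((ι → ℝ) → ℝ)) : Prop :=
  ∃ (d : ℕ) (c : (k : ℕ) → (Fin k → ι) → (ι → ℝ) → ℝ),
    (∀ k J, ContDiff ℝ ∞ (c k J)) ∧
    ∀ f : (ι → ℝ) → ℝ, ContDiff ℝ ∞ f → ∀ x,
      P f x = ∑ k ∈ Finset.range (d + 1), ∑ J : Fin k → ι,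
        c k J x * iteratedFDeriv ℝ k f x (fun l => Pi.single (J l) 1)

/-- `Q` is a lifting of `P` via the projection onto the first `n` variables. -/
def IsLifting {n p : ℕ} (Q : ((Fin n ⊕ Fin p → ℝ) → ℝ) → ((Fin n ⊕ Fin p → ℝ) → ℝ))
    (P : ((Fin n → ℝ) → ℝ) → ((Fin n → ℝ) → ℝ)) : Prop :=
  IsSmoothPDO Q ∧ ∀ f : (Fin n → ℝ) → ℝ, ContDiff ℝ ∞ f →
    ∀ z, Q (f ∘ projX) z = P f (projX z)

/-- A field `V` on `ℝ^n`, regarded as the field `(x, ξ) ↦ (V(x), 0)` on `ℝ^n × ℝ^p`. -/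
def SmoothVF.extend {n : ℕ} (p : ℕ) (V : SmoothVF (Fin n)) : SmoothVF (Fin n ⊕ Fin p) :=
  ⟨fun z => Sum.elim (V.1 (projX z)) 0, by
    change ContDiff ℝ ∞ fun z : Fin n ⊕ Fin p → ℝ => Sum.elim (V.1 (projX z)) 0
    rw [contDiff_pi]
    have hp : ContDiff ℝ ∞ (projX : (Fin n ⊕ Fin p → ℝ) → Fin n → ℝ) :=
      contDiff_pi.2 fun k => contDiff_apply ℝ ℝ (Sum.inl k)
    rintro (k | l)
    · exact contDiff_pi.1 (V.contDiff.comp hp) k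
    · exact contDiff_const⟩

/-! ### Folland's group and the change of variables -/

/-- The choices made in the construction, for `𝔞 = Lie{X_1, …, X_m}`: a basis `X_1, …, X_N` of
`𝔞` which extends the given fields and is adapted to the stratification (`X_l` belongs to the
layer `𝔞_{s_l}`, and `s_1 ≤ ⋯ ≤ s_N`); indices `i_1 < ⋯ < i_n` such that the `X_{i_k}(0)` are a
basis of `ℝ^n`; and the remaining indices `j_1 < ⋯ < j_p`. -/
structure LiftingFrame {n m : ℕ} (X : Fin m → SmoothVF (Fin n)) (N p : ℕ) where
  basis : Module.Basis (Fin N) ℝ ↥(lieGen X)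
  le : m ≤ N
  basis_eq : ∀ k : Fin m, (basis (Fin.castLE le k) : SmoothVF (Fin n)) = X k
  s : Fin N → ℕ
  s_mono : Monotone s
  span_layer : ∀ k : ℕ,
    Submodule.span ℝ {V : SmoothVF (Fin n) | ∃ l, s l = k ∧ V = (basis l : SmoothVF (Fin n))} =
      layer X k
  i : Fin n → Fin N
  i_mono : StrictMono i
  linInd : LinearIndependent ℝ fun k => (basis (i k) : SmoothVF (Fin n)).1 0
  j : Fin p → Fin N
  j_mono : StrictMono j
  range_j : Set.range j = (Set.range i)ᶜ

namespace LiftingFrame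

/-- The field `X_l`, `1 ≤ l ≤ N`. -/
def field {n m N p : ℕ} {X : Fin m → SmoothVF (Fin n)} (F : LiftingFrame X N p) (l : Fin N) :
    SmoothVF (Fin n) :=
  (F.basis l : SmoothVF (Fin n))

/-- `a · X = ∑ l, a_l X_l`, as an element of `𝔞`. -/
def Phi {n m N p : ℕ} {X : Fin m → SmoothVF (Fin n)} (F : LiftingFrame X N p)
    (a : Fin N → ℝ) : ↥(lieGen X) :=
  ∑ l, a l • F.basis l

/-- Folland's group law on `ℝ^N`: `a * b = Φ⁻¹(Φ(a) ⋄ Φ(b))`. -/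
def mulA {n m N p : ℕ} {X : Fin m → SmoothVF (Fin n)} (F : LiftingFrame X N p)
    (a b : Fin N → ℝ) : Fin N → ℝ :=
  F.basis.equivFun (bch (F.Phi a) (F.Phi b))

/-- The weights `s_1, …, s_N` of the dilations `D_λ` of Folland's group. -/
def weightA {n m N p : ℕ} {X : Fin m → SmoothVF (Fin n)} (F : LiftingFrame X N p) :
    Fin N → ℝ :=
  fun l => (F.s l : ℝ)

/-- `J_l`: the left-invariant field of Folland's group with `J_l(0) = ∂_l`, that is
`J_l(a) = d/dt (a * (t e_l))` at `t = 0`. -/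
def J {n m N p : ℕ} {X : Fin m → SmoothVF (Fin n)} (F : LiftingFrame X N p) (l : Fin N)
    (a : Fin N → ℝ) : Fin N → ℝ :=
  fderiv ℝ (F.mulA a) 0 (Pi.single l 1)

/-- Folland's map `π(a) = exp(a · X)(0)`. -/
def proj {n m N p : ℕ} {X : Fin m → SmoothVF (Fin n)} (F : LiftingFrame X N p)
    (a : Fin N → ℝ) : Fin n → ℝ :=
  SmoothVF.exp (F.Phi a : SmoothVF (Fin n)) 0

/-- The change of variables `T(a) = (π(a), a_{j_1}, …, a_{j_p})`. -/
def T {n m N p : ℕ} {X : Fin m → SmoothVF (Fin n)} (F : LiftingFrame X N p)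
    (a : Fin N → ℝ) : Fin n ⊕ Fin p → ℝ :=
  Sum.elim (F.proj a) (fun k => a (F.j k))

/-- `T⁻¹`. -/
def Tinv {n m N p : ℕ} {X : Fin m → SmoothVF (Fin n)} (F : LiftingFrame X N p) :
    (Fin n ⊕ Fin p → ℝ) → (Fin N → ℝ) :=
  Function.invFun F.T

/-- The group law of `𝔾`: `z ⋆ w = T(T⁻¹(z) * T⁻¹(w))`. -/
def mulG {n m N p : ℕ} {X : Fin m → SmoothVF (Fin n)} (F : LiftingFrame X N p)
    (z w : Fin n ⊕ Fin p → ℝ) : Fin n ⊕ Fin p → ℝ :=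
  F.T (F.mulA (F.Tinv z) (F.Tinv w))

/-- The weights `σ_1, …, σ_n, s_{j_1}, …, s_{j_p}` of the dilations `d_λ`. -/
def weightG {n m N p : ℕ} {X : Fin m → SmoothVF (Fin n)} (F : LiftingFrame X N p)
    (σ : Fin n → ℝ) : Fin n ⊕ Fin p → ℝ :=
  Sum.elim σ (fun k => (F.s (F.j k) : ℝ))

/-- The push-forward `Z_l = dT(J_l)`, that is `Z_l(z) = d_{T⁻¹(z)}T (J_l(T⁻¹(z)))`. -/
def Z {n m N p : ℕ} {X : Fin m → SmoothVF (Fin n)} (F : LiftingFrame X N p) (l : Fin N)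
    (z : Fin n ⊕ Fin p → ℝ) : Fin n ⊕ Fin p → ℝ :=
  fderiv ℝ F.T (F.Tinv z) (F.J l (F.Tinv z))

end LiftingFrame

end

noncomputable section

/-! A continuous function that is homogeneous of negative degree vanishes: let λ → 0 in f(x) =
λ^{-e} f(δ_λ x). The k-th component of a field of degree d has degree σ_k − d, so no non-zero field
has degree above σ_n. The layer 𝔞_k consists of fields of degree k, and fields of distinct degrees
are independent; hence 𝔞 is the direct sum of its layers, finite-dimensional and nilpotent. By
Hörmander's condition every σ_i occurs as the degree of a non-zero layer, so σ_n = r is an integer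
and the non-zero layers are exactly 𝔞_1, …, 𝔞_r.

For the same reason a product of r + 1 elements of 𝔞 kills each coordinate function. On the space
`killed X (r + 1)` of smooth functions killed by all such products, 𝔞 acts faithfully by nilpotent
endomorphisms (`rho`), and exp(V) is a finite sum. Applied to coordinates it gives the flow of V,
polynomial in time and defined for all times (`apply_flow_smul`). This yields completeness and the
smoothness of π.

The Campbell–Baker–Hausdorff formula is proved in associative algebras (`exp_bch`). There Z(t) =
log(exp(tx) exp(ty)) is a polynomial in t; the formula for the derivative of exp gives tZ'(t), and
expanding it in blocks gives Dynkin's series. Through `rho` the operation ⋄ becomes composition of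
operators (`bch_spec`). Since exp is injective on nilpotent elements, ⋄ is a group law, and the flow
of a ⋄ b is the flow of a followed by that of b (`flow_bch`).

Therefore π(a * te_l) is the point reached from π(a) along X_l in time t, and J_l is π-related to
X_l (`fieldJ_related`). At 0 the differential of π sends e_l to X_l(0); completing π by the
coordinates a_j gives a map T with invertible differential at 0. As T intertwines dilations, the
local inverse spreads to a global one (`bijective_and_contDiff_invFun`). The push-forwards Z_l are
then related to X_l by the projection to ℝ^n, which is the lifting property.

The Carnot group axioms are checked once for both groups, on `IsHomogeneousFrame`. At 0 a field of
degree s_l has components only in coordinates of weight s_l, so weights and generators are read off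
there. That the first m fields generate is inherited from 𝔞: a bracket expression for X_l lifts to a
left-invariant field related to X_l, and the only such field is the l-th one of the frame
(`lieGen_eq_leftInvariant`). -/

open Polynomial in
theorem Polynomial.eq_of_derivative_eq_of_coeff_zero {R : Type*} [Ring R] [Algebra ℚ R]
    {f g : R[X]} (h : derivative f = derivative g) (h0 : f.coeff 0 = g.coeff 0) : f = g := by
  ext n
  rcases n with _ | n
  · exact h0
  · have := congrArg (fun p => coeff p n) h
    simp only [coeff_derivative] at this
    have hu : IsUnit ((n : R) + 1) := by
      have : ((n : R) + 1) = algebraMap ℚ R (n + 1) := by simp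
      rw [this]
      exact (IsUnit.mk0 (n + 1 : ℚ) (by positivity)).map _
    exact hu.mul_right_cancel this

/-! ### Exponential and logarithm of nilpotent elements of a ℚ-algebra -/

namespace NilpotentExp

open Finset Polynomial

section Derivations

variable {R : Type*} [CommRing R] [Algebra ℚ R] (D : Derivation ℚ R R)

theorem derivation_exp {z : R} (hz : IsNilpotent z) :
    D (IsNilpotent.exp z) = D z * IsNilpotent.exp z := by
  obtain ⟨k, hk⟩ := hz
  -- One more term than necessary: differentiation drops the constant term and leaves exactly the
  -- `k` terms used on the right.
  have hk' : z ^ (k + 1) = 0 := by rw [pow_succ, hk, zero_mul]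
  conv_lhs => rw [IsNilpotent.exp_eq_sum hk', sum_range_succ']
  rw [IsNilpotent.exp_eq_sum hk, mul_sum]
  simp only [map_add, map_sum, Derivation.map_smul, pow_zero, Derivation.map_one_eq_zero, smul_zero,
    add_zero]
  refine sum_congr rfl fun i _ => ?_
  rw [Derivation.leibniz_pow, Nat.add_sub_cancel, Nat.factorial_succ, smul_eq_mul,
    ← Nat.cast_smul_eq_nsmul ℚ, smul_smul, mul_smul_comm, mul_comm (z ^ i)]
  congr 1
  push_cast
  field_simp

/-- The truncated logarithm `∑_{k < N} (-1)^k v^{k+1} / (k+1)` of `1 + v`. -/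
def logOneAdd {A : Type*} [Ring A] [Algebra ℚ A] (N : ℕ) (v : A) : A :=
  ∑ k ∈ range N, ((-1 : ℚ) ^ k / (k + 1)) • v ^ (k + 1)

theorem sum_neg_pow_mul {A : Type*} [Ring A] {N : ℕ} {v : A} (hv : v ^ N = 0) :
    (∑ k ∈ range N, (-v) ^ k) * (1 + v) = 1 := by
  have := geom_sum_mul_neg (-v) N
  rw [sub_neg_eq_add] at this
  rw [this, neg_pow, hv, mul_zero, sub_zero]

theorem derivation_logOneAdd {N : ℕ} {v : R} (hv : v ^ N = 0) :
    D (logOneAdd N v) * (1 + v) = D v := by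
  have h : D (logOneAdd N v) = D v * ∑ k ∈ range N, (-v) ^ k := by
    rw [logOneAdd, map_sum, mul_sum]
    refine sum_congr rfl fun k _ => ?_
    rw [Derivation.map_smul, Derivation.leibniz_pow, Nat.add_sub_cancel, smul_eq_mul,
      ← Nat.cast_smul_eq_nsmul ℚ, smul_smul, neg_pow v]
    have : ((-1 : ℚ) ^ k / (k + 1)) * ((k + 1 : ℕ) : ℚ) = (-1) ^ k := by
      push_cast; field_simp
    rw [this, Algebra.smul_def]
    simp only [map_pow, map_neg, map_one]
    ring
  rw [h, mul_assoc, sum_neg_pow_mul hv, mul_one]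

end Derivations

/-- The derivative of polynomials over a `ℚ`-algebra as a derivation. -/
def polyDeriv (B : Type*) [CommRing B] [Algebra ℚ B] : Derivation ℚ B[X] B[X] :=
  (derivative' (R := B)).restrictScalars ℚ

theorem polyDeriv_apply {B : Type*} [CommRing B] [Algebra ℚ B] (f : B[X]) :
    polyDeriv B f = derivative f := rfl

section CommRing

variable {B : Type*} [CommRing B] [Algebra ℚ B]

theorem isNilpotent_logOneAdd {N : ℕ} {v : B} (hv : IsNilpotent v) :
    IsNilpotent (logOneAdd N v) := by
  rw [logOneAdd]
  refine isNilpotent_sum fun i _ => ?_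
  exact IsNilpotent.smul (hv.pow_of_pos (Nat.succ_ne_zero i)) _

/-- Replace u by v = uX. Then exp(−log(1 + v)) (1 + v) has derivative zero and constant term 1, so
it equals 1 over a ℚ-algebra. Evaluation at X = 1 returns to u. -/
theorem exp_logOneAdd_comm {N : ℕ} {u : B} (hu : u ^ N = 0) :
    IsNilpotent.exp (logOneAdd N u) = 1 + u := by
  set v : B[X] := C u * X with hv
  have hvN : v ^ N = 0 := by rw [hv, mul_pow, ← C_pow, hu, C_0, zero_mul]
  have hL : IsNilpotent (logOneAdd N v) := isNilpotent_logOneAdd ⟨N, hvN⟩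
  set L := logOneAdd N v with hLdef
  have hG : IsNilpotent.exp (-L) * (1 + v) = 1 := by
    apply Polynomial.eq_of_derivative_eq_of_coeff_zero
    · rw [derivative_one, ← polyDeriv_apply, Derivation.leibniz, derivation_exp _ hL.neg, map_add,
        Derivation.map_one_eq_zero, zero_add, ← derivation_logOneAdd _ hvN, ← hLdef, map_neg,
        smul_eq_mul, smul_eq_mul]
      ring
    · rw [coeff_zero_eq_eval_zero, eval_mul, coeff_zero_eq_eval_zero]
      have h1 : eval 0 (IsNilpotent.exp (-L)) = 1 := by
        have := IsNilpotent.map_exp hL.neg (evalRingHom (0 : B))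
        rw [coe_evalRingHom] at this
        rw [this, eval_neg, hLdef, logOneAdd, eval_finsetSum]
        simp [hv]
      rw [h1]
      simp [hv]
  have hG' : IsNilpotent.exp L = 1 + v := by
    calc IsNilpotent.exp L = IsNilpotent.exp L * (IsNilpotent.exp (-L) * (1 + v)) := by
          rw [hG, mul_one]
      _ = 1 + v := by rw [← mul_assoc, IsNilpotent.exp_mul_exp_neg_self hL, one_mul]
  have h2 := congrArg (evalRingHom (1 : B)) hG'
  rw [IsNilpotent.map_exp hL] at h2
  convert h2 using 2
  · rw [hLdef, logOneAdd, logOneAdd, map_sum]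
    simp [hv]
  · simp [hv]

/-- The factors are truncations of (e^u − 1)/u and log(e^u)/(e^u − 1). A nilpotent u cannot be
cancelled, so a variable is introduced: with p = ∑ u^k X^k/(k+1)! one has exp(uX) = 1 + uXp and
(Xp)' = exp(uX). The derivative of Xp·q is then a geometric sum times 1 + v, that is 1. So Xpq = X,
and X, unlike u, is regular. -/
theorem phi_mul_psi_comm {N : ℕ} {u : B} (hu : u ^ N = 0) :
    (∑ k ∈ range N, ((k + 1).factorial : ℚ)⁻¹ • u ^ k) *
      (∑ k ∈ range N, ((-1 : ℚ) ^ k / (k + 1)) • (IsNilpotent.exp u - 1) ^ k) = 1 := by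
  set p : B[X] := ∑ k ∈ range N, C (((k + 1).factorial : ℚ)⁻¹ • u ^ k) * X ^ k with hp
  have huX : (C u * X : B[X]) ^ N = 0 := by rw [mul_pow, ← C_pow, hu, C_0, zero_mul]
  have hE : IsNilpotent.exp (C u * X : B[X]) = 1 + C u * (X * p) := by
    have huX' : (C u * X : B[X]) ^ (N + 1) = 0 := by rw [pow_succ, huX, zero_mul]
    rw [IsNilpotent.exp_eq_sum huX', sum_range_succ', hp, mul_sum, mul_sum, add_comm]
    congr 1
    · simp
    · refine sum_congr rfl fun k _ => ?_
      rw [← Polynomial.smul_C, smul_mul_assoc, mul_smul_comm, mul_smul_comm, C_pow]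
      congr 1
      ring
  have hE1 : IsNilpotent.exp (C u * X : B[X]) - 1 = C u * (X * p) := by rw [hE]; ring
  have hd : derivative (X * p) = 1 + C u * (X * p) := by
    rw [← hE, IsNilpotent.exp_eq_sum huX, hp, mul_sum, map_sum]
    refine sum_congr rfl fun k _ => ?_
    rw [← Polynomial.smul_C, smul_mul_assoc, mul_smul_comm, ← polyDeriv_apply,
      Derivation.map_smul, polyDeriv_apply, mul_left_comm, ← pow_succ', derivative_C_mul_X_pow,
      Nat.add_sub_cancel, mul_pow, ← C_pow, C_mul, Nat.factorial_succ]
    have : (C ((k + 1 : ℕ) : B)) = algebraMap ℚ B[X] (k + 1 : ℕ) := by simp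
    rw [this, mul_comm (C _) (algebraMap _ _ _), mul_assoc, ← Algebra.smul_def, smul_smul]
    congr 1
    push_cast
    field_simp
  set v : B[X] := C u * (X * p) with hv
  have hvN : v ^ N = 0 := by rw [hv, ← mul_assoc, mul_pow, huX, zero_mul]
  set q : B[X] := ∑ k ∈ range N, ((-1 : ℚ) ^ k / (k + 1)) • v ^ k with hq
  have hpq : X * p * q = X := by
    apply Polynomial.eq_of_derivative_eq_of_coeff_zero
    · have hterm : X * p * q =
          ∑ k ∈ range N, ((-1 : ℚ) ^ k / (k + 1)) • (C (u ^ k) * (X * p) ^ (k + 1)) := by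
        rw [hq, mul_sum]
        refine sum_congr rfl fun k _ => ?_
        rw [mul_smul_comm, hv, mul_pow, C_pow]
        congr 1
        ring
      rw [hterm, map_sum, derivative_X, ← sum_neg_pow_mul hvN, sum_mul]
      refine sum_congr rfl fun k _ => ?_
      rw [← polyDeriv_apply, Derivation.map_smul, polyDeriv_apply, derivative_C_mul,
        derivative_pow_succ, hd, neg_pow v]
      have : (C ((k : B) + 1)) = algebraMap ℚ B[X] (k + 1) := by simp
      rw [this, mul_assoc (algebraMap _ _ _), ← Algebra.smul_def, mul_smul_comm, smul_smul]
      have h3 : ((-1 : ℚ) ^ k / (k + 1)) * (k + 1) = (-1) ^ k := by field_simp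
      rw [h3, Algebra.smul_def]
      simp only [map_pow, map_neg, map_one]
      rw [hv]
      ring
    · simp [mul_assoc]
  have hpq1 : p * q = 1 := by
    have : X * (p * q) = X * 1 := by rw [← mul_assoc, hpq, mul_one]
    exact (Polynomial.isRegular_X (R := B)).left this
  have h2 := congrArg (evalRingHom (1 : B)) hpq1
  rw [map_mul, map_one, hp, hq, ← hE1, map_sum, map_sum] at h2
  convert h2 using 2
  · refine sum_congr rfl fun k _ => ?_
    simp
  · refine sum_congr rfl fun k _ => ?_
    rw [map_rat_smul, map_pow, map_sub, map_one, IsNilpotent.map_exp ⟨N, huX⟩]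
    simp

end CommRing

section Ring

variable {A : Type*} [Ring A] [Algebra ℚ A]

/-- A nilpotent element of a `ℚ`-algebra is the image of a nilpotent element of a commutative
`ℚ`-algebra. -/
theorem exists_comm_lift {N : ℕ} {u : A} (hu : u ^ N = 0) :
    ∃ (B : Type) (_ : CommRing B) (_ : Algebra ℚ B) (f : B →ₐ[ℚ] A) (s : B),
      s ^ N = 0 ∧ f s = u := by
  refine ⟨ℚ[X] ⧸ Ideal.span {(X : ℚ[X]) ^ N}, inferInstance, inferInstance,
    Ideal.Quotient.liftₐ _ (aeval u) ?_, Ideal.Quotient.mk _ X, ?_, ?_⟩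
  · intro a ha
    obtain ⟨c, rfl⟩ := Ideal.mem_span_singleton'.1 ha
    simp [hu]
  · rw [← map_pow, Ideal.Quotient.eq_zero_iff_mem]
    exact Ideal.mem_span_singleton_self _
  · change aeval u X = u
    simp

theorem exp_logOneAdd {N : ℕ} {u : A} (hu : u ^ N = 0) :
    IsNilpotent.exp (logOneAdd N u) = 1 + u := by
  obtain ⟨B, _, _, f, s, hs, rfl⟩ := exists_comm_lift hu
  have := congrArg f (exp_logOneAdd_comm hs)
  rw [IsNilpotent.map_exp (isNilpotent_logOneAdd ⟨N, hs⟩)] at this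
  simpa [logOneAdd] using this

theorem phi_mul_psi {N : ℕ} {u : A} (hu : u ^ N = 0) :
    (∑ k ∈ range N, ((-1 : ℚ) ^ k / (k + 1)) • (IsNilpotent.exp u - 1) ^ k) *
    (∑ k ∈ range N, ((k + 1).factorial : ℚ)⁻¹ • u ^ k) = 1 := by
  obtain ⟨B, _, _, f, s, hs, rfl⟩ := exists_comm_lift hu
  have := congrArg f (phi_mul_psi_comm hs)
  rw [mul_comm, map_mul, map_sum, map_sum, map_one] at this
  convert this using 2
  · refine sum_congr rfl fun k _ => ?_
    rw [map_smul, map_pow, map_sub, map_one, IsNilpotent.map_exp ⟨N, hs⟩]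
  · refine sum_congr rfl fun k _ => ?_
    rw [map_smul, map_pow]

/-- Factor the logarithm as ψ(u)(e^u − 1) and write e^u − 1 = φ(u)u; the factors φ and ψ cancel by
`phi_mul_psi`. -/
theorem logOneAdd_exp_sub_one {N : ℕ} {u : A} (hu : u ^ N = 0) :
    logOneAdd N (IsNilpotent.exp u - 1) = u := by
  have hu' : u ^ (N + 1) = 0 := by rw [pow_succ, hu, zero_mul]
  have h1 : IsNilpotent.exp u - 1 =
      (∑ k ∈ range N, ((k + 1).factorial : ℚ)⁻¹ • u ^ k) * u := by
    rw [IsNilpotent.exp_eq_sum hu', sum_range_succ', sum_mul]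
    simp only [pow_zero, Nat.factorial_zero, Nat.cast_one, inv_one, one_smul, add_sub_cancel_right]
    refine sum_congr rfl fun k _ => ?_
    rw [smul_mul_assoc, ← pow_succ]
  have h2 : logOneAdd N (IsNilpotent.exp u - 1) =
      (∑ k ∈ range N, ((-1 : ℚ) ^ k / (k + 1)) • (IsNilpotent.exp u - 1) ^ k) *
        (IsNilpotent.exp u - 1) := by
    rw [logOneAdd, sum_mul]
    refine sum_congr rfl fun k _ => ?_
    rw [smul_mul_assoc, ← pow_succ]
  rw [h2]
  nth_rw 2 [h1]
  rw [← mul_assoc, phi_mul_psi hu, one_mul]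

theorem exp_injOn {u v : A} (hu : IsNilpotent u) (hv : IsNilpotent v)
    (h : IsNilpotent.exp u = IsNilpotent.exp v) : u = v := by
  obtain ⟨k, hk⟩ := hu
  obtain ⟨l, hl⟩ := hv
  rw [← logOneAdd_exp_sub_one (pow_eq_zero_of_le (le_max_left k l) hk),
    ← logOneAdd_exp_sub_one (pow_eq_zero_of_le (le_max_right k l) hl), h]

/-- The commutator with `z`, as a `ℚ`-linear endomorphism. -/
def adQ (z : A) : Module.End ℚ A := LinearMap.mulLeft ℚ z - LinearMap.mulRight ℚ z

theorem adQ_apply (z w : A) : adQ z w = z * w - w * z := rfl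

theorem commute_mulLeft_mulRight (z w : A) :
    Commute (LinearMap.mulLeft ℚ z) (LinearMap.mulRight ℚ w) := by
  ext a
  simp [mul_assoc]

/-- Left and right multiplication by z commute, and every term of the binomial expansion of the
2K-th power of their difference contains a K-th power of one of them. -/
theorem adQ_pow {z : A} {K : ℕ} (hz : z ^ K = 0) : adQ z ^ (2 * K) = 0 := by
  have h1 : (LinearMap.mulLeft ℚ z) ^ K = 0 := by
    rw [LinearMap.pow_mulLeft, hz, LinearMap.mulLeft_zero_eq_zero]
  have hneg : -(LinearMap.mulRight ℚ z) = LinearMap.mulRight ℚ (-z) := by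
    ext a; simp
  have h2 : (LinearMap.mulRight ℚ (-z)) ^ K = 0 := by
    rw [LinearMap.pow_mulRight, neg_pow, hz, mul_zero, LinearMap.mulRight_zero_eq_zero]
  rw [adQ, sub_eq_add_neg, hneg]
  exact (commute_mulLeft_mulRight z (-z)).add_pow_eq_zero_of_add_le_succ_of_pow_eq_zero
    h1 h2 (by omega)

theorem exp_adQ {z : A} (hz : IsNilpotent z) (w : A) :
    IsNilpotent.exp (adQ z) w = IsNilpotent.exp z * w * IsNilpotent.exp (-z) := by
  obtain ⟨K, hK⟩ := hz
  have hK' : (-z) ^ K = 0 := by rw [neg_pow, hK, mul_zero]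
  have h1 : (LinearMap.mulLeft ℚ z) ^ K = 0 := by
    rw [LinearMap.pow_mulLeft, hK, LinearMap.mulLeft_zero_eq_zero]
  have hneg : -(LinearMap.mulRight ℚ z) = LinearMap.mulRight ℚ (-z) := by
    ext a; simp
  have h2 : (LinearMap.mulRight ℚ (-z)) ^ K = 0 := by
    rw [LinearMap.pow_mulRight, hK', LinearMap.mulRight_zero_eq_zero]
  rw [adQ, sub_eq_add_neg, hneg,
    IsNilpotent.exp_add_of_commute (commute_mulLeft_mulRight z (-z)) ⟨K, h1⟩ ⟨K, h2⟩,
    IsNilpotent.exp_eq_sum h1, IsNilpotent.exp_eq_sum h2, IsNilpotent.exp_eq_sum hK,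
    IsNilpotent.exp_eq_sum hK']
  simp only [LinearMap.pow_mulLeft, LinearMap.pow_mulRight, Module.End.mul_apply,
    LinearMap.sum_apply, LinearMap.smul_apply, LinearMap.mulLeft_apply, LinearMap.mulRight_apply]
  rw [mul_assoc, mul_sum, sum_mul]
  simp only [mul_smul_comm, smul_mul_assoc]

end Ring

/-! ### The derivative of the exponential map -/

section Dexp

variable {R : Type*} [Ring R] [Algebra ℚ R]

/-- The derivative of the exponential map. -/
theorem dexp (D : R →ₗ[ℚ] R) (hD : ∀ a b, D (a * b) = D a * b + a * D b) {z : R}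
    {N : ℕ} (hz : z ^ N = 0) {M : ℕ} (hM : adQ z ^ M = 0) :
    D (IsNilpotent.exp z) * IsNilpotent.exp (-z) =
      (∑ k ∈ range M, ((k + 1).factorial : ℚ)⁻¹ • adQ z ^ k) (D z) := by
  have hD1 : D 1 = 0 := by
    have := hD 1 1
    simpa using this
  have hz' : (-z) ^ N = 0 := by rw [neg_pow, hz, mul_zero]
  have hnil : IsNilpotent (C z * X : R[X]) := ⟨N, by
    rw [(commute_X (C z)).symm.mul_pow, ← C_pow, hz, C_0, zero_mul]⟩
  -- `P`, `E` and `Q` are D(exp(tz)), exp(tz) and exp(−tz) as polynomials in t, with D acting on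
  -- coefficients. The quantity sought is the value of PQ at t = 1.
  set P : R[X] := ∑ i ∈ range N, monomial i ((i.factorial : ℚ)⁻¹ • D (z ^ i)) with hP
  set E : R[X] := ∑ i ∈ range N, monomial i ((i.factorial : ℚ)⁻¹ • z ^ i) with hE
  set Q : R[X] := ∑ i ∈ range N, monomial i ((i.factorial : ℚ)⁻¹ • (-z) ^ i) with hQ
  have hcoeff : ∀ (g : ℕ → R) (i : ℕ), (N ≤ i → g i = 0) →
      (∑ i ∈ range N, monomial i (g i)).coeff i = g i := by
    intro g i hi
    rw [finsetSum_coeff]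
    simp only [coeff_monomial, sum_ite_eq', mem_range]
    split_ifs with h
    · rfl
    · exact (hi (not_lt.1 h)).symm
  have hPc : ∀ i, P.coeff i = (i.factorial : ℚ)⁻¹ • D (z ^ i) := fun i =>
    hcoeff _ i fun h => by rw [pow_eq_zero_of_le h hz, map_zero, smul_zero]
  have hEc : ∀ i, E.coeff i = (i.factorial : ℚ)⁻¹ • z ^ i := fun i =>
    hcoeff _ i fun h => by rw [pow_eq_zero_of_le h hz, smul_zero]
  have hQc : ∀ i, Q.coeff i = (i.factorial : ℚ)⁻¹ • (-z) ^ i := fun i =>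
    hcoeff _ i fun h => by rw [pow_eq_zero_of_le h hz', smul_zero]
  have hfac : ∀ (n : ℕ) (a : R), (((n + 1).factorial : ℚ)⁻¹ • a) * ((n : R) + 1) =
      (n.factorial : ℚ)⁻¹ • a := by
    intro n a
    have : ((n : R) + 1) = algebraMap ℚ R (n + 1) := by simp
    rw [this, ← Algebra.commutes, ← Algebra.smul_def, smul_smul, Nat.factorial_succ]
    congr 1
    push_cast
    field_simp
  have hP' : derivative P = C z * P + C (D z) * E := by
    ext n
    rw [coeff_derivative, hPc, hfac, coeff_add, coeff_C_mul, coeff_C_mul, hPc, hEc, pow_succ', hD,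
      smul_add, mul_smul_comm, mul_smul_comm, add_comm]
  have hQ' : derivative Q = -(Q * C z) := by
    ext n
    rw [coeff_derivative, hQc, hfac, coeff_neg, coeff_mul_C, hQc, pow_succ, smul_mul_assoc,
      ← smul_neg, mul_neg]
  have hEexp : E = IsNilpotent.exp (C z * X : R[X]) := by
    rw [IsNilpotent.exp_eq_sum (k := N), hE]
    · refine sum_congr rfl fun i _ => ?_
      rw [(commute_X (C z)).symm.mul_pow, ← C_pow, C_mul_X_pow_eq_monomial, smul_monomial]
    · rw [(commute_X (C z)).symm.mul_pow, ← C_pow, hz, C_0, zero_mul]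
  have hQexp : Q = IsNilpotent.exp (-(C z * X) : R[X]) := by
    rw [← neg_mul, ← C_neg, IsNilpotent.exp_eq_sum (k := N), hQ]
    · refine sum_congr rfl fun i _ => ?_
      rw [(commute_X (C (-z))).symm.mul_pow, ← C_pow, C_mul_X_pow_eq_monomial, smul_monomial]
    · rw [(commute_X (C (-z))).symm.mul_pow, ← C_pow, hz', C_0, zero_mul]
  have hEQ : E * Q = 1 := by
    rw [hEexp, hQexp, IsNilpotent.exp_mul_exp_neg_self hnil]
  -- The equation F' = [z, F] + Dz with F(0) = 0 determines the coefficients of F = PQ recursively.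
  have hF' : derivative (P * Q) = C z * (P * Q) - (P * Q) * C z + C (D z) := by
    rw [derivative_mul, hP', hQ', add_mul, mul_assoc, mul_assoc, hEQ]
    noncomm_ring
  have hF : ∀ k, (P * Q).coeff (k + 1) = ((k + 1).factorial : ℚ)⁻¹ • (adQ z ^ k) (D z) := by
    intro k
    have hrec : ∀ k, (P * Q).coeff (k + 1) =
        ((k + 1 : ℚ))⁻¹ • (adQ z ((P * Q).coeff k) + (C (D z) : R[X]).coeff k) := by
      intro k
      have h1 := congrArg (fun f => f.coeff k) hF'
      simp only [coeff_derivative, coeff_add, coeff_sub, coeff_C_mul, coeff_mul_C] at h1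
      rw [adQ_apply, ← h1]
      have : ((k : R) + 1) = algebraMap ℚ R (k + 1) := by simp
      rw [this, ← Algebra.commutes, ← Algebra.smul_def, smul_smul, inv_mul_cancel₀ (by positivity),
        one_smul]
    induction k with
    | zero =>
      have h0 : (P * Q).coeff 0 = 0 := by
        rw [mul_coeff_zero, hPc, pow_zero, hD1, smul_zero, zero_mul]
      rw [hrec, h0]
      simp
    | succ k ih =>
      rw [hrec, ih, coeff_C_succ, add_zero, map_smul, smul_smul, pow_succ' (adQ z),
        Module.End.mul_apply, Nat.factorial_succ (k + 1)]
      congr 1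
      push_cast
      rw [mul_inv]
  have heval : eval 1 (P * Q) = D (IsNilpotent.exp z) * IsNilpotent.exp (-z) := by
    have h1 : eval 1 (P * Q) = eval 1 P * eval 1 Q := by
      have := (eval₂RingHom' (RingHom.id R) (1 : R) fun a => Commute.one_right _).map_mul P Q
      simpa [eval₂RingHom'] using this
    rw [h1, hP, hQ, eval_finsetSum, eval_finsetSum, IsNilpotent.exp_eq_sum hz,
      IsNilpotent.exp_eq_sum hz', map_sum]
    simp [eval_monomial]
  -- The range is taken long enough for both the degree of PQ and the cut-off `M`; the terms beyond
  -- `M` vanish because `adQ z ^ M = 0`.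
  rw [← heval, eval_eq_sum_range' (n := max (M + 1) ((P * Q).natDegree + 1)) (by omega)]
  have hbig : ∀ k, M ≤ k → (P * Q).coeff (k + 1) = 0 := fun k hk => by
    rw [hF, pow_eq_zero_of_le hk hM, LinearMap.zero_apply, smul_zero]
  have h0 : (P * Q).coeff 0 = 0 := by
    rw [mul_coeff_zero, hPc, pow_zero, hD1, smul_zero, zero_mul]
  have hsub : range (M + 1) ⊆ range (max (M + 1) ((P * Q).natDegree + 1)) :=
    range_subset_range.2 (le_max_left _ _)
  rw [← sum_subset hsub, sum_range_succ', h0]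
  · simp only [one_pow, mul_one, add_zero, LinearMap.sum_apply, LinearMap.smul_apply, hF]
  · intro k _ hk
    rw [mem_range, not_lt] at hk
    obtain ⟨j, rfl⟩ : ∃ j, k = j + 1 := ⟨k - 1, by omega⟩
    rw [hbig j (by omega), zero_mul]

end Dexp

end NilpotentExp
end

noncomputable section

attribute [local instance] LieRing.ofAssociativeRing

open Finset Polynomial NilpotentExp

/-! ### Nested brackets and Dynkin sums -/

theorem nestedBracket_cons {L : Type*} [LieRing L] (a : L) {l : List L} (hl : l ≠ []) :
    nestedBracket (a :: l) = ⁅a, nestedBracket l⁆ := by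
  cases l with
  | nil => exact absurd rfl hl
  | cons b l => rfl

theorem nestedBracket_map {L L' : Type*} [LieRing L] [LieRing L'] (f : L → L') (h0 : f 0 = 0)
    (hf : ∀ a b, f ⁅a, b⁆ = ⁅f a, f b⁆) (l : List L) :
    nestedBracket (l.map f) = f (nestedBracket l) := by
  induction l with
  | nil => exact h0.symm
  | cons a l ih =>
    cases l with
    | nil => rfl
    | cons b l =>
      rw [List.map_cons, nestedBracket_cons (f a) (l := (b :: l).map f) (by simp), ih,
        nestedBracket_cons a (l := b :: l) (by simp), hf]

theorem bchWord_map {L L' : Type*} (f : L → L') (x y : L) {k : ℕ} (c : Fin k → ℕ × ℕ) :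
    bchWord (f x) (f y) c = (bchWord x y c).map f := by
  simp [bchWord, List.map_flatMap]

theorem length_bchWord {L : Type*} (x y : L) {k : ℕ} (c : Fin k → ℕ × ℕ) :
    (bchWord x y c).length = ∑ i, ((c i).1 + (c i).2) := by
  simp [bchWord, List.length_flatMap, List.map_ofFn, List.sum_ofFn]

theorem bchWord_cons {L : Type*} (x y : L) {k : ℕ} (t : ℕ × ℕ) (c : Fin k → ℕ × ℕ) :
    bchWord x y (Fin.cons t c : Fin (k + 1) → ℕ × ℕ) =
      List.replicate t.1 x ++ (List.replicate t.2 y ++ bchWord x y c) := by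
  simp [bchWord, List.ofFn_succ]

theorem bchTerm_map {L L' : Type*} [LieRing L] [LieAlgebra ℝ L] [LieRing L'] [LieAlgebra ℝ L']
    (f : L →ₗ⁅ℝ⁆ L') (d : ℕ) (x y : L) : f (bchTerm d x y) = bchTerm d (f x) (f y) := by
  simp only [bchTerm, map_sum, map_smul, bchWord_map f,
    nestedBracket_map f (map_zero f) (LieHom.map_lie f)]

theorem bch_map {L L' : Type*} [LieRing L] [LieAlgebra ℝ L] [LieRing L'] [LieAlgebra ℝ L']
    (f : L →ₗ⁅ℝ⁆ L') {x y : L} (h : (Function.support fun d => bchTerm d x y).Finite) :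
    f (bch x y) = bch (f x) (f y) := by
  rw [bch, bch]
  refine ((f : L →ₗ[ℝ] L').toAddMonoidHom.map_finsum h).trans (finsum_congr fun d => ?_)
  exact bchTerm_map f d x y

/-! ### Resummation of Dynkin's series by blocks -/

section Ring

variable {R : Type*} [Ring R] [Algebra ℚ R]

theorem nestedBracket_replicate_append (a : R) (p : ℕ) {l : List R} (hl : l ≠ []) :
    nestedBracket (List.replicate p a ++ l) = (adQ a ^ p) (nestedBracket l) := by
  induction p with
  | zero => rfl
  | succ p ih =>
    rw [List.replicate_succ, List.cons_append, nestedBracket_cons _ (by simp [hl]), ih, pow_succ',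
      Module.End.mul_apply]
    rfl

/-- The non-zero exponents `(p, q)` with `p, q < M`. -/
def dynkinIndex (M : ℕ) : Finset (ℕ × ℕ) := (range M ×ˢ range M).filter fun t => 0 < t.1 + t.2

/-- The sum over `k` blocks in Dynkin's formula, with all exponents less than `M`. -/
def dynkinSum (k M : ℕ) (x y : R) : R :=
  ∑ c ∈ Fintype.piFinset fun _ : Fin k => dynkinIndex M,
    (∏ i, (((c i).1.factorial : ℚ) * ((c i).2.factorial : ℚ)))⁻¹ • nestedBracket (bchWord x y c)

theorem nestedBracket_replicate (a : R) : ∀ p : ℕ,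
    nestedBracket (List.replicate p a) = if p = 1 then a else 0
  | 0 => rfl
  | 1 => rfl
  | p + 2 => by
    rw [if_neg (by omega), List.replicate_succ' , nestedBracket_replicate_append _ _ (by simp),
      pow_succ, Module.End.mul_apply]
    simp [nestedBracket, adQ_apply]

theorem sum_piFinset_fin_succ {α M : Type*} [AddCommMonoid M] {k : ℕ} (B : Finset α)
    (f : (Fin (k + 1) → α) → M) :
    ∑ c ∈ Fintype.piFinset (fun _ : Fin (k + 1) => B), f c =
      ∑ t ∈ B, ∑ c ∈ Fintype.piFinset (fun _ : Fin k => B), f (Fin.cons t c) := by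
  rw [← sum_product']
  refine sum_bij' (fun c _ => (c 0, Fin.tail c)) (fun t _ => Fin.cons t.1 t.2) ?_ ?_ ?_ ?_ ?_
  · intro c hc
    rw [Fintype.mem_piFinset] at hc
    rw [mem_product, Fintype.mem_piFinset]
    exact ⟨hc 0, fun i => hc i.succ⟩
  · intro t ht
    rw [mem_product, Fintype.mem_piFinset] at ht
    rw [Fintype.mem_piFinset]
    intro i
    refine Fin.cases ?_ (fun j => ?_) i
    · simpa using ht.1
    · simpa using ht.2 j
  · intro c _
    exact Fin.cons_self_tail c
  · intro t _
    simp
  · intro c _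
    rw [Fin.cons_self_tail]

/-- The innermost bracket of the word x^p y^q is [y, y] = 0 when q ≥ 2, and for q = 0 only p = 1
survives. The remaining words x^p y contribute (ad x)^p y / p!. -/
theorem dynkinSum_one {M : ℕ} (hM : 2 ≤ M) {x : R} (y : R) (hx : adQ x ^ M = 0) :
    dynkinSum 1 M x y = x + IsNilpotent.exp (adQ x) y := by
  obtain ⟨m, rfl⟩ : ∃ m, M = m + 2 := ⟨M - 2, by omega⟩
  rw [dynkinSum, sum_piFinset_fin_succ]
  simp only [Fintype.piFinset_of_isEmpty, univ_unique, sum_singleton, bchWord_cons]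
  have hempty : ∀ c : Fin 0 → ℕ × ℕ, bchWord x y c = [] := fun c => by simp [bchWord]
  simp only [hempty, List.append_nil, prod_singleton, Fin.default_eq_zero, Fin.cons_zero,
    dynkinIndex]
  rw [sum_filter_of_ne, sum_product, IsNilpotent.exp_eq_sum hx, LinearMap.sum_apply]
  · have hp : ∀ p ∈ range (m + 2), ∑ q ∈ range (m + 2),
        ((p.factorial : ℚ) * (q.factorial : ℚ))⁻¹ •
          nestedBracket (List.replicate p x ++ List.replicate q y) =
        (if p = 1 then x else 0) + ((p.factorial : ℚ)⁻¹ • adQ x ^ p) y := by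
      intro p _
      rw [sum_range_succ', sum_range_succ', sum_eq_zero, zero_add, add_comm]
      · congr 1
        · rw [List.replicate_zero, List.append_nil, nestedBracket_replicate]
          split_ifs with h
          · simp [h]
          · simp
        · rw [nestedBracket_replicate_append _ _ (by simp), nestedBracket_replicate]
          simp
      · intro q _
        rw [nestedBracket_replicate_append _ _ (by simp), nestedBracket_replicate,
          if_neg (by omega), map_zero, smul_zero]
    rw [sum_congr rfl hp, sum_add_distrib]
    congr 1
    simp
  · rintro ⟨p, q⟩ _ h
    by_contra h0
    have hp : p = 0 := by simp at h0; exact h0.1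
    have hq : q = 0 := by simp at h0; exact h0.2
    subst hp hq
    simp [nestedBracket] at h

/-- Prefixing a block x^p y^q to a non-empty word acts by (ad x)^p (ad y)^q. Summed over non-zero
(p, q) with factorial weights this is e^{ad x} e^{ad y} − 1. At least one block has to remain, hence
the index `k + 1` on the right. -/
theorem dynkinSum_succ {k M : ℕ} (hM : 0 < M) {x y : R} (hx : adQ x ^ M = 0)
    (hy : adQ y ^ M = 0) :
    dynkinSum (k + 2) M x y =
      (IsNilpotent.exp (adQ x) * IsNilpotent.exp (adQ y) - 1) (dynkinSum (k + 1) M x y) := by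
  have hE : IsNilpotent.exp (adQ x) * IsNilpotent.exp (adQ y) - 1 =
      ∑ t ∈ dynkinIndex M,
        ((t.1.factorial : ℚ) * (t.2.factorial : ℚ))⁻¹ • (adQ x ^ t.1 * adQ y ^ t.2) := by
    rw [IsNilpotent.exp_eq_sum hx, IsNilpotent.exp_eq_sum hy, sum_mul_sum, ← sum_product']
    -- The exponent (0, 0), excluded from `dynkinIndex`, is the term that cancels the subtracted
    -- identity.
    have h0 : (0, 0) ∈ range M ×ˢ range M := by simp [hM]
    rw [← add_sum_erase _ _ h0]
    simp only [Nat.factorial_zero, Nat.cast_one, inv_one, pow_zero, one_smul, mul_one,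
      add_sub_cancel_left]
    refine sum_congr ?_ fun t _ => ?_
    · ext ⟨p, q⟩
      simp only [dynkinIndex, mem_erase, mem_filter, mem_product, mem_range, ne_eq, Prod.mk.injEq]
      omega
    · rw [smul_mul_assoc, mul_smul_comm, smul_smul, mul_inv]
  rw [hE, dynkinSum, sum_piFinset_fin_succ, LinearMap.sum_apply]
  refine sum_congr rfl fun t _ => ?_
  rw [dynkinSum, map_sum]
  refine sum_congr rfl fun c hc => ?_
  have hne : bchWord x y c ≠ [] := by
    intro h
    have h1 := length_bchWord x y c
    rw [h, List.length_nil] at h1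
    have h2 := (Finset.sum_eq_zero_iff.1 h1.symm) 0 (mem_univ _)
    have h3 := (mem_filter.1 (Fintype.mem_piFinset.1 hc 0)).2
    omega
  rw [bchWord_cons, nestedBracket_replicate_append _ _ (by simp [hne]),
    nestedBracket_replicate_append _ _ hne, Fin.prod_univ_succ]
  simp only [Fin.cons_zero, Fin.cons_succ, map_smul, LinearMap.smul_apply, Module.End.mul_apply,
    smul_smul, mul_inv]
  congr 1
  ring

theorem dynkinSum_eq_pow {M : ℕ} (hM : 2 ≤ M) {x y : R} (hx : adQ x ^ M = 0)
    (hy : adQ y ^ M = 0) (k : ℕ) :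
    dynkinSum (k + 1) M x y =
      ((IsNilpotent.exp (adQ x) * IsNilpotent.exp (adQ y) - 1) ^ k)
        (x + IsNilpotent.exp (adQ x) y) := by
  induction k with
  | zero => rw [dynkinSum_one hM y hx]; rfl
  | succ k ih => rw [dynkinSum_succ (by omega) hx hy, ih, pow_succ']; rfl

omit [Algebra ℚ R] in
-- Since X is central, the power of X records the length of a word. Coefficients of polynomials thus
-- separate the degrees of Dynkin's series.
theorem nestedBracket_map_C_mul_X (l : List R) :
    nestedBracket (l.map fun a => (C a * X : R[X])) = C (nestedBracket l) * X ^ l.length := by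
  induction l with
  | nil => simp [nestedBracket]
  | cons a l ih =>
    cases l with
    | nil => simp [nestedBracket]
    | cons b l =>
      rw [List.map_cons, nestedBracket_cons _ (l := (b :: l).map _) (by simp), ih,
        nestedBracket_cons a (l := b :: l) (by simp), Ring.lie_def, Ring.lie_def, show (a :: b :: l).length = (b :: l).length + 1 from rfl, C_sub, C_mul,
        C_mul, sub_mul, pow_succ']
      set n := (b :: l).length
      have h1 : ∀ (u v : R), (C u * X * (C v * X ^ n) : R[X]) = C u * C v * (X * X ^ n) := by
        intro u v
        rw [mul_assoc, ← mul_assoc X, X_mul, mul_assoc, mul_assoc]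
      have h2 : ∀ (u v : R), (C v * X ^ n * (C u * X) : R[X]) = C v * C u * (X * X ^ n) := by
        intro u v
        rw [mul_assoc, ← mul_assoc (X ^ n), X_pow_mul, mul_assoc, mul_assoc, ← pow_succ,
          ← pow_succ']
      rw [h1, h2]

theorem coeff_dynkinSum (k M d : ℕ) (x y : R) :
    (dynkinSum k M (C x * X : R[X]) (C y * X)).coeff d =
      ∑ c ∈ (Fintype.piFinset fun _ : Fin k => dynkinIndex M).filter
          (fun c => ∑ i, ((c i).1 + (c i).2) = d),
        (∏ i, (((c i).1.factorial : ℚ) * ((c i).2.factorial : ℚ)))⁻¹ •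
          nestedBracket (bchWord x y c) := by
  rw [dynkinSum, finsetSum_coeff, sum_filter]
  refine sum_congr rfl fun c _ => ?_
  rw [bchWord_map (fun a => (C a * X : R[X])), nestedBracket_map_C_mul_X, coeff_smul,
    coeff_C_mul, coeff_X_pow, length_bchWord]
  by_cases h : ∑ i, ((c i).1 + (c i).2) = d
  · rw [if_pos h.symm, if_pos h, mul_one]
  · rw [if_neg (Ne.symm h), if_neg h, mul_zero, smul_zero]

end Ring

/-- Exponents in a word of length d are at most d < M, so nothing is lost by the cut-off M. A word
of k + 1 non-empty blocks has length at least k + 1, so blocks with k ≥ d do not contribute. The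
number of blocks is k + 1 here and k in `bchTerm`, which accounts for the sign. -/
theorem bchTerm_eq_coeff {A : Type*} [Ring A] [Algebra ℝ A] [Algebra ℚ A] {d M N : ℕ}
    (hM : d < M) (hN : d ≤ N) (x y : A) :
    bchTerm d x y = (d : ℚ)⁻¹ • (∑ k ∈ range N, ((-1 : ℚ) ^ k / (k + 1)) •
      dynkinSum (k + 1) M (C x * X : A[X]) (C y * X)).coeff d := by
  have hvanish : ∀ k, d ≤ k →
      (dynkinSum (k + 1) M (C x * X : A[X]) (C y * X)).coeff d = 0 := by
    intro k hk
    rw [coeff_dynkinSum]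
    refine sum_eq_zero fun c hc => ?_
    rw [mem_filter, Fintype.mem_piFinset] at hc
    exfalso
    have h1 : ∑ i : Fin (k + 1), 1 ≤ ∑ i, ((c i).1 + (c i).2) :=
      sum_le_sum fun i _ => (mem_filter.1 (hc.1 i)).2
    rw [hc.2] at h1
    simp at h1
    omega
  rw [finsetSum_coeff, ← sum_subset (range_subset_range.2 hN), smul_sum, bchTerm]
  · have : Icc 1 d = Ico 1 (d + 1) := by rfl
    rw [this, sum_Ico_eq_sum_range]
    simp only [Nat.add_sub_cancel]
    refine sum_congr rfl fun k _ => ?_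
    rw [add_comm 1 k, coeff_smul, coeff_dynkinSum, smul_sum, smul_sum, smul_sum]
    refine sum_congr ?_ fun c _ => ?_
    · ext c
      simp only [mem_filter, Fintype.mem_piFinset, dynkinIndex, mem_product, mem_range]
      constructor
      · rintro ⟨h1, h2, h3⟩
        exact ⟨fun i => ⟨⟨by have := (h1 i).1; omega, by have := (h1 i).2; omega⟩, h2 i⟩, h3⟩
      · rintro ⟨h1, h3⟩
        refine ⟨fun i => ?_, fun i => (h1 i).2, h3⟩
        have := single_le_sum (f := fun i => (c i).1 + (c i).2) (fun _ _ => Nat.zero_le _)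
          (mem_univ i)
        simp only [h3] at this
        omega
    · rw [smul_smul, smul_smul, smul_smul, ← Rat.cast_smul_eq_qsmul ℝ]
      congr 1
      push_cast
      rw [pow_succ, pow_succ]
      field_simp
  · intro k _ hk
    rw [mem_range, not_lt] at hk
    rw [coeff_smul, hvanish k hk, smul_zero]

/-! ### The Campbell-Baker-Hausdorff formula -/

section BCH

variable {A : Type*} [Ring A] [Algebra ℚ A] (I : Submodule ℚ A)

theorem coeff_mul_mem_pow {a b : ℕ} {f g : A[X]} (hf : ∀ i, f.coeff i ∈ I ^ a)
    (hg : ∀ i, g.coeff i ∈ I ^ b) (i : ℕ) : (f * g).coeff i ∈ I ^ (a + b) := by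
  rw [coeff_mul, pow_add]
  exact Submodule.sum_mem _ fun t _ => Submodule.mul_mem_mul (hf _) (hg _)

theorem coeff_pow_mem_pow {f : A[X]} (hf : ∀ i, f.coeff i ∈ I) (k i : ℕ) :
    (f ^ k).coeff i ∈ I ^ k := by
  induction k generalizing i with
  | zero =>
    rw [pow_zero, pow_zero, coeff_one]
    split_ifs
    · exact Submodule.one_le.1 le_rfl
    · exact Submodule.zero_mem _
  | succ k ih =>
    rw [pow_succ]
    exact coeff_mul_mem_pow I ih (b := 1) (by simpa only [pow_one] using hf) i

/-- For non-commuting x and y nilpotency of each is not enough. Working with coefficients in a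
multiplicatively closed I with I^K = 0 makes every expression built from x and y without constant
term nilpotent. -/
theorem pow_eq_zero_of_coeff_mem {K : ℕ} (hK : I ^ K = ⊥) {f : A[X]} (hf : ∀ i, f.coeff i ∈ I) :
    f ^ K = 0 := by
  ext i
  have := coeff_pow_mem_pow I hf K i
  rw [hK, Submodule.mem_bot] at this
  rw [this, coeff_zero]

variable {I}

theorem coeff_pow_succ_mem (hI : I * I ≤ I) {f : A[X]} (hf : ∀ i, f.coeff i ∈ I) (k i : ℕ) :
    (f ^ (k + 1)).coeff i ∈ I := by
  have hle : ∀ k, I ^ (k + 1) ≤ I := by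
    intro k
    induction k with
    | zero => simp
    | succ k ih =>
      rw [pow_succ]
      exact (mul_le_mul_left ih _).trans hI
  exact hle k (coeff_pow_mem_pow I hf (k + 1) i)

theorem coeff_exp_sub_one_mem (hI : I * I ≤ I) {K : ℕ} (hK : I ^ K = ⊥) {f : A[X]}
    (hf : ∀ i, f.coeff i ∈ I) (i : ℕ) : (IsNilpotent.exp f - 1).coeff i ∈ I := by
  have h : f ^ (K + 1) = 0 := by rw [pow_succ, pow_eq_zero_of_coeff_mem I hK hf, zero_mul]
  rw [IsNilpotent.exp_eq_sum h, sum_range_succ']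
  simp only [pow_zero, Nat.factorial_zero, Nat.cast_one, inv_one, one_smul, add_sub_cancel_right]
  rw [finsetSum_coeff]
  refine Submodule.sum_mem _ fun k _ => ?_
  rw [coeff_smul]
  exact I.smul_mem _ (coeff_pow_succ_mem hI hf k i)

theorem coeff_logOneAdd_mem (hI : I * I ≤ I) {f : A[X]} (hf : ∀ i, f.coeff i ∈ I) (N i : ℕ) :
    (logOneAdd N f).coeff i ∈ I := by
  rw [logOneAdd, finsetSum_coeff]
  refine Submodule.sum_mem _ fun k _ => ?_
  rw [coeff_smul]
  exact I.smul_mem _ (coeff_pow_succ_mem hI hf k i)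

theorem coeff_C_mul_X_mem {x : A} (hx : x ∈ I) (i : ℕ) : (C x * X : A[X]).coeff i ∈ I := by
  rw [coeff_C_mul, coeff_X]
  split_ifs
  · simpa using hx
  · simp

theorem derivative_exp_C_mul_X {x : A} {K : ℕ} (hx : x ^ K = 0) :
    derivative (IsNilpotent.exp (C x * X : A[X])) = C x * IsNilpotent.exp (C x * X : A[X]) := by
  have hpow : ∀ i, (C x * X : A[X]) ^ i = C (x ^ i) * X ^ i := fun i => by
    rw [(commute_X (C x)).symm.mul_pow, C_pow]
  have h1 : (C x * X : A[X]) ^ K = 0 := by rw [hpow, hx, C_0, zero_mul]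
  have h2 : (C x * X : A[X]) ^ (K + 1) = 0 := by rw [pow_succ, h1, zero_mul]
  conv_lhs => rw [IsNilpotent.exp_eq_sum h2, sum_range_succ']
  rw [IsNilpotent.exp_eq_sum h1, map_add, map_sum, mul_sum]
  simp only [pow_zero, Nat.factorial_zero, Nat.cast_one, inv_one, one_smul, derivative_one,
    add_zero]
  refine sum_congr rfl fun i _ => ?_
  rw [hpow, hpow, derivative_smul, derivative_C_mul_X_pow, mul_smul_comm, Nat.add_sub_cancel,
    ← mul_assoc, ← C_mul, ← pow_succ', Nat.factorial_succ]
  have : ((i + 1 : ℕ) : A) = algebraMap ℚ A (i + 1) := by simp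
  rw [this, ← Algebra.commutes, ← Algebra.smul_def, ← smul_C, smul_mul_assoc, smul_smul]
  congr 1
  push_cast
  field_simp

theorem mul_conj_eq {R : Type*} [Ring R] {a b e e' f f' : R} (he : e * e' = 1) (hf : f * f' = 1)
    (hb : f * b = b * f) : (a * e * f + e * (f * b)) * (f' * e') = a + e * b * e' := by
  calc (a * e * f + e * (f * b)) * (f' * e')
      = (a * e + e * b) * (f * f') * e' := by rw [hb]; noncomm_ring
    _ = a + e * b * e' := by rw [hf, mul_one, add_mul, mul_assoc a, he, mul_one]

set_option maxHeartbeats 1000000 in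
/-- The logarithm of `exp(tx) exp(ty)` is a polynomial in `t` with known derivative. -/
theorem exists_log_polynomial (hI : I * I ≤ I) {K : ℕ} (hK : I ^ K = ⊥) {x y : A} (hx : x ∈ I)
    (hy : y ∈ I) :
    ∃ Z : A[X], IsNilpotent Z ∧ Z.coeff 0 = 0 ∧
      IsNilpotent.exp Z = IsNilpotent.exp (C x * X) * IsNilpotent.exp (C y * X) ∧
      ∀ M, 2 * K ≤ M → 2 ≤ M → X * derivative Z =
        ∑ k ∈ range M, ((-1 : ℚ) ^ k / (k + 1)) • dynkinSum (k + 1) M (C x * X) (C y * X) := by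
  set X' : A[X] := C x * X with hX'
  set Y' : A[X] := C y * X with hY'
  have hXm : ∀ i, X'.coeff i ∈ I := coeff_C_mul_X_mem hx
  have hYm : ∀ i, Y'.coeff i ∈ I := coeff_C_mul_X_mem hy
  have hXK : X' ^ K = 0 := pow_eq_zero_of_coeff_mem I hK hXm
  have hYK : Y' ^ K = 0 := pow_eq_zero_of_coeff_mem I hK hYm
  have hxK : x ^ K = 0 := by
    have := Submodule.pow_mem_pow I hx K
    rwa [hK, Submodule.mem_bot] at this
  have hyK : y ^ K = 0 := by
    have := Submodule.pow_mem_pow I hy K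
    rwa [hK, Submodule.mem_bot] at this
  set W : A[X] := IsNilpotent.exp X' * IsNilpotent.exp Y' with hW
  have hUm : ∀ i, (W - 1).coeff i ∈ I := by
    intro i
    have h : W - 1 = (IsNilpotent.exp X' - 1) * (IsNilpotent.exp Y' - 1) +
        (IsNilpotent.exp X' - 1) + (IsNilpotent.exp Y' - 1) := by rw [hW]; noncomm_ring
    have hXe := coeff_exp_sub_one_mem hI hK hXm
    have hYe := coeff_exp_sub_one_mem hI hK hYm
    rw [h, coeff_add, coeff_add]
    refine I.add_mem (I.add_mem ?_ (hXe i)) (hYe i)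
    have h2 := coeff_mul_mem_pow I (a := 1) (b := 1) (by simpa only [pow_one] using hXe)
      (by simpa only [pow_one] using hYe) i
    rw [pow_add, pow_one] at h2
    exact hI h2
  have hUK : (W - 1) ^ K = 0 := pow_eq_zero_of_coeff_mem I hK hUm
  set Z := logOneAdd K (W - 1) with hZ
  have hZK : Z ^ K = 0 := pow_eq_zero_of_coeff_mem I hK (coeff_logOneAdd_mem hI hUm K)
  have hZexp : IsNilpotent.exp Z = W := by rw [hZ, exp_logOneAdd hUK]; abel
  have hZn : IsNilpotent Z := ⟨K, hZK⟩
  have hXn : IsNilpotent X' := ⟨K, hXK⟩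
  have hYn : IsNilpotent Y' := ⟨K, hYK⟩
  refine ⟨Z, hZn, ?_, hZexp, ?_⟩
  · let ev : A[X] →+* A := eval₂RingHom' (RingHom.id A) (0 : A) fun a => Commute.zero_right _
    have hev : ∀ f, ev f = f.coeff 0 := fun f => by
      simp [ev, eval₂RingHom', coeff_zero_eq_eval_zero]
    have h1 : ev X' = 0 := by rw [hev, hX']; simp
    have h2 : ev Y' = 0 := by rw [hev, hY']; simp
    have h3 : ev (W - 1) = 0 := by
      rw [map_sub, hW, map_mul, IsNilpotent.map_exp hXn, IsNilpotent.map_exp hYn, h1, h2]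
      simp
    rw [← hev, hZ, logOneAdd, map_sum]
    refine sum_eq_zero fun k _ => ?_
    rw [map_rat_smul, map_pow, h3]
    simp
  · intro M hM hM2
    -- The hypothesis 2K ≤ M enters here, through the exponent in `adQ_pow`.
    have hadZ : adQ Z ^ M = 0 := pow_eq_zero_of_le hM (adQ_pow hZK)
    have hadX : adQ X' ^ M = 0 := pow_eq_zero_of_le hM (adQ_pow hXK)
    have hadY : adQ Y' ^ M = 0 := pow_eq_zero_of_le hM (adQ_pow hYK)
    have hWinv : IsNilpotent.exp (-Z) = IsNilpotent.exp (-Y') * IsNilpotent.exp (-X') := by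
      have h1 : W * (IsNilpotent.exp (-Y') * IsNilpotent.exp (-X')) = 1 := by
        rw [hW, mul_assoc, ← mul_assoc (IsNilpotent.exp Y'), IsNilpotent.exp_mul_exp_neg_self hYn,
          one_mul, IsNilpotent.exp_mul_exp_neg_self hXn]
      calc IsNilpotent.exp (-Z) = IsNilpotent.exp (-Z) *
            (W * (IsNilpotent.exp (-Y') * IsNilpotent.exp (-X'))) := by rw [h1, mul_one]
        _ = _ := by rw [← mul_assoc, ← hZexp, IsNilpotent.exp_neg_mul_exp_self hZn, one_mul]
    have hE : IsNilpotent.exp (adQ Z) = IsNilpotent.exp (adQ X') * IsNilpotent.exp (adQ Y') := by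
      refine LinearMap.ext fun w => ?_
      rw [Module.End.mul_apply, exp_adQ hZn, exp_adQ hYn, exp_adQ hXn, hZexp, hWinv, hW]
      noncomm_ring
    let D : A[X] →ₗ[ℚ] A[X] := (derivative (R := A)).restrictScalars ℚ
    have hD : ∀ f, D f = derivative f := fun _ => rfl
    have h1 := dexp D (fun a b => by rw [hD, hD, hD, derivative_mul]) hZK hadZ
    -- The logarithmic derivative of exp(tx) exp(ty), computed directly by the product rule; `h1`
    -- expresses the same element by φ(ad Z) applied to Z'.
    have h2 : D (IsNilpotent.exp Z) * IsNilpotent.exp (-Z) =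
        C x + IsNilpotent.exp (adQ X') (C y) := by
      have hcomm : IsNilpotent.exp Y' * C y = C y * IsNilpotent.exp Y' := by
        rw [IsNilpotent.exp_eq_sum hYK, sum_mul, mul_sum]
        refine sum_congr rfl fun i _ => ?_
        rw [smul_mul_assoc, mul_smul_comm]
        congr 1
        refine (Commute.pow_left ?_ i).eq
        rw [hY']
        exact (Commute.refl (C y)).mul_left (commute_X (C y))
      rw [exp_adQ hXn, hZexp, hD, hW, derivative_mul, derivative_exp_C_mul_X hxK,
        derivative_exp_C_mul_X hyK, hWinv, ← hX', ← hcomm]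
      exact mul_conj_eq (IsNilpotent.exp_mul_exp_neg_self hXn)
        (IsNilpotent.exp_mul_exp_neg_self hYn) hcomm
    rw [h2] at h1
    have hXE : X * IsNilpotent.exp (adQ X') (C y) = IsNilpotent.exp (adQ X') Y' := by
      rw [exp_adQ hXn, exp_adQ hXn, hY', ← mul_assoc, ← mul_assoc, X_mul, mul_assoc (IsNilpotent.exp X'),
        X_mul, mul_assoc (IsNilpotent.exp X')]
    have hadXc : ∀ f, adQ Z (X * f) = X * adQ Z f := by
      intro f
      rw [adQ_apply, adQ_apply, mul_sub, ← mul_assoc, ← X_mul, mul_assoc, mul_assoc]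
    have hadXp : ∀ k f, (adQ Z ^ k) (X * f) = X * (adQ Z ^ k) f := by
      intro k
      induction k with
      | zero => intro f; rfl
      | succ k ih => intro f; rw [pow_succ, Module.End.mul_apply, hadXc, ih]; rfl
    -- Both sides are multiplied by t, so that the left side becomes the one-block Dynkin sum in tx
    -- and ty.
    have h3 : X' + IsNilpotent.exp (adQ X') Y' =
        (∑ k ∈ range M, ((k + 1).factorial : ℚ)⁻¹ • adQ Z ^ k) (X * derivative Z) := by
      have hXC : X' = X * C x := by rw [hX', X_mul]
      rw [← hXE]
      nth_rw 1 [hXC]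
      rw [← mul_add, h1, LinearMap.sum_apply, LinearMap.sum_apply,
        mul_sum]
      refine sum_congr rfl fun k _ => ?_
      rw [LinearMap.smul_apply, LinearMap.smul_apply, hadXp, mul_smul_comm, hD]
    -- φ(ad Z) is inverted by ψ(ad Z), a series in e^{ad Z} − 1 = e^{ad tx} e^{ad ty} − 1, whose
    -- powers are the sums over several blocks.
    have h4 := congrArg (fun T : Module.End ℚ A[X] => T (X * derivative Z)) (phi_mul_psi hadZ)
    simp only [Module.End.mul_apply, Module.End.one_apply] at h4
    rw [← h3] at h4
    rw [← h4, LinearMap.sum_apply]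
    refine sum_congr rfl fun k _ => ?_
    rw [LinearMap.smul_apply, dynkinSum_eq_pow hM2 hadX hadY, hE]

end BCH

section RealBCH

variable {A : Type*} [Ring A] [Algebra ℝ A] [Algebra ℚ A] {I : Submodule ℚ A}

/-- The Campbell-Baker-Hausdorff formula, in Dynkin's form. -/
theorem exp_bch (hI : I * I ≤ I) {K : ℕ} (hK : I ^ K = ⊥) {x y : A} (hx : x ∈ I) (hy : y ∈ I) :
    (Function.support fun d => bchTerm d x y).Finite ∧
      IsNilpotent.exp (bch x y) = IsNilpotent.exp x * IsNilpotent.exp y := by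
  obtain ⟨Z, hZn, hZ0, hZexp, hZ⟩ := exists_log_polynomial hI hK hx hy
  have hterm : ∀ d, bchTerm d x y = Z.coeff d := by
    intro d
    rcases d with _ | d
    · rw [hZ0]; simp [bchTerm]
    -- The cut-off 2K + d + 2 meets all requirements at once: at least 2K, at least 2, and larger
    -- than d + 1. The coefficient of t^{d+1} in tZ' is d + 1 times that of Z, which is the origin
    -- of the factor 1/d in Dynkin's formula.
    · rw [bchTerm_eq_coeff (d := d + 1) (M := 2 * K + d + 2) (N := 2 * K + d + 2) (by omega)
          (by omega),
        ← hZ (2 * K + d + 2) (by omega) (by omega), coeff_X_mul, coeff_derivative]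
      have : ((d : A) + 1) = algebraMap ℚ A (d + 1) := by simp
      rw [this, ← Algebra.commutes, ← Algebra.smul_def, smul_smul]
      push_cast
      rw [inv_mul_cancel₀ (by positivity), one_smul]
  have hsupp : (Function.support fun d => bchTerm d x y) ⊆ Z.support := by
    intro d hd
    rw [Function.mem_support, hterm] at hd
    exact mem_support_iff.2 hd
  refine ⟨Z.support.finite_toSet.subset hsupp, ?_⟩
  -- Evaluation at t = 1 is a ring homomorphism because 1 is central, although `A` is not
  -- commutative.
  let ev : A[X] →+* A := eval₂RingHom' (RingHom.id A) (1 : A) fun a => Commute.one_right _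
  have hev : ∀ f, ev f = f.eval 1 := fun f => rfl
  have hb : bch x y = ev Z := by
    rw [bch, finsum_eq_sum_of_support_subset _ hsupp, hev, eval_eq_sum, Polynomial.sum]
    refine sum_congr rfl fun d _ => ?_
    rw [hterm, one_pow, mul_one]
  have hnil : ∀ z ∈ I, IsNilpotent (C z * X : A[X]) := fun z hz =>
    ⟨K, pow_eq_zero_of_coeff_mem I hK (coeff_C_mul_X_mem hz)⟩
  rw [hb, ← IsNilpotent.map_exp hZn, hZexp, map_mul, IsNilpotent.map_exp (hnil x hx),
    IsNilpotent.map_exp (hnil y hy), hev, hev]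
  simp

end RealBCH
end

noncomputable section

set_option linter.unusedSectionVars false

/-! ### Vector fields as operators -/

namespace SmoothVF

variable {ι : Type*} [Fintype ι]

theorem op_contDiff (V : SmoothVF ι) {f : (ι → ℝ) → ℝ} (hf : ContDiff ℝ ∞ f) :
    ContDiff ℝ ∞ (V.op f) :=
  (hf.fderiv_right (m := ∞) (by simp)).clm_apply V.contDiff

theorem op_add_left (V W : SmoothVF ι) (f : (ι → ℝ) → ℝ) : (V + W).op f = V.op f + W.op f := by
  funext x
  simp [op]

theorem op_smul_left (c : ℝ) (V : SmoothVF ι) (f : (ι → ℝ) → ℝ) : (c • V).op f = c • V.op f := by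
  funext x
  simp [op]

theorem op_zero_left (f : (ι → ℝ) → ℝ) : (0 : SmoothVF ι).op f = 0 := by
  funext x
  simp [op]

theorem op_add (V : SmoothVF ι) {f g : (ι → ℝ) → ℝ} (hf : ContDiff ℝ ∞ f)
    (hg : ContDiff ℝ ∞ g) : V.op (f + g) = V.op f + V.op g := by
  funext x
  rw [op, fderiv_add (hf.differentiable (by simp) x) (hg.differentiable (by simp) x)]
  rfl

theorem op_const_smul (V : SmoothVF ι) (c : ℝ) (f : (ι → ℝ) → ℝ) :
    V.op (c • f) = c • V.op f := by
  funext x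
  simp only [op, fderiv_const_smul_field]
  rfl

theorem op_zero (V : SmoothVF ι) : V.op 0 = 0 := by
  funext x
  simp [op]

theorem op_lie (V W : SmoothVF ι) {f : (ι → ℝ) → ℝ} (hf : ContDiff ℝ ∞ f) :
    (⁅V, W⁆ : SmoothVF ι).op f = V.op (W.op f) - W.op (V.op f) := by
  funext x
  exact VectorField.fderiv_apply_lieBracket (n := ∞) hf.contDiffAt
    (by rw [minSmoothness_of_isRCLikeNormedField]; exact WithTop.coe_le_coe.2 le_top)
    (W.differentiableAt x) (V.differentiableAt x)

theorem contDiff_coord (k : ι) : ContDiff ℝ ∞ fun x : ι → ℝ => x k := contDiff_apply ℝ ℝ k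

theorem op_coord (V : SmoothVF ι) (k : ι) : V.op (fun x => x k) = fun x => V.1 x k := by
  funext x
  have : HasFDerivAt (fun x : ι → ℝ => x k) (ContinuousLinearMap.proj (R := ℝ) k) x :=
    (ContinuousLinearMap.proj (R := ℝ) (φ := fun _ : ι => ℝ) k).hasFDerivAt
  rw [op, this.fderiv]
  rfl

theorem ext_of_op {V W : SmoothVF ι} (h : ∀ k : ι, V.op (fun x => x k) = W.op fun x => x k) :
    V = W := by
  refine Subtype.ext (funext fun x => funext fun k => ?_)
  have := congrFun (h k) x
  rwa [op_coord, op_coord] at this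

/-- Evaluation of smooth fields at a point. -/
def evalAt (x : ι → ℝ) : SmoothVF ι →ₗ[ℝ] (ι → ℝ) where
  toFun V := V.1 x
  map_add' _ _ := rfl
  map_smul' _ _ := rfl

/-- `V` and `W` are related by the map `φ` if `V (f ∘ φ) = (W f) ∘ φ`. -/
def Related {κ : Type*} [Fintype κ] (φ : (ι → ℝ) → (κ → ℝ)) (V : SmoothVF ι) (W : SmoothVF κ) :
    Prop :=
  ∀ x, fderiv ℝ φ x (V.1 x) = W.1 (φ x)

theorem Related.op {κ : Type*} [Fintype κ] {φ : (ι → ℝ) → (κ → ℝ)} {V : SmoothVF ι}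
    {W : SmoothVF κ} (h : Related φ V W) (hφ : ContDiff ℝ ∞ φ) {f : (κ → ℝ) → ℝ}
    (hf : ContDiff ℝ ∞ f) : V.op (f ∘ φ) = W.op f ∘ φ := by
  funext x
  rw [SmoothVF.op, fderiv_comp x (hf.differentiable (by simp) _) (hφ.differentiable (by simp) _)]
  simp [SmoothVF.op, h x]

theorem related_iff_op {κ : Type*} [Fintype κ] {φ : (ι → ℝ) → (κ → ℝ)} (hφ : ContDiff ℝ ∞ φ)
    {V : SmoothVF ι} {W : SmoothVF κ} :
    Related φ V W ↔ ∀ k : κ, V.op ((fun y => y k) ∘ φ) = W.op (fun y => y k) ∘ φ := by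
  refine ⟨fun h k => h.op hφ (contDiff_coord k), fun h x => funext fun k => ?_⟩
  have h1 := congrFun (h k) x
  rw [op_coord, SmoothVF.op, fderiv_comp x ((contDiff_coord k).differentiable (by simp) _)
    (hφ.differentiable (by simp) _)] at h1
  have : HasFDerivAt (fun x : κ → ℝ => x k) (ContinuousLinearMap.proj (R := ℝ) k) (φ x) :=
    (ContinuousLinearMap.proj (R := ℝ) (φ := fun _ : κ => ℝ) k).hasFDerivAt
  rw [this.fderiv] at h1
  exact h1

theorem Related.lie {κ : Type*} [Fintype κ] {φ : (ι → ℝ) → (κ → ℝ)} (hφ : ContDiff ℝ ∞ φ)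
    {V V' : SmoothVF ι} {W W' : SmoothVF κ} (h : Related φ V W) (h' : Related φ V' W') :
    Related φ ⁅V, V'⁆ ⁅W, W'⁆ := by
  rw [related_iff_op hφ]
  intro k
  have hk := contDiff_coord (ι := κ) k
  rw [op_lie V V' (hk.comp hφ), op_lie W W' hk, h.op hφ hk, h'.op hφ hk,
    h.op hφ (W'.op_contDiff hk), h'.op hφ (W.op_contDiff hk)]
  rfl

end SmoothVF

open SmoothVF

/-! ### Homogeneity -/

section Homogeneous

variable {ι : Type*} [Fintype ι] (σ : ι → ℝ)

/-- `f` is homogeneous of degree `e`. -/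
def IsHomogeneousFn (e : ℝ) (f : (ι → ℝ) → ℝ) : Prop :=
  ∀ lam : ℝ, 0 < lam → ∀ x, f (dil σ lam x) = lam ^ e * f x

variable {σ}

theorem dil_contDiff (lam : ℝ) : ContDiff ℝ ∞ (dil σ lam) :=
  contDiff_pi.2 fun k => contDiff_const.mul (contDiff_apply ℝ ℝ k)

theorem dil_zero (lam : ℝ) : dil σ lam 0 = 0 := by
  funext k; simp [dil]

theorem dil_dil {a b : ℝ} (ha : 0 < a) (hb : 0 < b) (x : ι → ℝ) :
    dil σ a (dil σ b x) = dil σ (a * b) x := by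
  funext k
  simp only [dil]
  rw [Real.mul_rpow ha.le hb.le, mul_assoc]

theorem dil_one (x : ι → ℝ) : dil σ 1 x = x := by
  funext k; simp [dil]

theorem dil_inv_dil {a : ℝ} (ha : 0 < a) (x : ι → ℝ) : dil σ a⁻¹ (dil σ a x) = x := by
  rw [dil_dil (inv_pos.2 ha) ha, inv_mul_cancel₀ ha.ne', dil_one]

theorem tendsto_dil_zero (hσ : ∀ k, 0 < σ k) (x : ι → ℝ) :
    Filter.Tendsto (fun lam : ℝ => dil σ lam x) (nhdsWithin 0 (Set.Ioi 0)) (nhds 0) := by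
  rw [tendsto_pi_nhds]
  intro k
  have h : Filter.Tendsto (fun lam : ℝ => lam ^ σ k * x k) (nhds 0) (nhds (0 ^ σ k * x k)) :=
    ((Real.continuousAt_rpow_const 0 (σ k) (Or.inr (hσ k).le)).tendsto).mul_const _
  rw [Real.zero_rpow (hσ k).ne', zero_mul] at h
  exact h.mono_left nhdsWithin_le_nhds

/-- As λ → 0+, the constant f(x) = λ^{-e} f(δ_λ x) tends to 0 · f(0), by continuity at the origin
and −e > 0. -/
theorem IsHomogeneousFn.eq_zero (hσ : ∀ k, 0 < σ k) {e : ℝ} (he : e < 0) {f : (ι → ℝ) → ℝ}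
    (hf : IsHomogeneousFn σ e f) (hc : Continuous f) : f = 0 := by
  funext x
  have h1 : Filter.Tendsto (fun lam : ℝ => lam ^ (-e) * f (dil σ lam x))
      (nhdsWithin 0 (Set.Ioi 0)) (nhds (0 * f 0)) := by
    refine Filter.Tendsto.mul ?_ ((hc.tendsto 0).comp (tendsto_dil_zero hσ x))
    have h : Filter.Tendsto (fun lam : ℝ => lam ^ (-e)) (nhds 0) (nhds (0 ^ (-e))) :=
      (Real.continuousAt_rpow_const 0 (-e) (Or.inr (by linarith))).tendsto
    rw [Real.zero_rpow (by linarith)] at h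
    exact h.mono_left nhdsWithin_le_nhds
  have h2 : Filter.Tendsto (fun lam : ℝ => lam ^ (-e) * f (dil σ lam x))
      (nhdsWithin 0 (Set.Ioi 0)) (nhds (f x)) := by
    refine Filter.Tendsto.congr' ?_ tendsto_const_nhds
    filter_upwards [self_mem_nhdsWithin] with lam hlam
    rw [hf lam hlam, ← mul_assoc, ← Real.rpow_add hlam, neg_add_cancel, Real.rpow_zero, one_mul]
  rw [zero_mul] at h1
  exact tendsto_nhds_unique h2 h1

theorem isHomogeneousFn_coord (k : ι) : IsHomogeneousFn σ (σ k) fun x => x k := fun _ _ _ => rfl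

theorem IsHomogeneousFn.op {d e : ℝ} {V : SmoothVF ι} (hV : IsHomogeneousVF σ d V)
    {f : (ι → ℝ) → ℝ} (hf : IsHomogeneousFn σ e f) (hc : ContDiff ℝ ∞ f) :
    IsHomogeneousFn σ (e - d) (V.op f) := by
  intro lam hlam x
  have h1 := hV lam hlam f hc x
  have h2 : f ∘ dil σ lam = (lam ^ e) • f := funext fun y => hf lam hlam y
  rw [h2, op_const_smul, Pi.smul_apply, smul_eq_mul] at h1
  rw [Real.rpow_sub hlam, div_mul_eq_mul_div, h1, mul_div_cancel_left₀]
  exact (Real.rpow_pos_of_pos hlam d).ne'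

theorem isHomogeneousVF_iff {d : ℝ} {V : SmoothVF ι} :
    IsHomogeneousVF σ d V ↔ ∀ k, IsHomogeneousFn σ (σ k - d) fun x => V.1 x k := by
  constructor
  · intro h k
    have := IsHomogeneousFn.op h (isHomogeneousFn_coord (σ := σ) k) (contDiff_coord k)
    rwa [op_coord] at this
  · intro h lam hlam f hf x
    have hd : HasFDerivAt (dil σ lam) (ContinuousLinearMap.pi fun k =>
        (lam ^ σ k) • ContinuousLinearMap.proj (R := ℝ) (φ := fun _ : ι => ℝ) k) x := by
      rw [hasFDerivAt_pi]
      intro k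
      exact ((ContinuousLinearMap.proj (R := ℝ) (φ := fun _ : ι => ℝ) k).hasFDerivAt).const_mul _
    have hv : fderiv ℝ (dil σ lam) x (V.1 x) = (lam ^ d) • V.1 (dil σ lam x) := by
      rw [hd.fderiv]
      funext k
      have : V.1 (dil σ lam x) k = lam ^ (σ k - d) * V.1 x k := h k lam hlam x
      simp only [ContinuousLinearMap.coe_pi', _root_.smul_apply,
        ContinuousLinearMap.proj_apply, smul_eq_mul, Pi.smul_apply]
      rw [this, ← mul_assoc, ← Real.rpow_add hlam, add_sub_cancel]
    rw [op, fderiv_comp x (hf.differentiable (by simp) _) hd.differentiableAt,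
      ContinuousLinearMap.comp_apply, hv, map_smul]
    rfl

variable (σ) in
/-- The fields that are homogeneous of degree `d`. -/
def homogeneousVF (d : ℝ) : Submodule ℝ (SmoothVF ι) where
  carrier := {V | IsHomogeneousVF σ d V}
  add_mem' := by
    intro V W hV hW lam hlam f hf x
    rw [op_add_left, op_add_left, Pi.add_apply, Pi.add_apply, hV lam hlam f hf x,
      hW lam hlam f hf x, mul_add]
  zero_mem' := by
    intro lam hlam f hf x
    rw [op_zero_left, op_zero_left]
    simp
  smul_mem' := by
    intro c V hV lam hlam f hf x
    rw [op_smul_left, op_smul_left, Pi.smul_apply, Pi.smul_apply, hV lam hlam f hf x, smul_eq_mul,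
      smul_eq_mul]
    ring

theorem mem_homogeneousVF {d : ℝ} {V : SmoothVF ι} :
    V ∈ homogeneousVF σ d ↔ IsHomogeneousVF σ d V := Iff.rfl

theorem lie_mem_homogeneousVF {d e : ℝ} {V W : SmoothVF ι} (hV : V ∈ homogeneousVF σ d)
    (hW : W ∈ homogeneousVF σ e) : ⁅V, W⁆ ∈ homogeneousVF σ (d + e) := by
  intro lam hlam f hf x
  have hd := dil_contDiff (σ := σ) lam
  have h1 : V.op (f ∘ dil σ lam) = (lam ^ d) • (V.op f ∘ dil σ lam) :=
    funext fun y => hV lam hlam f hf y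
  have h2 : W.op (f ∘ dil σ lam) = (lam ^ e) • (W.op f ∘ dil σ lam) :=
    funext fun y => hW lam hlam f hf y
  rw [op_lie _ _ (hf.comp hd), op_lie _ _ hf, h1, h2, op_const_smul, op_const_smul, Pi.sub_apply,
    Pi.smul_apply, Pi.smul_apply, hV lam hlam _ (W.op_contDiff hf) x,
    hW lam hlam _ (V.op_contDiff hf) x, Real.rpow_add hlam, Pi.sub_apply, smul_eq_mul, smul_eq_mul]
  ring

theorem homogeneousVF_eq_bot (hσ : ∀ k, 0 < σ k) {d : ℝ} (hd : ∀ k, σ k < d) :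
    homogeneousVF σ d = ⊥ := by
  rw [eq_bot_iff]
  intro V hV
  rw [Submodule.mem_bot]
  refine Subtype.ext (funext fun x => funext fun k => ?_)
  have h := (isHomogeneousVF_iff.1 (mem_homogeneousVF.1 hV) k).eq_zero hσ (by linarith [hd k])
    ((continuous_apply k).comp V.contDiff.continuous)
  exact congrFun h x

/-- A homogeneous field of degree `d` has a non-zero `k`-th component at `0` only if `d = σ_k`. -/
theorem eq_weight_of_apply_zero_ne {d : ℝ} {V : SmoothVF ι} (hV : V ∈ homogeneousVF σ d) {k : ι}
    (h : V.1 0 k ≠ 0) : d = σ k := by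
  have h1 := isHomogeneousVF_iff.1 (mem_homogeneousVF.1 hV) k 2 (by norm_num) 0
  rw [dil_zero] at h1
  have h2 : (2 : ℝ) ^ (σ k - d) = 1 := by
    have : (1 - (2 : ℝ) ^ (σ k - d)) * V.1 0 k = 0 := by linarith
    rcases mul_eq_zero.1 this with h3 | h3
    · linarith
    · exact absurd h3 h
  have h3 := congrArg Real.log h2
  rw [Real.log_rpow (by norm_num), Real.log_one] at h3
  rcases mul_eq_zero.1 h3 with h4 | h4
  · linarith
  · have := Real.log_pos (show (1 : ℝ) < 2 by norm_num)
    linarith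

variable (σ) in
/-- The pull-back of fields by `dil σ 2`. -/
def pullDil : Module.End ℝ (SmoothVF ι) where
  toFun V := ⟨fun x => dil σ 2⁻¹ (V.1 (dil σ 2 x)),
    (dil_contDiff _).comp (V.contDiff.comp (dil_contDiff _))⟩
  map_add' V W := Subtype.ext (funext fun x => funext fun k => by simp [dil, mul_add])
  map_smul' c V := Subtype.ext (funext fun x => funext fun k => by simp [dil]; ring)

theorem homogeneousVF_le_eigenspace (d : ℝ) :
    homogeneousVF σ d ≤ (pullDil σ).eigenspace ((2 : ℝ) ^ (-d)) := by
  intro V hV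
  rw [Module.End.mem_eigenspace_iff]
  refine Subtype.ext (funext fun x => funext fun k => ?_)
  have h := isHomogeneousVF_iff.1 (mem_homogeneousVF.1 hV) k 2 (by norm_num) x
  simp only at h
  change (2 : ℝ)⁻¹ ^ σ k * V.1 (dil σ 2 x) k = 2 ^ (-d) * V.1 x k
  rw [h, ← mul_assoc, Real.inv_rpow (by norm_num), ← Real.rpow_neg (by norm_num),
    ← Real.rpow_add (by norm_num)]
  congr 2
  ring

/-- Fields of degree d lie in the eigenspace of `pullDil σ` for 2^{-d}, and these eigenvalues are
distinct. -/
theorem iSupIndep_homogeneousVF : iSupIndep fun k : ℕ => homogeneousVF σ (k : ℝ) := by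
  have h := (Module.End.eigenspaces_iSupIndep (pullDil σ)).comp
    (f := fun k : ℕ => (2 : ℝ) ^ (-(k : ℝ))) ?_
  · exact h.mono fun k => homogeneousVF_le_eigenspace (k : ℝ)
  · intro a b hab
    simp only at hab
    have := congrArg Real.log hab
    rw [Real.log_rpow (by norm_num), Real.log_rpow (by norm_num)] at this
    have h2 := Real.log_pos (show (1 : ℝ) < 2 by norm_num)
    have h3 := mul_right_cancel₀ h2.ne' this
    exact_mod_cast neg_injective h3

end Homogeneous

/-! ### The layers -/

section Layers

variable {ι : Type*} [Fintype ι] {m : ℕ} (X : Fin m → SmoothVF ι)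

theorem lie_mem_layer_succ {k : ℕ} (hk : 1 ≤ k) {U V : SmoothVF ι} (hU : U ∈ layer X 1)
    (hV : V ∈ layer X k) : ⁅U, V⁆ ∈ layer X (k + 1) := by
  obtain ⟨j, rfl⟩ : ∃ j, k = j + 1 := ⟨k - 1, by omega⟩
  exact Submodule.subset_span ⟨U, hU, V, hV, rfl⟩

theorem layer_succ_le {k : ℕ} (hk : 1 ≤ k) {P : Submodule ℝ (SmoothVF ι)}
    (h : ∀ U ∈ layer X 1, ∀ V ∈ layer X k, ⁅U, V⁆ ∈ P) : layer X (k + 1) ≤ P := by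
  obtain ⟨j, rfl⟩ : ∃ j, k = j + 1 := ⟨k - 1, by omega⟩
  refine Submodule.span_le.2 ?_
  rintro _ ⟨U, hU, V, hV, rfl⟩
  exact h U hU V hV

/-- Induction on i through the Jacobi identity [[A, B], V] = [A, [B, V]] − [B, [A, V]] with A in the
first layer. The second term requires the statement for all j. -/
theorem lie_mem_layer {i j : ℕ} {U V : SmoothVF ι} (hU : U ∈ layer X i) (hV : V ∈ layer X j) :
    ⁅U, V⁆ ∈ layer X (i + j) := by
  rcases Nat.eq_zero_or_pos j with rfl | hj
  · have : V = 0 := hV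
    rw [this, lie_zero]; exact Submodule.zero_mem _
  induction i generalizing j U V with
  | zero =>
    have : U = 0 := hU
    rw [this, zero_lie]; exact Submodule.zero_mem _
  | succ i ih =>
    rcases Nat.eq_zero_or_pos i with rfl | hi
    · rw [add_comm]; exact lie_mem_layer_succ X hj hU hV
    · let Q : Submodule ℝ (SmoothVF ι) :=
        { carrier := {U | ∀ V ∈ layer X j, ⁅U, V⁆ ∈ layer X (i + 1 + j)}
          add_mem' := fun ha hb V hV => by
            rw [add_lie]; exact Submodule.add_mem _ (ha V hV) (hb V hV)
          zero_mem' := fun V _ => by rw [zero_lie]; exact Submodule.zero_mem _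
          smul_mem' := fun c U hU V hV => by
            rw [smul_lie]; exact Submodule.smul_mem _ _ (hU V hV) }
      have hle : layer X (i + 1) ≤ Q := by
        refine layer_succ_le X hi fun A hA B hB V hV => ?_
        rw [lie_lie]
        refine Submodule.sub_mem _ ?_ ?_
        · have h1 := lie_mem_layer_succ X (k := i + j) (by omega) hA (ih hB hV hj)
          rwa [show i + j + 1 = i + 1 + j by omega] at h1
        · have h1 := ih hB (lie_mem_layer_succ X hj hA hV) (by omega)
          rwa [show i + (j + 1) = i + 1 + j by omega] at h1
      exact hle hU V hV

/-- From index 1 on each layer is produced from the preceding one. Index 0 is excluded because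
`layer X 0` is zero by convention. -/
theorem layer_eq_bot_of_le {k l : ℕ} (hk : 1 ≤ k) (hkl : k ≤ l) (h : layer X k = ⊥) :
    layer X l = ⊥ := by
  induction l, hkl using Nat.le_induction with
  | base => exact h
  | succ l hl ih =>
    rw [eq_bot_iff]
    refine layer_succ_le X (hk.trans hl) fun U _ V hV => ?_
    rw [ih, Submodule.mem_bot] at hV
    rw [hV, lie_zero]
    exact Submodule.zero_mem _

theorem layer_fg (k : ℕ) : (layer X k).FG := by
  rcases k with _ | k
  · exact Submodule.fg_bot
  induction k with
  | zero => exact Submodule.fg_span (Set.finite_range X)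
  | succ k ih =>
    let B : SmoothVF ι →ₗ[ℝ] SmoothVF ι →ₗ[ℝ] SmoothVF ι :=
      (LieModule.toEnd ℝ (SmoothVF ι) (SmoothVF ι) : SmoothVF ι →ₗ[ℝ] _)
    have h1 : (layer X 1).FG := Submodule.fg_span (Set.finite_range X)
    have h : layer X (k + 1 + 1) = Submodule.map₂ B (layer X 1) (layer X (k + 1)) := by
      refine le_antisymm ?_ ?_
      · exact layer_succ_le X (by omega) fun U hU V hV => Submodule.apply_mem_map₂ B hU hV
      · exact Submodule.map₂_le.2 fun U hU V hV => lie_mem_layer_succ X (by omega) hU hV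
    rw [h]
    exact h1.map₂ B ih

theorem layer_le_lieGen (k : ℕ) : layer X k ≤ (lieGen X).toSubmodule := by
  rcases k with _ | k
  · exact bot_le
  have h1 : layer X 1 ≤ (lieGen X).toSubmodule :=
    Submodule.span_le.2 LieSubalgebra.subset_lieSpan
  induction k with
  | zero => exact h1
  | succ k ih => exact layer_succ_le X (by omega) fun U hU V hV =>
      (lieGen X).lie_mem (h1 hU) (ih hV)

theorem lieGen_eq_iSup : (lieGen X).toSubmodule = ⨆ k, layer X k := by
  refine le_antisymm ?_ (iSup_le (layer_le_lieGen X))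
  let K : LieSubalgebra ℝ (SmoothVF ι) :=
    { (⨆ k, layer X k : Submodule ℝ (SmoothVF ι)) with
      lie_mem' := by
        intro U V hU hV
        change U ∈ (⨆ k, layer X k : Submodule ℝ (SmoothVF ι)) at hU
        change V ∈ (⨆ k, layer X k : Submodule ℝ (SmoothVF ι)) at hV
        change ⁅U, V⁆ ∈ (⨆ k, layer X k : Submodule ℝ (SmoothVF ι))
        refine Submodule.iSup_induction _ (motive := fun U => ⁅U, V⁆ ∈ _) hU ?_ ?_ ?_
        · intro i U hU
          refine Submodule.iSup_induction _ (motive := fun V => ⁅U, V⁆ ∈ _) hV ?_ ?_ ?_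
          · intro j V hV
            exact Submodule.mem_iSup_of_mem (i + j) (lie_mem_layer X hU hV)
          · rw [lie_zero]; exact Submodule.zero_mem _
          · intro A B hA hB
            rw [lie_add]; exact Submodule.add_mem _ hA hB
        · rw [zero_lie]; exact Submodule.zero_mem _
        · intro A B hA hB
          rw [add_lie]; exact Submodule.add_mem _ hA hB }
  have : lieGen X ≤ K := by
    refine LieSubalgebra.lieSpan_le.2 ?_
    rintro _ ⟨k, rfl⟩
    exact Submodule.mem_iSup_of_mem 1 (Submodule.subset_span ⟨k, rfl⟩)
  exact this

variable {X} {σ : ι → ℝ}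

theorem layer_le_homogeneousVF (hX : ∀ k, IsHomogeneousVF σ 1 (X k)) (k : ℕ) :
    layer X k ≤ homogeneousVF σ (k : ℝ) := by
  rcases k with _ | k
  · exact bot_le
  have h1 : layer X 1 ≤ homogeneousVF σ 1 := by
    refine Submodule.span_le.2 ?_
    rintro _ ⟨k, rfl⟩
    exact hX k
  induction k with
  | zero => simpa using h1
  | succ k ih =>
    refine layer_succ_le X (by omega) fun U hU V hV => ?_
    have := lie_mem_homogeneousVF (h1 hU) (ih hV)
    rwa [show ((k + 1 + 1 : ℕ) : ℝ) = 1 + ((k + 1 : ℕ) : ℝ) by push_cast; ring]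

theorem layer_eq_bot (hX : ∀ k, IsHomogeneousVF σ 1 (X k)) (hσ : ∀ k, 0 < σ k) {k : ℕ}
    (hk : ∀ i, σ i < k) : layer X k = ⊥ := by
  rw [eq_bot_iff, ← homogeneousVF_eq_bot hσ hk]
  exact layer_le_homogeneousVF hX k

theorem iSupIndep_layer (hX : ∀ k, IsHomogeneousVF σ 1 (X k)) : iSupIndep (layer X) :=
  iSupIndep_homogeneousVF.mono (layer_le_homogeneousVF hX)

theorem finiteDimensional_lieGen {r : ℕ} (hr : ∀ k, r < k → layer X k = ⊥) :
    FiniteDimensional ℝ ↥(lieGen X) := by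
  have h : (lieGen X).toSubmodule = ⨆ k ∈ Finset.range (r + 1), layer X k := by
    rw [lieGen_eq_iSup]
    refine le_antisymm (iSup_le fun k => ?_) (iSup₂_le fun k _ => le_iSup (layer X) k)
    by_cases hk : k ≤ r
    · exact le_iSup₂_of_le k (Finset.mem_range.2 (by omega)) le_rfl
    · rw [hr k (by omega)]; exact bot_le
  have h2 : (lieGen X).toSubmodule.FG := by
    rw [h]
    exact Submodule.fg_biSup _ _ fun k _ => layer_fg X k
  exact Module.Finite.iff_fg.2 h2

end Layers
end

noncomputable section

set_option linter.unusedSectionVars false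

attribute [local instance] LieRing.ofAssociativeRing

open SmoothVF

/-! ### Exponentials of nilpotent endomorphisms of real vector spaces -/

section ExpEnd

variable {W : Type*} [AddCommGroup W] [Module ℝ W]

/-- The exponential of a real endomorphism with vanishing `K`-th power. -/
def expEnd (K : ℕ) (φ : Module.End ℝ W) : Module.End ℝ W :=
  ∑ i ∈ Finset.range K, (i.factorial : ℝ)⁻¹ • φ ^ i

/-- Real algebras are rational algebras. -/
abbrev ratAlgebraEnd : Algebra ℚ (Module.End ℝ W) :=
  Algebra.compHom (Module.End ℝ W) (algebraMap ℚ ℝ)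

theorem expEnd_eq_exp {K : ℕ} {φ : Module.End ℝ W} (hφ : φ ^ K = 0) :
    let _ := ratAlgebraEnd (W := W)
    expEnd K φ = IsNilpotent.exp φ := by
  intro _
  rw [IsNilpotent.exp_eq_sum hφ, expEnd]
  refine Finset.sum_congr rfl fun i _ => ?_
  rw [← Rat.cast_smul_eq_qsmul ℝ]
  push_cast
  rfl

theorem expEnd_zero {K : ℕ} (hK : (0 : Module.End ℝ W) ^ K = 0) :
    expEnd K (0 : Module.End ℝ W) = 1 := by
  let _ := ratAlgebraEnd (W := W)
  rw [expEnd_eq_exp hK, IsNilpotent.exp_zero]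

theorem expEnd_add {K : ℕ} {φ ψ : Module.End ℝ W} (hφ : φ ^ K = 0) (hψ : ψ ^ K = 0)
    (h : (φ + ψ) ^ K = 0) (hc : Commute φ ψ) :
    expEnd K (φ + ψ) = expEnd K φ * expEnd K ψ := by
  let _ := ratAlgebraEnd (W := W)
  rw [expEnd_eq_exp hφ, expEnd_eq_exp hψ, expEnd_eq_exp h]
  exact IsNilpotent.exp_add_of_commute hc ⟨K, hφ⟩ ⟨K, hψ⟩

theorem expEnd_injOn {K : ℕ} {φ ψ : Module.End ℝ W} (hφ : φ ^ K = 0) (hψ : ψ ^ K = 0)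
    (h : expEnd K φ = expEnd K ψ) : φ = ψ := by
  let _ := ratAlgebraEnd (W := W)
  rw [expEnd_eq_exp hφ, expEnd_eq_exp hψ] at h
  exact NilpotentExp.exp_injOn ⟨K, hφ⟩ ⟨K, hψ⟩ h

/-- The endomorphisms that lower a filtration. -/
def lowering (F : ℕ → Submodule ℝ W) : Submodule ℝ (Module.End ℝ W) where
  carrier := {φ | ∀ k, ∀ f ∈ F (k + 1), φ f ∈ F k}
  add_mem' := fun ha hb k f hf => Submodule.add_mem _ (ha k f hf) (hb k f hf)
  zero_mem' := fun _ _ _ => Submodule.zero_mem _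
  smul_mem' := fun _ _ hφ k f hf => Submodule.smul_mem _ _ (hφ k f hf)

variable {F : ℕ → Submodule ℝ W} (hF : ∀ k, F k ≤ F (k + 1)) {K : ℕ} (h0 : F 0 = ⊥) (hK : F K = ⊤)

include h0 hK in
theorem pow_eq_zero_of_mem_lowering {φ : Module.End ℝ W} (hφ : φ ∈ lowering F) : φ ^ K = 0 := by
  have h : ∀ j, ∀ f ∈ F j, (φ ^ j) f = 0 := by
    intro j
    induction j with
    | zero => intro f hf; rw [h0] at hf; rw [(Submodule.mem_bot ℝ).1 hf, map_zero]
    | succ j ih => intro f hf; rw [pow_succ, Module.End.mul_apply]; exact ih _ (hφ j f hf)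
  exact LinearMap.ext fun f => h K f (by rw [hK]; trivial)

include hF h0 hK in
-- The lowering endomorphisms form a multiplicatively closed space whose K-fold products map F K = ⊤
-- into F 0 = ⊥, so `exp_bch` applies. The nilpotency premise on `bch φ ψ` is met in `bch_spec`,
-- where this element is again the image of a field.
theorem expEnd_bch {φ ψ : Module.End ℝ W} (hφ : φ ∈ lowering F) (hψ : ψ ∈ lowering F) :
    (Function.support fun d => bchTerm d φ ψ).Finite ∧
      (bch φ ψ ^ K = 0 → expEnd K (bch φ ψ) = expEnd K φ * expEnd K ψ) := by
  let _ := ratAlgebraEnd (W := W)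
  let I : Submodule ℚ (Module.End ℝ W) :=
    { carrier := lowering F
      add_mem' := fun ha hb => (lowering F).add_mem ha hb
      zero_mem' := (lowering F).zero_mem
      smul_mem' := fun c a ha => by
        rw [← Rat.cast_smul_eq_qsmul ℝ]
        exact (lowering F).smul_mem _ ha }
  have hmul : I * I ≤ I := by
    rw [Submodule.mul_le]
    intro a ha b hb k f hf
    exact ha k _ (hF k (hb k f hf))
  have hpow : ∀ (j : ℕ) (a : Module.End ℝ W), a ∈ I ^ j → ∀ k, ∀ f ∈ F (k + j), a f ∈ F k := by
    intro j a ha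
    induction ha using Submodule.pow_induction_on_right' with
    | algebraMap q =>
      intro k f hf
      rw [Algebra.algebraMap_eq_smul_one, ← Rat.cast_smul_eq_qsmul ℝ]
      exact Submodule.smul_mem _ _ hf
    | add a b j ha hb iha ihb =>
      intro k f hf
      exact Submodule.add_mem _ (iha k f hf) (ihb k f hf)
    | mul_mem j a ha iha b hb =>
      intro k f hf
      exact iha k (b f) (hb (k + j) f hf)
  have hbot : I ^ K = ⊥ := by
    rw [eq_bot_iff]
    intro a ha
    rw [Submodule.mem_bot]
    refine LinearMap.ext fun f => ?_
    have := hpow K a ha 0 f (by rw [zero_add, hK]; trivial)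
    rwa [h0, Submodule.mem_bot] at this
  obtain ⟨h1, h2⟩ := exp_bch hmul hbot (x := φ) (y := ψ) hφ hψ
  refine ⟨h1, fun h3 => ?_⟩
  rw [expEnd_eq_exp h3, expEnd_eq_exp (pow_eq_zero_of_mem_lowering h0 hK hφ),
    expEnd_eq_exp (pow_eq_zero_of_mem_lowering h0 hK hψ), h2]

end ExpEnd

/-! ### Smooth functions killed by long words in `Lie{X_1, …, X_m}` -/

section Killed

variable {ι : Type*} [Fintype ι] {m : ℕ} (X : Fin m → SmoothVF ι)

/-- The smooth functions that are killed by all products of `k` elements of `Lie{X_1, …, X_m}`. -/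
def killed : ℕ → Submodule ℝ ((ι → ℝ) → ℝ)
  | 0 => ⊥
  | k + 1 =>
    { carrier := {f | ContDiff ℝ ∞ f ∧ ∀ V ∈ lieGen X, V.op f ∈ killed k}
      add_mem' := fun {f g} hf hg => ⟨hf.1.add hg.1, fun V hV => by
        rw [op_add V hf.1 hg.1]; exact Submodule.add_mem _ (hf.2 V hV) (hg.2 V hV)⟩
      zero_mem' := ⟨contDiff_const, fun V _ => by rw [op_zero]; exact Submodule.zero_mem _⟩
      smul_mem' := fun c f hf => ⟨hf.1.const_smul c, fun V hV => by
        rw [op_const_smul]; exact Submodule.smul_mem _ _ (hf.2 V hV)⟩ }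

variable {X}

theorem contDiff_of_mem_killed {k : ℕ} {f : (ι → ℝ) → ℝ} (hf : f ∈ killed X k) :
    ContDiff ℝ ∞ f := by
  rcases k with _ | k
  · have : f = 0 := hf
    rw [this]
    exact contDiff_const
  · exact hf.1

theorem op_mem_killed {k : ℕ} {f : (ι → ℝ) → ℝ} (hf : f ∈ killed X (k + 1)) {V : SmoothVF ι}
    (hV : V ∈ lieGen X) : V.op f ∈ killed X k := hf.2 V hV

theorem killed_le_succ (k : ℕ) : killed X k ≤ killed X (k + 1) := by
  induction k with
  | zero => exact bot_le
  | succ k ih => exact fun f hf => ⟨hf.1, fun V hV => ih (hf.2 V hV)⟩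

theorem op_mem_killed_self {k : ℕ} {f : (ι → ℝ) → ℝ} (hf : f ∈ killed X k) {V : SmoothVF ι}
    (hV : V ∈ lieGen X) : V.op f ∈ killed X k :=
  op_mem_killed (killed_le_succ k hf) hV

/-- Every element of 𝔞 is a sum of fields of degree j ≥ 1, each lowering the degree of a function by
j. After k applications the degree is negative and the function is zero. -/
theorem mem_killed_of_homogeneous {σ : ι → ℝ} (hX : ∀ k, IsHomogeneousVF σ 1 (X k))
    (hσ : ∀ k, 0 < σ k) {k : ℕ} {e : ℝ} (he : e < k) {f : (ι → ℝ) → ℝ}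
    (hf : IsHomogeneousFn σ e f) (hc : ContDiff ℝ ∞ f) : f ∈ killed X k := by
  induction k generalizing e f with
  | zero => exact hf.eq_zero hσ (by simpa using he) hc.continuous
  | succ k ih =>
    refine ⟨hc, fun V hV => ?_⟩
    have hV' : V ∈ (⨆ j, layer X j : Submodule ℝ (SmoothVF ι)) := by
      rw [← lieGen_eq_iSup]; exact hV
    refine Submodule.iSup_induction _ (motive := fun V => V.op f ∈ killed X k) hV' ?_ ?_ ?_
    · intro j V hV
      rcases Nat.eq_zero_or_pos j with rfl | hj
      · have : V = 0 := hV
        rw [this, op_zero_left]; exact Submodule.zero_mem _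
      · refine ih (e := e - j) ?_ (hf.op (layer_le_homogeneousVF hX j hV) hc) (V.op_contDiff hc)
        have : (1 : ℝ) ≤ j := by exact_mod_cast hj
        push_cast at he
        linarith
    · rw [op_zero_left]; exact Submodule.zero_mem _
    · intro A B hA hB
      rw [op_add_left]; exact Submodule.add_mem _ hA hB

variable (X) in
/-- The action of `Lie{X_1, …, X_m}` on `killed X K`. -/
def rho (K : ℕ) : ↥(lieGen X) →ₗ⁅ℝ⁆ Module.End ℝ ↥(killed X K) where
  toFun V :=
    { toFun := fun f => ⟨V.1.op f.1, op_mem_killed_self f.2 V.2⟩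
      map_add' := fun f g => Subtype.ext
        (op_add V.1 (contDiff_of_mem_killed f.2) (contDiff_of_mem_killed g.2))
      map_smul' := fun c f => Subtype.ext (op_const_smul V.1 c f.1) }
  map_add' V W := LinearMap.ext fun f => Subtype.ext (op_add_left V.1 W.1 f.1)
  map_smul' c V := LinearMap.ext fun f => Subtype.ext (op_smul_left c V.1 f.1)
  map_lie' := fun {V W} => LinearMap.ext fun f => Subtype.ext
    (op_lie V.1 W.1 (contDiff_of_mem_killed f.2))

variable (X) in
/-- The filtration of `killed X K` by the `killed X k`. -/
def killedFiltration (K k : ℕ) : Submodule ℝ ↥(killed X K) :=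
  (killed X k).comap (killed X K).subtype

theorem killedFiltration_le_succ (K k : ℕ) :
    killedFiltration X K k ≤ killedFiltration X K (k + 1) := fun _ hf => killed_le_succ k hf

theorem killedFiltration_zero (K : ℕ) : killedFiltration X K 0 = ⊥ := by
  rw [eq_bot_iff]
  intro f hf
  exact Subtype.ext hf

theorem killedFiltration_self (K : ℕ) : killedFiltration X K K = ⊤ := by
  rw [eq_top_iff]
  exact fun f _ => f.2

theorem rho_mem_lowering (K : ℕ) (V : ↥(lieGen X)) : rho X K V ∈ lowering (killedFiltration X K) :=
  fun _ _ hf => op_mem_killed hf V.2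

theorem rho_pow_eq_zero (K : ℕ) (V : ↥(lieGen X)) : rho X K V ^ K = 0 :=
  pow_eq_zero_of_mem_lowering (killedFiltration_zero K) (killedFiltration_self K)
    (rho_mem_lowering K V)

/-- The coordinate functions, as elements of `killed X K`. -/
def coordFn {K : ℕ} (hK : ∀ k : ι, (fun x : ι → ℝ => x k) ∈ killed X K) (k : ι) :
    ↥(killed X K) := ⟨fun x => x k, hK k⟩

/-- A field is determined by its action on the coordinates, which belong to `killed X K`. Identities
between operators can therefore be pulled back to 𝔞. -/
theorem rho_injective {K : ℕ} (hK : ∀ k : ι, (fun x : ι → ℝ => x k) ∈ killed X K) :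
    Function.Injective (rho X K) := by
  intro V W h
  refine Subtype.ext (ext_of_op fun k => ?_)
  exact congrArg Subtype.val (congrArg (fun φ => φ (coordFn hK k)) h)

variable (X) in
/-- The function `exp(V) f`, for `f` killed by products of `K` fields. -/
def expAct (K : ℕ) (V : ↥(lieGen X)) : Module.End ℝ ↥(killed X K) := expEnd K (rho X K V)

theorem expAct_smul_apply {K : ℕ} (t : ℝ) (V : ↥(lieGen X)) (f : ↥(killed X K)) (x : ι → ℝ) :
    (expAct X K (t • V) f).1 x =
      ∑ i ∈ Finset.range K, (i.factorial : ℝ)⁻¹ * t ^ i * ((rho X K V ^ i) f).1 x := by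
  rw [expAct, expEnd, LinearMap.sum_apply, AddSubmonoidClass.coe_finsetSum,
    Finset.sum_apply]
  refine Finset.sum_congr rfl fun i _ => ?_
  rw [map_smul, smul_pow, LinearMap.smul_apply, LinearMap.smul_apply, smul_smul]
  rfl

theorem expAct_apply {K : ℕ} (V : ↥(lieGen X)) (f : ↥(killed X K)) (x : ι → ℝ) :
    (expAct X K V f).1 x =
      ∑ i ∈ Finset.range K, (i.factorial : ℝ)⁻¹ * ((rho X K V ^ i) f).1 x := by
  have := expAct_smul_apply 1 V f x
  simpa using this

theorem expAct_zero {K : ℕ} : expAct X K 0 = 1 := by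
  have h := rho_pow_eq_zero K (0 : ↥(lieGen X))
  rw [map_zero] at h
  rw [expAct, map_zero, expEnd_zero h]

theorem expAct_add_smul {K : ℕ} (s t : ℝ) (V : ↥(lieGen X)) :
    expAct X K ((s + t) • V) = expAct X K (s • V) * expAct X K (t • V) := by
  have h := rho_pow_eq_zero K (s • V + t • V)
  rw [map_add] at h
  rw [expAct, expAct, expAct, add_smul, map_add]
  refine expEnd_add (rho_pow_eq_zero K _) (rho_pow_eq_zero K _) h ?_
  rw [map_smul, map_smul]
  exact ((Commute.refl _).smul_left _).smul_right _

theorem hasDerivAt_expAct {K : ℕ} (V : ↥(lieGen X)) (f : ↥(killed X K)) (x : ι → ℝ) (s : ℝ) :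
    HasDerivAt (fun t => (expAct X K (t • V) f).1 x) ((expAct X K (s • V) (rho X K V f)).1 x) s := by
  simp only [expAct_smul_apply]
  have h : ∀ i ∈ Finset.range K, HasDerivAt
      (fun t : ℝ => (i.factorial : ℝ)⁻¹ * t ^ i * ((rho X K V ^ i) f).1 x)
      ((i.factorial : ℝ)⁻¹ * (i * s ^ (i - 1)) * ((rho X K V ^ i) f).1 x) s := fun i _ =>
    ((hasDerivAt_pow i s).const_mul _).mul_const _
  refine (HasDerivAt.fun_sum h).congr_deriv ?_
  rcases K with _ | K
  · simp
  rw [Finset.sum_range_succ', Finset.sum_range_succ]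
  -- Differentiation shifts the Taylor polynomial by one; the missing top term contains the K-th
  -- power of the action and vanishes.
  have hz : (rho X (K + 1) V ^ K) (rho X (K + 1) V f) = 0 := by
    rw [← Module.End.mul_apply, ← pow_succ, rho_pow_eq_zero]; rfl
  rw [hz]
  simp only [Nat.cast_zero, zero_mul, mul_zero, add_zero, ZeroMemClass.coe_zero, Pi.zero_apply]
  refine Finset.sum_congr rfl fun i _ => ?_
  rw [pow_succ (rho X (K + 1) V), Module.End.mul_apply, Nat.factorial_succ, Nat.add_sub_cancel]
  push_cast
  field_simp

/-! ### Flows -/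

/-- Functions in `killed X K` along integral curves. -/
theorem apply_integralCurve {K : ℕ} (V : ↥(lieGen X)) {γ : ℝ → ι → ℝ} {ε : ℝ} (hε : 0 < ε)
    (hγ : ∀ t ∈ Set.Ioo (-ε) ε, HasDerivAt γ (V.1.1 (γ t)) t) {t : ℝ} (ht : t ∈ Set.Ioo (-ε) ε)
    (f : ↥(killed X K)) : f.1 (γ t) = (expAct X K (t • V) f).1 (γ 0) := by
  -- Along an integral curve, s ↦ (exp(−sV) g)(γ(s)) is constant: moving along γ and differentiating
  -- the exponential contribute opposite sums. The choice g = exp(tV) f then gives the claim, and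
  -- with coordinates for f it also gives uniqueness of integral curves.
  have key : ∀ g : ↥(killed X K),
      (expAct X K ((-t) • V) g).1 (γ t) = (expAct X K ((-0 : ℝ) • V) g).1 (γ 0) := by
    intro g
    have hd : ∀ s ∈ Set.Ioo (-ε) ε,
        HasDerivAt (fun s => (expAct X K ((-s) • V) g).1 (γ s)) 0 s := by
      intro s hs
      simp only [expAct_smul_apply]
      have h : ∀ i ∈ Finset.range K, HasDerivAt
          (fun s : ℝ => (i.factorial : ℝ)⁻¹ * (-s) ^ i * ((rho X K V ^ i) g).1 (γ s))
          ((i.factorial : ℝ)⁻¹ * (i * (-s) ^ (i - 1) * (-1)) * ((rho X K V ^ i) g).1 (γ s) +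
            (i.factorial : ℝ)⁻¹ * (-s) ^ i * ((rho X K V ^ (i + 1)) g).1 (γ s)) s := by
        intro i _
        have h1 : HasDerivAt (fun s : ℝ => (-s) ^ i) (i * (-s) ^ (i - 1) * (-1)) s :=
          (hasDerivAt_neg s).fun_pow i
        have hsm : ContDiff ℝ ∞ ((rho X K V ^ i) g).1 := contDiff_of_mem_killed (Subtype.property _)
        have h2 := ((hsm.differentiable (by simp) (γ s)).hasFDerivAt).comp_hasDerivAt s (hγ s hs)
        have h3 : (fderiv ℝ ((rho X K V ^ i) g).1 (γ s)) (V.1.1 (γ s)) =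
            ((rho X K V ^ (i + 1)) g).1 (γ s) := by
          rw [pow_succ', Module.End.mul_apply]; rfl
        rw [h3] at h2
        exact (h1.const_mul _).mul h2
      refine (HasDerivAt.fun_sum h).congr_deriv ?_
      rw [Finset.sum_add_distrib]
      rcases K with _ | K
      · simp
      rw [Finset.sum_range_succ', Finset.sum_range_succ (fun i => (i.factorial : ℝ)⁻¹ * (-s) ^ i *
        ((rho X (K + 1) V ^ (i + 1)) g).1 (γ s)), rho_pow_eq_zero]
      have hneg : ∀ i ∈ Finset.range K,
          (((i + 1).factorial : ℝ)⁻¹ * (((i + 1 : ℕ) : ℝ) * (-s) ^ (i + 1 - 1) * (-1)) *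
            ((rho X (K + 1) V ^ (i + 1)) g).1 (γ s)) =
          -((i.factorial : ℝ)⁻¹ * (-s) ^ i * ((rho X (K + 1) V ^ (i + 1)) g).1 (γ s)) := by
        intro i _
        rw [Nat.factorial_succ, Nat.add_sub_cancel]
        push_cast
        field_simp
      rw [Finset.sum_congr rfl hneg, Finset.sum_neg_distrib]
      simp
    refine IsOpen.is_const_of_deriv_eq_zero (f := fun s => (expAct X K ((-s) • V) g).1 (γ s))
      isOpen_Ioo isPreconnected_Ioo
      (fun s hs => (hd s hs).differentiableAt.differentiableWithinAt)
      (fun s hs => (hd s hs).deriv) ht ⟨by linarith, hε⟩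
  have h1 := key (expAct X K (t • V) f)
  rwa [neg_zero, zero_smul, expAct_zero, ← Module.End.mul_apply, ← expAct_add_smul, neg_add_cancel,
    zero_smul, expAct_zero] at h1

variable {K : ℕ} (hK : ∀ k : ι, (fun x : ι → ℝ => x k) ∈ killed X K)

/-- The flow of `V`, given by its Taylor polynomial. -/
def flow (V : ↥(lieGen X)) (x : ι → ℝ) : ι → ℝ := fun k => (expAct X K V (coordFn hK k)).1 x

theorem continuous_expAct_smul (V : ↥(lieGen X)) (f : ↥(killed X K)) (x : ι → ℝ) :
    Continuous fun t : ℝ => (expAct X K (t • V) f).1 x :=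
  continuous_iff_continuousAt.2 fun s => (hasDerivAt_expAct V f x s).continuousAt

/-- The flow is defined through coordinates only; the point is that it transports every function of
`killed X K`. The times at which this holds form a closed set containing 0. The set is open: the
local integral curve through a point already reached satisfies the identity by
`apply_integralCurve`, and its coordinates identify it with the polynomial flow. -/
theorem apply_flow_smul (V : ↥(lieGen X)) (x : ι → ℝ) (s : ℝ) (f : ↥(killed X K)) :
    f.1 (flow hK (s • V) x) = (expAct X K (s • V) f).1 x := by
  let S : Set ℝ := {s | ∀ f : ↥(killed X K), f.1 (flow hK (s • V) x) = (expAct X K (s • V) f).1 x}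
  have h0 : (0 : ℝ) ∈ S := by
    intro f
    have : flow hK ((0 : ℝ) • V) x = x := by
      funext k
      rw [flow, zero_smul, expAct_zero]; rfl
    rw [this, zero_smul, expAct_zero]; rfl
  have hclosed : IsClosed S := by
    have : S = ⋂ f : ↥(killed X K),
        {s | f.1 (flow hK (s • V) x) = (expAct X K (s • V) f).1 x} := by
      ext s; simp [S]
    rw [this]
    refine isClosed_iInter fun f => isClosed_eq ?_ (continuous_expAct_smul V f x)
    exact (contDiff_of_mem_killed f.2).continuous.comp
      (continuous_pi fun k => continuous_expAct_smul V _ x)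
  have hopen : IsOpen S := by
    rw [Metric.isOpen_iff]
    intro s hs
    obtain ⟨γ, hγ0, ε, hε, hγ⟩ :=
      ContDiffAt.exists_forall_mem_closedBall_exists_eq_forall_mem_Ioo_hasDerivAt₀
        (f := V.1.1) (x₀ := flow hK (s • V) x) (V.1.contDiff.contDiffAt.of_le (by
          exact_mod_cast (le_top : (1 : ℕ∞) ≤ ⊤))) 0
    rw [zero_sub, zero_add] at hγ
    refine ⟨ε, hε, fun u hu => ?_⟩
    rw [Metric.mem_ball, Real.dist_eq, abs_lt] at hu
    have hmem : u - s ∈ Set.Ioo (-ε) ε := ⟨by linarith, by linarith⟩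
    have h1 : ∀ f : ↥(killed X K), f.1 (γ (u - s)) = (expAct X K (u • V) f).1 x := by
      intro f
      rw [apply_integralCurve V hε hγ hmem f, hγ0, hs (expAct X K ((u - s) • V) f),
        ← Module.End.mul_apply, ← expAct_add_smul, add_sub_cancel]
    have h2 : γ (u - s) = flow hK (u • V) x := funext fun k => h1 (coordFn hK k)
    intro f
    rw [← h2, h1]
  have huniv : S = Set.univ := IsClopen.eq_univ ⟨hclosed, hopen⟩ ⟨0, h0⟩
  have : s ∈ S := by rw [huniv]; trivial
  exact this f

theorem apply_flow (V : ↥(lieGen X)) (x : ι → ℝ) (f : ↥(killed X K)) :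
    f.1 (flow hK V x) = (expAct X K V f).1 x := by
  have := apply_flow_smul hK V x 1 f
  rwa [one_smul] at this

theorem isGlobalCurveFrom_flow (V : ↥(lieGen X)) (x : ι → ℝ) :
    IsGlobalCurveFrom V.1 x fun t => flow hK (t • V) x := by
  refine ⟨?_, fun s => ?_⟩
  · funext k
    simp only [flow]
    rw [zero_smul, expAct_zero]; rfl
  · rw [hasDerivAt_pi]
    intro k
    have h := hasDerivAt_expAct V (coordFn hK k) x s
    rw [← apply_flow_smul hK] at h
    have h2 : (rho X K V (coordFn hK k)).1 = fun x => V.1.1 x k := op_coord V.1 k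
    rw [h2] at h
    exact h

/-- The curve chosen in the definition of `exp` is unspecified; `apply_integralCurve` on coordinates
shows that every global integral curve agrees with the flow. The interval (−2, 2) only has to
contain time 1. -/
theorem exp_eq_flow (V : ↥(lieGen X)) (x : ι → ℝ) : SmoothVF.exp V.1 x = flow hK V x := by
  have hex : ∃ γ : ℝ → ι → ℝ, IsGlobalCurveFrom V.1 x γ := ⟨_, isGlobalCurveFrom_flow hK V x⟩
  rw [SmoothVF.exp, dif_pos hex]
  obtain ⟨h0, h1⟩ := hex.choose_spec
  funext k
  have := apply_integralCurve V (γ := hex.choose) (ε := 2) (by norm_num) (fun t _ => h1 t) (t := 1)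
    (by constructor <;> norm_num) (coordFn hK k)
  rw [one_smul, h0] at this
  exact this

/-! ### The Campbell-Baker-Hausdorff operation on `Lie{X_1, …, X_m}` -/

include hK

/-- The formula holds for the images under `rho`. Injectivity of `rho` brings finiteness of the
series back to 𝔞, and only then can `rho` be passed through the sum. -/
theorem bch_spec (a b : ↥(lieGen X)) :
    (Function.support fun d => bchTerm d a b).Finite ∧
      expAct X K (bch a b) = expAct X K a * expAct X K b := by
  obtain ⟨h1, h2⟩ := expEnd_bch (killedFiltration_le_succ K) (killedFiltration_zero K)
    (killedFiltration_self K) (rho_mem_lowering K a) (rho_mem_lowering K b)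
  have hsupp : (Function.support fun d => bchTerm d a b).Finite := by
    refine h1.subset fun d hd => ?_
    rw [Function.mem_support] at hd ⊢
    rw [← bchTerm_map]
    intro h
    exact hd (rho_injective hK (h.trans (map_zero _).symm))
  refine ⟨hsupp, ?_⟩
  have hmap := bch_map (rho X K) hsupp
  have h3 := rho_pow_eq_zero K (bch a b)
  rw [hmap] at h3
  rw [expAct, hmap, h2 h3]
  rfl

theorem expAct_injective : Function.Injective (expAct X K) := fun a b h =>
  rho_injective hK (expEnd_injOn (rho_pow_eq_zero K a) (rho_pow_eq_zero K b) h)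

theorem bch_assoc (a b c : ↥(lieGen X)) : bch (bch a b) c = bch a (bch b c) := by
  apply expAct_injective hK
  simp only [(bch_spec hK _ _).2, mul_assoc]

theorem zero_bch (a : ↥(lieGen X)) : bch 0 a = a := by
  apply expAct_injective hK
  rw [(bch_spec hK _ _).2, expAct_zero, one_mul]

theorem bch_zero (a : ↥(lieGen X)) : bch a 0 = a := by
  apply expAct_injective hK
  rw [(bch_spec hK _ _).2, expAct_zero, mul_one]

theorem expAct_mul_neg (a : ↥(lieGen X)) : expAct X K a * expAct X K (-a) = 1 := by
  have := expAct_add_smul (K := K) 1 (-1) a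
  rwa [add_neg_cancel, zero_smul, expAct_zero, one_smul, neg_one_smul, eq_comm] at this

theorem bch_neg (a : ↥(lieGen X)) : bch a (-a) = 0 := by
  apply expAct_injective hK
  rw [(bch_spec hK _ _).2, expAct_zero, expAct_mul_neg hK]

theorem neg_bch (a : ↥(lieGen X)) : bch (-a) a = 0 := by
  have := bch_neg hK (-a)
  rwa [neg_neg] at this

/-- The operator exp(a) exp(b) applied to x_k is exp(a) applied to the function exp(b) x_k, that is,
this function evaluated on the flow of a. Hence a flows first. -/
theorem flow_bch (a b : ↥(lieGen X)) (x : ι → ℝ) :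
    flow hK (bch a b) x = flow hK b (flow hK a x) := by
  funext k
  rw [flow, (bch_spec hK a b).2, Module.End.mul_apply, ← apply_flow hK]
  rfl

theorem map_bch (φ : ↥(lieGen X) →ₗ⁅ℝ⁆ ↥(lieGen X)) (a b : ↥(lieGen X)) :
    φ (bch a b) = bch (φ a) (φ b) := bch_map φ (bch_spec hK a b).1

end Killed
end

noncomputable section

set_option linter.unusedSectionVars false

attribute [local instance] LieRing.ofAssociativeRing

open SmoothVF

/-! ### Vanishing of long brackets -/

section LongBrackets

variable {W : Type*} [AddCommGroup W] [Module ℝ W] {F : ℕ → Submodule ℝ W}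

theorem nestedBracket_lowers (hF : ∀ k, F k ≤ F (k + 1)) (l : List (Module.End ℝ W))
    (hl : ∀ φ ∈ l, φ ∈ lowering F) :
    ∀ k, ∀ f ∈ F (k + l.length), nestedBracket l f ∈ F k := by
  match l with
  | [] => intro k f _; exact Submodule.zero_mem _
  | [a] => intro k f hf; exact hl a (by simp) k f hf
  | a :: b :: l =>
    intro k f hf
    have ih := nestedBracket_lowers hF (b :: l) fun φ hφ => hl φ (by simp_all)
    have ha := hl a (by simp)
    change (a * nestedBracket (b :: l) - nestedBracket (b :: l) * a) f ∈ F k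
    refine Submodule.sub_mem _ (ha k _ (ih (k + 1) f ?_)) (ih k _ (ha _ f ?_))
    · rw [List.length_cons] at hf
      rwa [show k + 1 + (b :: l).length = k + ((b :: l).length + 1) by ring]
    · exact hf

theorem bchTerm_eq_zero_of_lowering (hF : ∀ k, F k ≤ F (k + 1)) {K : ℕ} (h0 : F 0 = ⊥)
    (hK : F K = ⊤) {φ ψ : Module.End ℝ W} (hφ : φ ∈ lowering F) (hψ : ψ ∈ lowering F) {d : ℕ}
    (hd : K ≤ d) : bchTerm d φ ψ = 0 := by
  have hmono : Monotone F := monotone_nat_of_le_succ hF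
  refine Finset.sum_eq_zero fun k _ => ?_
  rw [Finset.sum_eq_zero, smul_zero]
  intro c hc
  have hc := (Finset.mem_filter.1 hc).2.2
  have : nestedBracket (bchWord φ ψ c) = 0 := by
    refine LinearMap.ext fun f => ?_
    have h := nestedBracket_lowers hF (bchWord φ ψ c) (by
      intro χ hχ
      simp only [bchWord, List.mem_flatMap, List.mem_append, List.mem_replicate] at hχ
      obtain ⟨t, _, ⟨_, rfl⟩ | ⟨_, rfl⟩⟩ := hχ
      · exact hφ
      · exact hψ) 0 f (by
        rw [zero_add, length_bchWord, hc]
        exact hmono hd (by rw [hK]; trivial))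
    rwa [h0, Submodule.mem_bot] at h
  rw [this, smul_zero]

end LongBrackets

section UniformBch

variable {ι : Type*} [Fintype ι] {m : ℕ} {X : Fin m → SmoothVF ι}
  {K : ℕ} (hK : ∀ k : ι, (fun x : ι → ℝ => x k) ∈ killed X K)

include hK in
-- A bracket of length at least K lowers the filtration by K steps and is zero. The truncation order
-- is uniform in a and b, which gives smoothness of the group law.
theorem bch_eq_sum_range (a b : ↥(lieGen X)) :
    bch a b = ∑ d ∈ Finset.range K, bchTerm d a b := by
  refine finsum_eq_sum_of_support_subset _ fun d hd => ?_
  rw [Finset.coe_range, Set.mem_Iio]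
  by_contra h
  refine hd (rho_injective hK ?_)
  rw [bchTerm_map, map_zero]
  exact bchTerm_eq_zero_of_lowering (killedFiltration_le_succ K) (killedFiltration_zero K)
    (killedFiltration_self K) (rho_mem_lowering K a) (rho_mem_lowering K b) (not_lt.1 h)

/-- Maps intertwine the flows of related fields. -/
theorem Related.apply_flow {φ : (ι → ℝ) → (ι → ℝ)} (hφ : ContDiff ℝ ∞ φ) {V W : ↥(lieGen X)}
    (h : Related φ V.1 W.1) (x : ι → ℝ) : φ (flow hK V x) = flow hK W (φ x) := by
  obtain ⟨h0, h1⟩ := isGlobalCurveFrom_flow hK V x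
  funext k
  have := apply_integralCurve W (γ := fun t => φ (flow hK (t • V) x)) (ε := 2) (by norm_num)
    (fun t _ => by
      have h2 := ((hφ.differentiable (by simp) _).hasFDerivAt).comp_hasDerivAt t (h1 t)
      rwa [h] at h2) (t := 1) (by constructor <;> norm_num) (coordFn hK k)
  rw [one_smul, one_smul] at this
  simp only at h0
  rw [h0] at this
  exact this

end UniformBch

/-! ### Folland's group -/

namespace LiftingFrame

variable {n m N p : ℕ} {X : Fin m → SmoothVF (Fin n)} (F : LiftingFrame X N p)

theorem Phi_eq (a : Fin N → ℝ) : F.Phi a = F.basis.equivFun.symm a := by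
  rw [Module.Basis.equivFun_symm_apply, Phi]

theorem equivFun_Phi (a : Fin N → ℝ) : F.basis.equivFun (F.Phi a) = a := by
  rw [Phi_eq, LinearEquiv.apply_symm_apply]

theorem Phi_mulA (a b : Fin N → ℝ) : F.Phi (F.mulA a b) = bch (F.Phi a) (F.Phi b) := by
  rw [Phi_eq, mulA, LinearEquiv.symm_apply_apply]

theorem Phi_injective : Function.Injective F.Phi := fun a b h => by
  rw [← F.equivFun_Phi a, h, F.equivFun_Phi]

theorem Phi_zero : F.Phi 0 = 0 := by rw [Phi_eq, map_zero]

theorem Phi_neg (a : Fin N → ℝ) : F.Phi (-a) = -F.Phi a := by rw [Phi_eq, Phi_eq, map_neg]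

theorem Phi_smul_single (t : ℝ) (l : Fin N) :
    F.Phi (t • Pi.single l 1) = t • F.basis l := by
  rw [Phi_eq, map_smul, Module.Basis.equivFun_symm_apply]
  simp [Pi.single_apply]

theorem coe_Phi (a : Fin N → ℝ) : (F.Phi a : SmoothVF (Fin n)) = ∑ l, a l • F.field l := by
  rw [Phi, AddSubmonoidClass.coe_finsetSum]; rfl

/-! Smoothness of the group law. -/

variable {E : Type*} [NormedAddCommGroup E] [NormedSpace ℝ E]

/-- Smooth maps into `Lie{X_1, …, X_m}`, as maps whose coordinates are smooth. -/
def SmoothMap (g : E → ↥(lieGen X)) : Prop := ContDiff ℝ ∞ fun e => F.basis.equivFun (g e)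

variable {F}

theorem SmoothMap.const_smul {g : E → ↥(lieGen X)} (hg : F.SmoothMap g) (c : ℝ) :
    F.SmoothMap fun e => c • g e := by
  unfold SmoothMap
  simp only [map_smul]
  exact ContDiff.const_smul c hg

theorem SmoothMap.sum {κ : Type*} (s : Finset κ) {g : κ → E → ↥(lieGen X)}
    (hg : ∀ i ∈ s, F.SmoothMap (g i)) : F.SmoothMap fun e => ∑ i ∈ s, g i e := by
  unfold SmoothMap
  simp only [map_sum]
  exact ContDiff.sum hg

theorem smoothMap_zero : F.SmoothMap fun _ : E => 0 := contDiff_const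

theorem SmoothMap.lie {g h : E → ↥(lieGen X)} (hg : F.SmoothMap g) (hh : F.SmoothMap h) :
    F.SmoothMap fun e => ⁅g e, h e⁆ := by
  have key : ∀ u v : ↥(lieGen X), F.basis.equivFun ⁅u, v⁆ =
      ∑ k, ∑ l, (F.basis.equivFun u k * F.basis.equivFun v l) •
        F.basis.equivFun ⁅F.basis k, F.basis l⁆ := by
    intro u v
    conv_lhs => rw [← F.basis.sum_equivFun u, ← F.basis.sum_equivFun v]
    simp only [sum_lie, lie_sum, smul_lie, lie_smul, map_sum, map_smul, mul_smul, Finset.smul_sum]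
    rw [Finset.sum_comm]
    exact Finset.sum_congr rfl fun k _ => Finset.sum_congr rfl fun l _ => smul_comm _ _ _
  unfold SmoothMap
  rw [show (fun e => F.basis.equivFun ⁅g e, h e⁆) = _ from funext fun e => key _ _]
  exact ContDiff.sum fun k _ => ContDiff.sum fun l _ =>
    ((contDiff_pi.1 hg k).mul (contDiff_pi.1 hh l)).smul contDiff_const

theorem SmoothMap.nestedBracket (l : List (E → ↥(lieGen X))) (hl : ∀ g ∈ l, F.SmoothMap g) :
    F.SmoothMap fun e => _root_.nestedBracket (l.map fun g => g e) := by
  match l with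
  | [] => exact smoothMap_zero
  | [a] => exact hl a (by simp)
  | a :: b :: l =>
    exact (hl a (by simp)).lie (SmoothMap.nestedBracket (b :: l) fun g hg => hl g (by simp_all))

theorem SmoothMap.bchTerm {g h : E → ↥(lieGen X)} (hg : F.SmoothMap g) (hh : F.SmoothMap h)
    (d : ℕ) : F.SmoothMap fun e => _root_.bchTerm d (g e) (h e) := by
  unfold _root_.bchTerm
  refine SmoothMap.sum _ fun k _ => SmoothMap.const_smul (SmoothMap.sum _ fun c _ =>
    SmoothMap.const_smul ?_ _) _
  have : ∀ e, bchWord (g e) (h e) c = (bchWord g h c).map fun f => f e := fun e =>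
    bchWord_map (fun f : E → ↥(lieGen X) => f e) g h c
  simp only [this]
  refine SmoothMap.nestedBracket _ fun χ hχ => ?_
  simp only [bchWord, List.mem_flatMap, List.mem_append, List.mem_replicate] at hχ
  obtain ⟨t, _, ⟨_, rfl⟩ | ⟨_, rfl⟩⟩ := hχ
  · exact hg
  · exact hh

theorem smoothMap_Phi {g : E → Fin N → ℝ} (hg : ContDiff ℝ ∞ g) :
    F.SmoothMap fun e => F.Phi (g e) := by
  unfold SmoothMap
  simpa only [equivFun_Phi] using hg

variable (F)
variable {K : ℕ} (hK : ∀ k : Fin n, (fun x : Fin n → ℝ => x k) ∈ killed X K)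

section GroupLaw

include hK

theorem contDiff_mulA : ContDiff ℝ ∞ fun z : (Fin N → ℝ) × (Fin N → ℝ) => F.mulA z.1 z.2 := by
  have h : F.SmoothMap fun z : (Fin N → ℝ) × (Fin N → ℝ) => bch (F.Phi z.1) (F.Phi z.2) := by
    simp only [bch_eq_sum_range hK]
    exact SmoothMap.sum _ fun d _ =>
      (smoothMap_Phi contDiff_fst).bchTerm (smoothMap_Phi contDiff_snd) d
  exact h

theorem mulA_assoc (a b c : Fin N → ℝ) : F.mulA (F.mulA a b) c = F.mulA a (F.mulA b c) := by
  apply F.Phi_injective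
  simp only [Phi_mulA, bch_assoc hK]

theorem zero_mulA (a : Fin N → ℝ) : F.mulA 0 a = a := by
  apply F.Phi_injective
  rw [Phi_mulA, Phi_zero, zero_bch hK]

theorem mulA_zero (a : Fin N → ℝ) : F.mulA a 0 = a := by
  apply F.Phi_injective
  rw [Phi_mulA, Phi_zero, bch_zero hK]

theorem neg_mulA (a : Fin N → ℝ) : F.mulA (-a) a = 0 := by
  apply F.Phi_injective
  rw [Phi_mulA, Phi_zero, Phi_neg, neg_bch hK]

theorem mulA_neg (a : Fin N → ℝ) : F.mulA a (-a) = 0 := by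
  apply F.Phi_injective
  rw [Phi_mulA, Phi_zero, Phi_neg, bch_neg hK]

end GroupLaw

/-! The dilations. -/

theorem field_mem_layer (l : Fin N) : F.field l ∈ layer X (F.s l) := by
  rw [← F.span_layer]
  exact Submodule.subset_span ⟨l, rfl, rfl⟩

/-- The dilation `X_l ↦ λ^{s_l} X_l` of `Lie{X_1, …, X_m}`. -/
def dilLinear (lam : ℝ) : ↥(lieGen X) →ₗ[ℝ] ↥(lieGen X) :=
  F.basis.constr ℝ fun l => lam ^ F.s l • F.basis l

theorem dilLinear_basis (lam : ℝ) (l : Fin N) :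
    F.dilLinear lam (F.basis l) = lam ^ F.s l • F.basis l :=
  F.basis.constr_basis ℝ _ l

/-- The basis is adapted, so the layer is spanned by basis elements of weight k. This is needed for
[X_k, X_l], which lies in a known layer but need not be a basis element. -/
theorem dilLinear_of_mem_layer (lam : ℝ) {k : ℕ} (V : ↥(lieGen X)) (hV : V.1 ∈ layer X k) :
    F.dilLinear lam V = lam ^ k • V := by
  have h : layer X k ≤ (LinearMap.ker (F.dilLinear lam - lam ^ k • LinearMap.id)).map
      (lieGen X).toSubmodule.subtype := by
    rw [← F.span_layer, Submodule.span_le]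
    rintro _ ⟨l, rfl, rfl⟩
    refine ⟨F.basis l, ?_, rfl⟩
    change F.dilLinear lam (F.basis l) - lam ^ F.s l • F.basis l = 0
    rw [dilLinear_basis, sub_self]
  obtain ⟨U, hU, hUV⟩ := h hV
  have : U = V := Subtype.ext hUV
  subst this
  simpa [sub_eq_zero] using hU

/-- The dilations are endomorphisms of the Lie algebra. -/
def dilLie (lam : ℝ) : ↥(lieGen X) →ₗ⁅ℝ⁆ ↥(lieGen X) where
  __ := F.dilLinear lam
  map_lie' := by
    intro x y
    have h : (LieModule.toEnd ℝ ↥(lieGen X) ↥(lieGen X) : ↥(lieGen X) →ₗ[ℝ] _).compr₂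
        (F.dilLinear lam) =
        (LieModule.toEnd ℝ ↥(lieGen X) ↥(lieGen X) : ↥(lieGen X) →ₗ[ℝ] _).compl₁₂
          (F.dilLinear lam) (F.dilLinear lam) := by
      refine F.basis.ext fun k => F.basis.ext fun l => ?_
      have h1 := F.dilLinear_of_mem_layer lam ⁅F.basis k, F.basis l⁆
        (lie_mem_layer X (F.field_mem_layer k) (F.field_mem_layer l))
      simp only [LinearMap.compr₂_apply, LinearMap.compl₁₂_apply, LieHom.coe_toLinearMap,
        LieModule.toEnd_apply_apply, dilLinear_basis, h1, smul_lie, lie_smul, smul_smul, pow_add]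
      rw [mul_comm]
    exact LinearMap.congr_fun (LinearMap.congr_fun h x) y

theorem Phi_dil (lam : ℝ) (a : Fin N → ℝ) : F.Phi (dil F.weightA lam a) = F.dilLie lam (F.Phi a) := by
  change _ = F.dilLinear lam (F.Phi a)
  simp only [Phi, map_sum, map_smul, dilLinear_basis, dil, weightA, Real.rpow_natCast, smul_smul]
  exact Finset.sum_congr rfl fun l _ => by rw [mul_comm]

include hK in
theorem dil_mulA (lam : ℝ) (a b : Fin N → ℝ) :
    dil F.weightA lam (F.mulA a b) = F.mulA (dil F.weightA lam a) (dil F.weightA lam b) := by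
  apply F.Phi_injective
  rw [Phi_dil, Phi_mulA, Phi_mulA, Phi_dil, Phi_dil, map_bch hK]

/-! Folland's projection. -/

include hK in
theorem proj_eq_flow (a : Fin N → ℝ) : F.proj a = flow hK (F.Phi a) 0 := exp_eq_flow hK _ _

include hK in
theorem proj_mulA (a b : Fin N → ℝ) : F.proj (F.mulA a b) = flow hK (F.Phi b) (F.proj a) := by
  rw [F.proj_eq_flow hK, F.proj_eq_flow hK, Phi_mulA, flow_bch]

/-- The action of a · X is linear in a, so its powers are polynomial in a. The factor applied first
is peeled off, hence the induction over all f. -/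
theorem contDiff_rho_pow (x : Fin n → ℝ) (i : ℕ) (f : ↥(killed X K)) :
    ContDiff ℝ ∞ fun a : Fin N → ℝ => ((rho X K (F.Phi a) ^ i) f).1 x := by
  induction i generalizing f with
  | zero =>
    simp only [pow_zero]
    exact contDiff_const
  | succ i ih =>
    have h : ∀ a : Fin N → ℝ, ((rho X K (F.Phi a) ^ (i + 1)) f).1 x =
        ∑ l, a l * ((rho X K (F.Phi a) ^ i) (rho X K (F.basis l) f)).1 x := by
      intro a
      have h1 : rho X K (F.Phi a) f = ∑ l, a l • rho X K (F.basis l) f := by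
        rw [Phi, map_sum, LinearMap.sum_apply]
        simp only [map_smul, LinearMap.smul_apply]
      rw [pow_succ, Module.End.mul_apply, h1, map_sum, AddSubmonoidClass.coe_finsetSum,
        Finset.sum_apply]
      simp only [map_smul]
      rfl
    simp only [h]
    exact ContDiff.sum fun l _ => (contDiff_apply ℝ ℝ l).mul (ih _)

include hK in
theorem contDiff_proj : ContDiff ℝ ∞ F.proj := by
  have h : F.proj = fun a => flow hK (F.Phi a) 0 := funext fun a => F.proj_eq_flow hK a
  rw [h, contDiff_pi]
  intro k
  simp only [flow, expAct_apply]
  exact ContDiff.sum fun i _ => contDiff_const.mul (F.contDiff_rho_pow 0 i _)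

include hK in
theorem proj_zero : F.proj 0 = 0 := by
  rw [F.proj_eq_flow hK, Phi_zero]
  funext k
  rw [flow, expAct_zero]; rfl

include hK in
theorem contDiff_T : ContDiff ℝ ∞ F.T := by
  rw [contDiff_pi]
  rintro (k | k)
  · exact contDiff_pi.1 (F.contDiff_proj hK) k
  · exact contDiff_apply ℝ ℝ (F.j k)

variable {σ : Fin n → ℝ} (hX : ∀ k, IsHomogeneousVF σ 1 (X k))

include hX in
theorem field_homogeneous (l : Fin N) : IsHomogeneousVF σ (F.s l) (F.field l) :=
  layer_le_homogeneousVF hX (F.s l) (F.field_mem_layer l)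

include hK hX in
-- By homogeneity δ_λ carries a · X to D_λ(a) · X, hence integral curves to integral curves, and it
-- fixes the starting point 0.
theorem proj_dil {lam : ℝ} (hlam : 0 < lam) (a : Fin N → ℝ) :
    F.proj (dil F.weightA lam a) = dil σ lam (F.proj a) := by
  have h : Related (dil σ lam) (F.Phi a).1 (F.Phi (dil F.weightA lam a)).1 := by
    rw [related_iff_op (dil_contDiff lam)]
    intro k
    have h2 : ∀ (c : Fin N → ℝ) (f : (Fin n → ℝ) → ℝ),
        (∑ l, c l • F.field l).op f = ∑ l, c l • (F.field l).op f := by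
      intro c f
      funext x
      simp only [SmoothVF.op, Submodule.coe_sum, Finset.sum_apply, map_sum, Submodule.coe_smul,
        Pi.smul_apply, map_smul]
    funext x
    rw [coe_Phi, coe_Phi, h2, Function.comp_apply, h2, Finset.sum_apply, Finset.sum_apply]
    refine Finset.sum_congr rfl fun l _ => ?_
    rw [Pi.smul_apply, Pi.smul_apply, F.field_homogeneous hX l lam hlam _ (contDiff_coord k) x]
    simp only [dil, weightA, smul_eq_mul]
    ring
  rw [F.proj_eq_flow hK, F.proj_eq_flow hK, Related.apply_flow hK (dil_contDiff lam) h, dil_zero]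

include hK hX in
theorem T_dil {lam : ℝ} (hlam : 0 < lam) (a : Fin N → ℝ) :
    F.T (dil F.weightA lam a) = dil (F.weightG σ) lam (F.T a) := by
  funext k
  rcases k with k | k
  · exact congrFun (F.proj_dil hK hX hlam a) k
  · rfl

/-! The fields `J_l`. -/

include hK in
theorem contDiff_mulA_left (a : Fin N → ℝ) : ContDiff ℝ ∞ (F.mulA a) := by
  have h := (F.contDiff_mulA hK).comp (f := fun b : Fin N → ℝ => (a, b))
    (contDiff_const.prodMk contDiff_id)
  exact h

/-- `J_l` as a smooth field. -/
def fieldJ (l : Fin N) : SmoothVF (Fin N) :=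
  ⟨F.J l, by
    have h : ContDiff ℝ ∞ (Function.uncurry F.mulA) := F.contDiff_mulA hK
    exact (h.fderiv (m := ∞) (n := ∞) (g := fun _ => 0) contDiff_const (by simp)).clm_apply contDiff_const⟩

theorem fieldJ_zero (l : Fin N) : (F.fieldJ hK l).1 0 = Pi.single l 1 := by
  change fderiv ℝ (F.mulA 0) 0 (Pi.single l 1) = _
  rw [show F.mulA 0 = id from funext fun a => F.zero_mulA hK a, fderiv_id]
  rfl

theorem fieldJ_mem_leftInvariant (l : Fin N) : F.fieldJ hK l ∈ leftInvariant F.mulA := by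
  intro a b
  change fderiv ℝ (F.mulA a) b (fderiv ℝ (F.mulA b) 0 (Pi.single l 1)) =
    fderiv ℝ (F.mulA (F.mulA a b)) 0 (Pi.single l 1)
  have h : F.mulA (F.mulA a b) = F.mulA a ∘ F.mulA b := funext fun c => F.mulA_assoc hK a b c
  rw [h, fderiv_comp _ ((F.contDiff_mulA_left hK a).differentiable (by simp) _)
    ((F.contDiff_mulA_left hK b).differentiable (by simp) _), F.mulA_zero hK]
  rfl

/-- By `proj_mulA` the curve π(a * te_l) is the integral curve of X_l from π(a); both sides are its
velocity at t = 0. -/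
theorem fieldJ_related (l : Fin N) : Related F.proj (F.fieldJ hK l) (F.field l) := by
  intro a
  have h1 : HasDerivAt (fun t : ℝ => F.mulA a (t • Pi.single l 1)) ((F.fieldJ hK l).1 a) 0 := by
    have h := ((F.contDiff_mulA_left hK a).differentiable (by simp)
      ((0 : ℝ) • (Pi.single l 1 : Fin N → ℝ))).hasFDerivAt
    have h2 : HasDerivAt (fun t : ℝ => t • (Pi.single l 1 : Fin N → ℝ)) (Pi.single l 1) 0 := by
      simpa using (hasDerivAt_id (0 : ℝ)).smul_const (Pi.single l 1 : Fin N → ℝ)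
    have h3 := h.comp_hasDerivAt (0 : ℝ) h2
    rw [zero_smul] at h3
    exact h3
  have h2 := (((F.contDiff_proj hK).differentiable (by simp)
    (F.mulA a ((0 : ℝ) • Pi.single l 1))).hasFDerivAt).comp_hasDerivAt (0 : ℝ) h1
  rw [zero_smul, F.mulA_zero hK] at h2
  obtain ⟨h0, h3⟩ := isGlobalCurveFrom_flow hK (F.basis l) (F.proj a)
  have h4 := h3 0
  simp only at h0
  have h5 : (F.proj ∘ fun t : ℝ => F.mulA a (t • Pi.single l 1)) =
      fun t : ℝ => flow hK (t • F.basis l) (F.proj a) := by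
    funext t
    rw [Function.comp_apply, F.proj_mulA hK, Phi_smul_single]
  rw [h5] at h2
  have h6 := h2.unique h4
  simp only [h0] at h6
  exact h6

/-- Differentiate D_λ(a * b) = D_λ(a) * D_λ(b) in b at 0 in the direction e_l. -/
theorem fieldJ_homogeneous (l : Fin N) : IsHomogeneousVF F.weightA (F.s l) (F.fieldJ hK l) := by
  rw [isHomogeneousVF_iff]
  intro k lam hlam a
  let L : (Fin N → ℝ) →L[ℝ] (Fin N → ℝ) := ContinuousLinearMap.pi fun k =>
    (lam ^ F.weightA k) • ContinuousLinearMap.proj (R := ℝ) (φ := fun _ : Fin N => ℝ) k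
  have hL : dil F.weightA lam = L := by
    funext x k
    simp [L, dil]
  have h : F.mulA (dil F.weightA lam a) ∘ L = L ∘ F.mulA a := by
    funext b
    rw [Function.comp_apply, Function.comp_apply, ← hL, F.dil_mulA hK]
  have h1 : fderiv ℝ (F.mulA (dil F.weightA lam a) ∘ L) 0 (Pi.single l 1) =
      fderiv ℝ (L ∘ F.mulA a) 0 (Pi.single l 1) := by rw [h]
  rw [fderiv_comp _ ((F.contDiff_mulA_left hK _).differentiable (by simp) _) L.differentiableAt,
    fderiv_comp _ L.differentiableAt ((F.contDiff_mulA_left hK _).differentiable (by simp) _),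
    L.fderiv, L.fderiv, map_zero, ContinuousLinearMap.comp_apply, ContinuousLinearMap.comp_apply]
    at h1
  have h2 : L (Pi.single l 1) = lam ^ F.weightA l • Pi.single l 1 := by
    rw [← hL]
    funext k
    by_cases hk : k = l
    · subst hk; simp [dil]
    · simp [dil, hk]
  rw [h2, map_smul, ← hL] at h1
  have h3 := congrFun h1 k
  change lam ^ F.weightA l * (F.fieldJ hK l).1 (dil F.weightA lam a) k =
    lam ^ F.weightA k * (F.fieldJ hK l).1 a k at h3
  change (F.fieldJ hK l).1 (dil F.weightA lam a) k = _
  have h4 := (Real.rpow_pos_of_pos hlam (F.weightA l)).ne'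
  rw [show (F.s l : ℝ) = F.weightA l from rfl, Real.rpow_sub hlam, div_mul_eq_mul_div, ← h3,
    mul_div_cancel_left₀ _ h4]

end LiftingFrame
end

noncomputable section

open SmoothVF

/-! ### Smooth maps that intertwine dilations -/

section DilationEquivariant

set_option linter.unusedSectionVars false

variable {κ ι : Type*} [Fintype κ] [Fintype ι] {u : κ → ℝ} {w : ι → ℝ}
  {φ : (κ → ℝ) → (ι → ℝ)}

theorem eventually_dil (hw : ∀ k, 0 < w k) (x : ι → ℝ) {P : (ι → ℝ) → Prop}
    (hP : ∀ᶠ y in nhds 0, P y) :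
    ∀ᶠ lam : ℝ in nhdsWithin 0 (Set.Ioi 0), P (dil w lam x) :=
  (tendsto_dil_zero hw x).eventually hP

/-- A smooth map that intertwines dilations and is a local diffeomorphism at `0` is a global
diffeomorphism. -/
theorem bijective_and_contDiff_invFun (hu : ∀ k, 0 < u k) (hw : ∀ k, 0 < w k)
    (hφ : ContDiff ℝ ∞ φ) (h0 : φ 0 = 0) (hd : Function.Bijective (fderiv ℝ φ 0))
    (hdil : ∀ lam : ℝ, 0 < lam → ∀ a, φ (dil u lam a) = dil w lam (φ a)) :
    Function.Bijective φ ∧ ContDiff ℝ ∞ (Function.invFun φ) := by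
  let e : (κ → ℝ) ≃L[ℝ] (ι → ℝ) :=
    (LinearEquiv.ofBijective (fderiv ℝ φ 0 : (κ → ℝ) →ₗ[ℝ] (ι → ℝ)) hd).toContinuousLinearEquiv
  have he : HasFDerivAt φ (e : (κ → ℝ) →L[ℝ] (ι → ℝ)) 0 := by
    have h : (e : (κ → ℝ) →L[ℝ] (ι → ℝ)) = fderiv ℝ φ 0 := ContinuousLinearMap.ext fun _ => rfl
    rw [h]
    exact (hφ.differentiable (by simp) 0).hasFDerivAt
  have hn : (∞ : WithTop ℕ∞) ≠ 0 := by simp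
  have hs : HasStrictFDerivAt φ (e : (κ → ℝ) →L[ℝ] (ι → ℝ)) 0 :=
    hφ.contDiffAt.hasStrictFDerivAt' he hn
  let g := hs.localInverse φ e 0
  have hg1 : ∀ᶠ a in nhds 0, g (φ a) = a := hs.eventually_left_inverse
  have hg2 : ∀ᶠ z in nhds 0, φ (g z) = z := by
    have := hs.eventually_right_inverse
    rwa [h0] at this
  have hg3 : ContDiffAt ℝ ∞ g 0 := by
    have := hφ.contDiffAt.to_localInverse he hn
    rwa [h0] at this
  have hpos : ∀ᶠ lam : ℝ in nhdsWithin 0 (Set.Ioi 0), 0 < lam := self_mem_nhdsWithin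
  -- A small dilation moves given points into the neighbourhood of 0 where the local inverse `g`
  -- works; equivariance then undoes the dilation.
  have hinj : Function.Injective φ := by
    intro a b hab
    obtain ⟨lam, ⟨ha, hb⟩, hl⟩ :=
      (((eventually_dil hu a hg1).and (eventually_dil hu b hg1)).and hpos).exists
    rw [hdil lam hl, hab, ← hdil lam hl, hb] at ha
    rw [← dil_inv_dil hl a, ← ha, dil_inv_dil hl]
  have hsurj : Function.Surjective φ := by
    intro z
    obtain ⟨lam, h, hl⟩ := ((eventually_dil hw z hg2).and hpos).exists
    exact ⟨dil u lam⁻¹ (g (dil w lam z)), by rw [hdil _ (inv_pos.2 hl), h, dil_inv_dil hl]⟩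
  -- Smoothness is proved for each finite order q, since being C^q at a point is an open condition
  -- only for finite q. Near z the inverse equals δ_{1/λ} ∘ g ∘ δ_λ for small λ.
  refine ⟨⟨hinj, hsurj⟩, contDiff_infty.2 fun q => contDiff_iff_contDiffAt.2 fun z => ?_⟩
  have hg4 : ContDiffAt ℝ q g 0 := hg3.of_le (by exact_mod_cast le_top)
  obtain ⟨lam, ⟨h1, h2⟩, hl⟩ := (((eventually_dil hw z hg2.eventually_nhds).and
    (eventually_dil hw z (hg4.eventually (by simp)))).and hpos).exists
  have hdw : ContDiff ℝ q (dil w lam) := (dil_contDiff lam).of_le (by exact_mod_cast le_top)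
  have hdu : ContDiff ℝ q (dil u lam⁻¹) := (dil_contDiff _).of_le (by exact_mod_cast le_top)
  have h3 : ContDiffAt ℝ q (fun y => dil u lam⁻¹ (g (dil w lam y))) z :=
    hdu.contDiffAt.comp z (h2.comp z hdw.contDiffAt)
  refine h3.congr_of_eventuallyEq ?_
  filter_upwards [hdw.continuous.continuousAt.eventually h1] with y hy
  apply hinj
  rw [Function.invFun_eq (hsurj y), hdil _ (inv_pos.2 hl), hy, dil_inv_dil hl]

theorem fderiv_dil (lam : ℝ) (x v : ι → ℝ) : fderiv ℝ (dil w lam) x v = dil w lam v := by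
  let L : (ι → ℝ) →L[ℝ] (ι → ℝ) := ContinuousLinearMap.pi fun k =>
    (lam ^ w k) • ContinuousLinearMap.proj (R := ℝ) (φ := fun _ : ι => ℝ) k
  have hL : dil w lam = L := by
    funext x k
    simp [L, dil]
  rw [hL, L.fderiv]

theorem fderiv_dil_apply (hφ : ContDiff ℝ ∞ φ) {lam : ℝ}
    (hdil : ∀ a, φ (dil u lam a) = dil w lam (φ a)) (a v : κ → ℝ) :
    fderiv ℝ φ (dil u lam a) (dil u lam v) = dil w lam (fderiv ℝ φ a v) := by
  have h : φ ∘ dil u lam = dil w lam ∘ φ := funext hdil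
  have h1 : fderiv ℝ (φ ∘ dil u lam) a v = fderiv ℝ (dil w lam ∘ φ) a v := by rw [h]
  have hd : ∀ x, DifferentiableAt ℝ (dil u lam) x := (dil_contDiff lam).differentiable (by simp)
  have hd' : ∀ x, DifferentiableAt ℝ (dil w lam) x := (dil_contDiff lam).differentiable (by simp)
  rwa [fderiv_comp _ (hφ.differentiable (by simp) _) (hd a),
    fderiv_comp _ (hd' _) (hφ.differentiable (by simp) _), ContinuousLinearMap.comp_apply,
    ContinuousLinearMap.comp_apply, fderiv_dil, fderiv_dil] at h1

end DilationEquivariant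

/-! ### The change of variables T, the group 𝔾 and the fields Z_l -/

namespace LiftingFrame

variable {n m N p : ℕ} {X : Fin m → SmoothVF (Fin n)} (F : LiftingFrame X N p)

theorem bijective_sumElim : Function.Bijective (Sum.elim F.i F.j) := by
  constructor
  · refine F.i_mono.injective.sumElim F.j_mono.injective fun k l h => ?_
    have : F.j l ∈ Set.range F.j := ⟨l, rfl⟩
    rw [F.range_j] at this
    exact this ⟨k, h⟩
  · intro l
    by_cases h : l ∈ Set.range F.i
    · obtain ⟨k, rfl⟩ := h
      exact ⟨Sum.inl k, rfl⟩
    · have : l ∈ Set.range F.j := by rw [F.range_j]; exact h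
      obtain ⟨k, rfl⟩ := this
      exact ⟨Sum.inr k, rfl⟩

variable {K : ℕ} (hK : ∀ k : Fin n, (fun x : Fin n → ℝ => x k) ∈ killed X K)

include hK

theorem T_zero : F.T 0 = 0 := by
  funext k
  rcases k with k | k
  · exact congrFun (F.proj_zero hK) k
  · rfl

theorem fderiv_T_inl (a v : Fin N → ℝ) (k : Fin n) :
    fderiv ℝ F.T a v (Sum.inl k) = fderiv ℝ F.proj a v k := by
  have h := hasFDerivAt_pi'.1 ((F.contDiff_T hK).differentiable (by simp) a).hasFDerivAt (Sum.inl k)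
  have h2 := hasFDerivAt_pi'.1 ((F.contDiff_proj hK).differentiable (by simp) a).hasFDerivAt k
  exact congrArg (fun L => L v) (h.unique h2)

theorem fderiv_T_inr (a v : Fin N → ℝ) (k : Fin p) :
    fderiv ℝ F.T a v (Sum.inr k) = v (F.j k) := by
  have h := hasFDerivAt_pi'.1 ((F.contDiff_T hK).differentiable (by simp) a).hasFDerivAt (Sum.inr k)
  have h2 : HasFDerivAt (fun a : Fin N → ℝ => a (F.j k))
      (ContinuousLinearMap.proj (R := ℝ) (φ := fun _ : Fin N => ℝ) (F.j k)) a :=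
    hasFDerivAt_apply (F.j k) a
  exact congrArg (fun L => L v) (h.unique h2)

theorem fderiv_proj_zero (v : Fin N → ℝ) :
    fderiv ℝ F.proj 0 v = ∑ l, v l • (F.field l).1 0 := by
  have h : ∀ l, fderiv ℝ F.proj 0 (Pi.single l 1) = (F.field l).1 0 := by
    intro l
    have := F.fieldJ_related hK l 0
    rwa [F.fieldJ_zero hK, F.proj_zero hK] at this
  conv_lhs => rw [pi_eq_sum_univ' v, map_sum]
  refine Finset.sum_congr rfl fun l _ => ?_
  rw [map_smul, ← h]

/-- For v in the kernel the last p components give v_j = 0. The first n then give ∑ v_i X_i(0) = 0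
over the chosen indices, whose fields are independent at 0. -/
theorem bijective_fderiv_T : Function.Bijective (fderiv ℝ F.T 0) := by
  have hinj : Function.Injective (fderiv ℝ F.T 0 : (Fin N → ℝ) →ₗ[ℝ] (Fin n ⊕ Fin p → ℝ)) := by
    rw [← LinearMap.ker_eq_bot, LinearMap.ker_eq_bot']
    intro v hv
    have hj : ∀ k, v (F.j k) = 0 := fun k => by
      rw [← F.fderiv_T_inr hK 0 v k]
      exact congrFun hv (Sum.inr k)
    have h1 : ∑ l, v l • (F.field l).1 0 = 0 := by
      rw [← F.fderiv_proj_zero hK]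
      funext k
      rw [← F.fderiv_T_inl hK]
      exact congrFun hv (Sum.inl k)
    rw [← F.bijective_sumElim.sum_comp (fun l => v l • (F.field l).1 0), Fintype.sum_sum_type] at h1
    simp only [Sum.elim_inl, Sum.elim_inr, hj, zero_smul, Finset.sum_const_zero, add_zero] at h1
    have hi := Fintype.linearIndependent_iff.1 F.linInd _ h1
    funext l
    obtain ⟨k | k, rfl⟩ := F.bijective_sumElim.2 l
    · exact hi k
    · exact hj k
  refine ⟨hinj, (LinearMap.injective_iff_surjective_of_finrank_eq_finrank ?_).1 hinj⟩
  rw [Module.finrank_fintype_fun_eq_card, Module.finrank_fintype_fun_eq_card]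
  exact (Fintype.card_of_bijective F.bijective_sumElim).symm

variable {σ : Fin n → ℝ} (hX : ∀ k, IsHomogeneousVF σ 1 (X k)) (hσ : ∀ k, 0 < σ k)

omit hK in
theorem s_pos (l : Fin N) : 0 < F.s l := by
  rw [Nat.pos_iff_ne_zero]
  intro h
  have h1 := F.field_mem_layer l
  rw [h] at h1
  exact F.basis.ne_zero l (Subtype.ext h1)

omit hK in
include hσ in
theorem weightG_pos (k : Fin n ⊕ Fin p) : 0 < F.weightG σ k := by
  rcases k with k | k
  · exact hσ k
  · exact Nat.cast_pos.2 (F.s_pos _)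

omit hK in
theorem weightA_pos (l : Fin N) : 0 < F.weightA l := Nat.cast_pos.2 (F.s_pos _)

include hX hσ

theorem T_diffeomorphism : Function.Bijective F.T ∧ ContDiff ℝ ∞ F.Tinv :=
  bijective_and_contDiff_invFun F.weightA_pos (F.weightG_pos hσ) (F.contDiff_T hK) (F.T_zero hK)
    (F.bijective_fderiv_T hK) fun _ hlam a => F.T_dil hK hX hlam a

theorem Tinv_T (a : Fin N → ℝ) : F.Tinv (F.T a) = a :=
  Function.leftInverse_invFun (F.T_diffeomorphism hK hX hσ).1.1 a

theorem T_Tinv (z : Fin n ⊕ Fin p → ℝ) : F.T (F.Tinv z) = z :=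
  Function.invFun_eq ((F.T_diffeomorphism hK hX hσ).1.2 z)

theorem T_mulA (a b : Fin N → ℝ) : F.T (F.mulA a b) = F.mulG (F.T a) (F.T b) := by
  rw [mulG, F.Tinv_T hK hX hσ, F.Tinv_T hK hX hσ]

theorem contDiff_mulG :
    ContDiff ℝ ∞ fun z : (Fin n ⊕ Fin p → ℝ) × (Fin n ⊕ Fin p → ℝ) => F.mulG z.1 z.2 := by
  have h := (F.T_diffeomorphism hK hX hσ).2
  have h1 : ContDiff ℝ ∞ fun z : (Fin n ⊕ Fin p → ℝ) × (Fin n ⊕ Fin p → ℝ) =>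
      (F.Tinv z.1, F.Tinv z.2) := (h.comp contDiff_fst).prodMk (h.comp contDiff_snd)
  have h2 := (F.contDiff_mulA hK).comp h1
  have h3 := (F.contDiff_T hK).comp h2
  exact h3

theorem mulG_assoc (a b c : Fin n ⊕ Fin p → ℝ) :
    F.mulG (F.mulG a b) c = F.mulG a (F.mulG b c) := by
  simp only [mulG, F.Tinv_T hK hX hσ, F.mulA_assoc hK]

theorem Tinv_zero : F.Tinv 0 = 0 := by
  rw [← F.T_zero hK, F.Tinv_T hK hX hσ]

theorem zero_mulG (a : Fin n ⊕ Fin p → ℝ) : F.mulG 0 a = a := by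
  rw [mulG, F.Tinv_zero hK hX hσ, F.zero_mulA hK, F.T_Tinv hK hX hσ]

theorem mulG_zero (a : Fin n ⊕ Fin p → ℝ) : F.mulG a 0 = a := by
  rw [mulG, F.Tinv_zero hK hX hσ, F.mulA_zero hK, F.T_Tinv hK hX hσ]

theorem exists_inv_mulG :
    ∃ inv : (Fin n ⊕ Fin p → ℝ) → (Fin n ⊕ Fin p → ℝ), ContDiff ℝ ∞ inv ∧
      ∀ a, F.mulG (inv a) a = 0 ∧ F.mulG a (inv a) = 0 := by
  refine ⟨fun z => F.T (-F.Tinv z),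
    (F.contDiff_T hK).comp (F.T_diffeomorphism hK hX hσ).2.neg, fun a => ?_⟩
  rw [mulG, mulG, F.Tinv_T hK hX hσ, F.neg_mulA hK, F.mulA_neg hK, F.T_zero hK]
  exact ⟨rfl, rfl⟩

theorem Tinv_dil {lam : ℝ} (hlam : 0 < lam) (z : Fin n ⊕ Fin p → ℝ) :
    F.Tinv (dil (F.weightG σ) lam z) = dil F.weightA lam (F.Tinv z) := by
  apply (F.T_diffeomorphism hK hX hσ).1.1
  rw [F.T_Tinv hK hX hσ, F.T_dil hK hX hlam, F.T_Tinv hK hX hσ]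

theorem dil_mulG {lam : ℝ} (hlam : 0 < lam) (a b : Fin n ⊕ Fin p → ℝ) :
    dil (F.weightG σ) lam (F.mulG a b) =
      F.mulG (dil (F.weightG σ) lam a) (dil (F.weightG σ) lam b) := by
  rw [mulG, mulG, F.Tinv_dil hK hX hσ hlam, F.Tinv_dil hK hX hσ hlam, ← F.dil_mulA hK,
    F.T_dil hK hX hlam]

/-! The fields `Z_l`. -/

/-- `Z_l` as a smooth field. -/
def fieldZ (l : Fin N) : SmoothVF (Fin n ⊕ Fin p) :=
  ⟨F.Z l, by
    have h := (F.T_diffeomorphism hK hX hσ).2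
    have h1 : ContDiff ℝ ∞ (fderiv ℝ F.T) := (F.contDiff_T hK).fderiv_right (by simp)
    exact (h1.comp h).clm_apply ((F.fieldJ hK l).contDiff.comp h)⟩

theorem fieldZ_related (l : Fin N) : Related F.T (F.fieldJ hK l) (F.fieldZ hK hX hσ l) := by
  intro a
  change _ = fderiv ℝ F.T (F.Tinv (F.T a)) (F.J l (F.Tinv (F.T a)))
  rw [F.Tinv_T hK hX hσ]
  rfl

theorem fieldZ_zero (l : Fin N) :
    (F.fieldZ hK hX hσ l).1 0 = fderiv ℝ F.T 0 (Pi.single l 1) := by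
  have := F.fieldZ_related hK hX hσ l 0
  rw [F.T_zero hK, F.fieldJ_zero hK] at this
  exact this.symm

theorem fieldZ_mem_leftInvariant (l : Fin N) : F.fieldZ hK hX hσ l ∈ leftInvariant F.mulG := by
  intro z w
  obtain ⟨a, rfl⟩ := (F.T_diffeomorphism hK hX hσ).1.2 z
  obtain ⟨b, rfl⟩ := (F.T_diffeomorphism hK hX hσ).1.2 w
  have hm : ContDiff ℝ ∞ (F.mulG (F.T a)) := by
    have h := (F.contDiff_mulG hK hX hσ).comp (f := fun b : Fin n ⊕ Fin p → ℝ => (F.T a, b))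
      (contDiff_const.prodMk contDiff_id)
    exact h
  have h : F.mulG (F.T a) ∘ F.T = F.T ∘ F.mulA a :=
    funext fun c => (F.T_mulA hK hX hσ a c).symm
  have h1 : fderiv ℝ (F.mulG (F.T a) ∘ F.T) b (F.J l b) =
    fderiv ℝ (F.T ∘ F.mulA a) b (F.J l b) := by rw [h]
  rw [fderiv_comp _ (hm.differentiable (by simp) _) ((F.contDiff_T hK).differentiable (by simp) _),
    fderiv_comp _ ((F.contDiff_T hK).differentiable (by simp) _)
    ((F.contDiff_mulA_left hK a).differentiable (by simp) _), ContinuousLinearMap.comp_apply,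
    ContinuousLinearMap.comp_apply] at h1
  rw [← F.fieldZ_related hK hX hσ l b, ← F.T_mulA hK hX hσ, ← F.fieldZ_related hK hX hσ l,
    ← F.fieldJ_mem_leftInvariant hK l a b]
  exact h1

theorem fieldZ_homogeneous (l : Fin N) :
    IsHomogeneousVF (F.weightG σ) (F.s l) (F.fieldZ hK hX hσ l) := by
  rw [isHomogeneousVF_iff]
  intro k lam hlam z
  obtain ⟨a, rfl⟩ := (F.T_diffeomorphism hK hX hσ).1.2 z
  have hp := Real.rpow_pos_of_pos hlam (F.s l : ℝ)
  have h1 : lam ^ (F.s l : ℝ) • (F.fieldJ hK l).1 (dil F.weightA lam a) =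
      dil F.weightA lam ((F.fieldJ hK l).1 a) := by
    funext k
    have := isHomogeneousVF_iff.1 (F.fieldJ_homogeneous hK l) k lam hlam a
    simp only at this
    rw [Pi.smul_apply, this, smul_eq_mul, ← mul_assoc, ← Real.rpow_add hlam, add_sub_cancel]
    rfl
  have h2 := fderiv_dil_apply (F.contDiff_T hK) (fun a => F.T_dil hK hX hlam a) a
    ((F.fieldJ hK l).1 a)
  rw [← h1, map_smul, F.fieldZ_related hK hX hσ, F.fieldZ_related hK hX hσ,
    F.T_dil hK hX hlam] at h2
  have h3 := congrFun h2 k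
  change lam ^ (F.s l : ℝ) * _ = lam ^ F.weightG σ k * _ at h3
  rw [Real.rpow_sub hlam, div_mul_eq_mul_div, ← h3, mul_div_cancel_left₀ _ hp.ne']

/-- The x-part of dT(J_l) is dπ(J_l), which is X_l at π(a), and π is the x-part of T. This is the
lifting property in coordinates. -/
theorem fieldZ_inl (l : Fin N) (z : Fin n ⊕ Fin p → ℝ) (k : Fin n) :
    (F.fieldZ hK hX hσ l).1 z (Sum.inl k) = (F.field l).1 (projX z) k := by
  obtain ⟨a, rfl⟩ := (F.T_diffeomorphism hK hX hσ).1.2 z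
  rw [← F.fieldZ_related hK hX hσ, F.fderiv_T_inl hK, F.fieldJ_related hK]
  rfl

end LiftingFrame

theorem contDiff_projX {n p : ℕ} :
    ContDiff ℝ ∞ (projX : (Fin n ⊕ Fin p → ℝ) → Fin n → ℝ) :=
  contDiff_pi.2 fun k => contDiff_apply ℝ ℝ (Sum.inl k)

theorem fderiv_projX {n p : ℕ} (z v : Fin n ⊕ Fin p → ℝ) : fderiv ℝ projX z v = projX v := by
  let L : (Fin n ⊕ Fin p → ℝ) →L[ℝ] (Fin n → ℝ) := ContinuousLinearMap.pi fun k =>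
    ContinuousLinearMap.proj (R := ℝ) (φ := fun _ : Fin n ⊕ Fin p => ℝ) (Sum.inl k)
  have hL : projX = L := rfl
  rw [hL, L.fderiv]

theorem LiftingFrame.fieldZ_related_projX {n m N p : ℕ} {X : Fin m → SmoothVF (Fin n)}
    (F : LiftingFrame X N p) {K : ℕ} (hK : ∀ k : Fin n, (fun x : Fin n → ℝ => x k) ∈ killed X K)
    {σ : Fin n → ℝ} (hX : ∀ k, IsHomogeneousVF σ 1 (X k)) (hσ : ∀ k, 0 < σ k) (l : Fin N) :
    Related projX (F.fieldZ hK hX hσ l) (F.field l) := by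
  intro z
  rw [fderiv_projX]
  exact funext fun k => F.fieldZ_inl hK hX hσ l z k

end

noncomputable section

open SmoothVF

/-! ### Nilpotency of `Lie{X_1, …, X_m}` -/

section Nilpotency

variable {ι : Type*} [Fintype ι] {m : ℕ} (X : Fin m → SmoothVF ι)

theorem coe_mem_iSup_layer_of_mem_lowerCentralSeries (k : ℕ) (V : ↥(lieGen X))
    (hV : V ∈ LieModule.lowerCentralSeries ℝ ↥(lieGen X) ↥(lieGen X) k) :
    V.1 ∈ ⨆ j, layer X (j + k + 1) := by
  have hmem : ∀ V : ↥(lieGen X), V.1 ∈ ⨆ j, layer X j := fun V => by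
    rw [← lieGen_eq_iSup]; exact V.2
  induction k generalizing V with
  | zero =>
    have h : (⨆ j, layer X j) ≤ ⨆ j, layer X (j + 0 + 1) := by
      refine iSup_le fun j => ?_
      rcases j with _ | j
      · exact bot_le
      · exact le_iSup (fun j => layer X (j + 0 + 1)) j
    exact h (hmem V)
  | succ k ih =>
    rw [LieModule.lowerCentralSeries_succ, ← LieSubmodule.mem_toSubmodule,
      LieSubmodule.lieIdeal_oper_eq_linear_span'] at hV
    have h : Submodule.span ℝ {Y : ↥(lieGen X) | ∃ x ∈ (⊤ : LieIdeal ℝ ↥(lieGen X)),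
        ∃ y ∈ LieModule.lowerCentralSeries ℝ ↥(lieGen X) ↥(lieGen X) k, ⁅x, y⁆ = Y} ≤
        (⨆ j, layer X (j + (k + 1) + 1)).comap (lieGen X).toSubmodule.subtype := by
      rw [Submodule.span_le]
      rintro _ ⟨U, _, V, hV, rfl⟩
      change ⁅U.1, V.1⁆ ∈ ⨆ j, layer X (j + (k + 1) + 1)
      refine Submodule.iSup_induction _ (motive := fun U => ⁅U, V.1⁆ ∈ _) (hmem U) ?_ ?_ ?_
      · intro i A hA
        rcases i with _ | i
        · have : A = 0 := hA
          rw [this, zero_lie]; exact Submodule.zero_mem _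
        refine Submodule.iSup_induction _ (motive := fun V => ⁅A, V⁆ ∈ _) (ih V hV) ?_ ?_ ?_
        · intro j B hB
          refine Submodule.mem_iSup_of_mem (i + j) ?_
          have := lie_mem_layer X hA hB
          rwa [show i + j + (k + 1) + 1 = i + 1 + (j + k + 1) by ring]
        · rw [lie_zero]; exact Submodule.zero_mem _
        · intro B C hB hC
          rw [lie_add]; exact Submodule.add_mem _ hB hC
      · rw [zero_lie]; exact Submodule.zero_mem _
      · intro A B hA hB
        rw [add_lie]; exact Submodule.add_mem _ hA hB
    exact h hV

theorem layer_le_map_lowerCentralSeries (k : ℕ) :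
    layer X (k + 1) ≤
      (LieModule.lowerCentralSeries ℝ ↥(lieGen X) ↥(lieGen X) k).toSubmodule.map
        (lieGen X).toSubmodule.subtype := by
  induction k with
  | zero => exact fun V hV => ⟨⟨V, layer_le_lieGen X 1 hV⟩, by simp, rfl⟩
  | succ k ih =>
    refine layer_succ_le X (by omega) fun U hU V hV => ?_
    obtain ⟨W, hW, rfl⟩ := ih hV
    refine ⟨⁅(⟨U, layer_le_lieGen X 1 hU⟩ : ↥(lieGen X)), W⁆, ?_, rfl⟩
    rw [LieModule.lowerCentralSeries_succ]
    exact LieSubmodule.lie_mem_lie (LieSubmodule.mem_top _) hW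

/-- Term k of the lower central series lies in the sum of the layers of index at least k + 1 and
contains layer k + 1. The shift arises because the series starts at 0 with the whole algebra and the
layers start at 1. -/
theorem isNilpotent_and_nilpotencyLength_lieGen {r : ℕ} (hr : 1 ≤ r) (h1 : layer X r ≠ ⊥)
    (h2 : ∀ k, r < k → layer X k = ⊥) :
    LieRing.IsNilpotent ↥(lieGen X) ∧
      LieModule.nilpotencyLength ↥(lieGen X) ↥(lieGen X) = r := by
  have h3 : LieModule.lowerCentralSeries ℝ ↥(lieGen X) ↥(lieGen X) r = ⊥ := by
    rw [eq_bot_iff]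
    intro V hV
    have := coe_mem_iSup_layer_of_mem_lowerCentralSeries X r V hV
    rw [iSup_eq_bot.2 fun j => h2 _ (by omega), Submodule.mem_bot] at this
    exact Subtype.ext this
  refine ⟨(LieModule.isNilpotent_iff ℝ _ _).2 ⟨r, h3⟩, ?_⟩
  obtain ⟨k, rfl⟩ : ∃ k, r = k + 1 := ⟨r - 1, by omega⟩
  rw [LieModule.nilpotencyLength_eq_succ_iff ℝ]
  refine ⟨h3, fun h4 => h1 ?_⟩
  rw [eq_bot_iff]
  intro V hV
  obtain ⟨W, hW, rfl⟩ := layer_le_map_lowerCentralSeries X k hV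
  rw [h4] at hW
  have hW0 : W = 0 := hW
  rw [hW0]
  exact Submodule.zero_mem _

end Nilpotency

/-! ### Left-invariant fields -/

section LeftInvariant

variable {ι : Type*} [Fintype ι] {mul : (ι → ℝ) → (ι → ℝ) → (ι → ℝ)}

theorem leftInvariant_ext (hm : ∀ a, mul a 0 = a) {V W : SmoothVF ι} (hV : V ∈ leftInvariant mul)
    (hW : W ∈ leftInvariant mul) (h : V.1 0 = W.1 0) : V = W := by
  refine Subtype.ext (funext fun a => ?_)
  have h1 := hV a 0
  have h2 := hW a 0
  rw [hm] at h1 h2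
  rw [← h1, ← h2, h]

theorem lie_mem_leftInvariant (hs : ∀ a, ContDiff ℝ ∞ (mul a)) {V W : SmoothVF ι}
    (hV : V ∈ leftInvariant mul) (hW : W ∈ leftInvariant mul) : ⁅V, W⁆ ∈ leftInvariant mul :=
  fun a => Related.lie (hs a) (fun b => hV a b) fun b => hW a b

/-- The Lie algebra of left-invariant fields. -/
def leftInvariantLie (hs : ∀ a, ContDiff ℝ ∞ (mul a)) : LieSubalgebra ℝ (SmoothVF ι) :=
  { leftInvariant mul with lie_mem' := fun hV hW => lie_mem_leftInvariant hs hV hW }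

/-- Left-invariant fields are determined by their values at 0, so spaces of them can be compared
there. -/
theorem eq_of_map_evalAt_eq (hm : ∀ a, mul a 0 = a) {P Q : Submodule ℝ (SmoothVF ι)}
    (hP : P ≤ leftInvariant mul) (hQ : Q ≤ leftInvariant mul)
    (h : P.map (evalAt 0) = Q.map (evalAt 0)) : P = Q := by
  have key : ∀ {P Q : Submodule ℝ (SmoothVF ι)}, P ≤ leftInvariant mul → Q ≤ leftInvariant mul →
      P.map (evalAt 0) ≤ Q.map (evalAt 0) → P ≤ Q := by
    intro P Q hP hQ h V hV
    obtain ⟨W, hW, hVW⟩ := h ⟨V, hV, rfl⟩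
    rwa [← leftInvariant_ext hm (hQ hW) (hP hV) hVW]
  exact le_antisymm (key hP hQ h.le) (key hQ hP h.ge)

end LeftInvariant

theorem LieSubalgebra.lieSpan_eq_of_span_eq {R L : Type*} [CommRing R] [LieRing L]
    [LieAlgebra R L] {s t : Set L} (h : Submodule.span R s = Submodule.span R t) :
    LieSubalgebra.lieSpan R L s = LieSubalgebra.lieSpan R L t := by
  refine le_antisymm (LieSubalgebra.lieSpan_le.2 fun x hx => ?_)
    (LieSubalgebra.lieSpan_le.2 fun x hx => ?_)
  · have : x ∈ Submodule.span R t := h ▸ Submodule.subset_span hx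
    exact LieSubalgebra.submodule_span_le_lieSpan this
  · have : x ∈ Submodule.span R s := h ▸ Submodule.subset_span hx
    exact LieSubalgebra.submodule_span_le_lieSpan this

/-! ### Frames of homogeneous left-invariant fields -/

/-- `Z` is a frame of left-invariant fields for a smooth group law with dilations; `Z_l` is
homogeneous of degree `s_l`. -/
structure IsHomogeneousFrame {ι : Type*} [Fintype ι] {N : ℕ}
    (mul : (ι → ℝ) → (ι → ℝ) → (ι → ℝ)) (w : ι → ℝ) (s : Fin N → ℕ)
    (Z : Fin N → SmoothVF ι) : Prop where
  smooth_mul : ContDiff ℝ ∞ (fun z : (ι → ℝ) × (ι → ℝ) => mul z.1 z.2)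
  assoc : ∀ a b c, mul (mul a b) c = mul a (mul b c)
  zero_mul : ∀ a, mul 0 a = a
  mul_zero : ∀ a, mul a 0 = a
  exists_inv : ∃ inv : (ι → ℝ) → (ι → ℝ), ContDiff ℝ ∞ inv ∧
    ∀ a, mul (inv a) a = 0 ∧ mul a (inv a) = 0
  dil_mul : ∀ lam : ℝ, 0 < lam → ∀ a b,
    dil w lam (mul a b) = mul (dil w lam a) (dil w lam b)
  leftInv : ∀ l, Z l ∈ leftInvariant mul
  linInd : LinearIndependent ℝ fun l => (Z l).1 0
  top_le_span : ⊤ ≤ Submodule.span ℝ (Set.range fun l => (Z l).1 0)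
  homogeneous : ∀ l, IsHomogeneousVF w (s l) (Z l)

namespace IsHomogeneousFrame

variable {ι : Type*} [Fintype ι] {N : ℕ}
  {mul : (ι → ℝ) → (ι → ℝ) → (ι → ℝ)} {w : ι → ℝ} {s : Fin N → ℕ} {Z : Fin N → SmoothVF ι}
  (H : IsHomogeneousFrame mul w s Z)

include H

theorem smooth_mul_left (a : ι → ℝ) : ContDiff ℝ ∞ (mul a) := by
  have h := H.smooth_mul.comp (f := fun b : ι → ℝ => (a, b)) (contDiff_const.prodMk contDiff_id)
  exact h

theorem linearIndependent : LinearIndependent ℝ Z :=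
  LinearIndependent.of_comp (evalAt 0) H.linInd

theorem span_le : Submodule.span ℝ (Set.range Z) ≤ leftInvariant mul := by
  rw [Submodule.span_le]
  rintro _ ⟨l, rfl⟩
  exact H.leftInv l

theorem map_evalAt_span :
    (Submodule.span ℝ (Set.range Z)).map (evalAt 0) = ⊤ := by
  rw [Submodule.map_span, ← Set.range_comp, eq_top_iff]
  exact H.top_le_span

theorem span_eq : Submodule.span ℝ (Set.range Z) = leftInvariant mul :=
  eq_of_map_evalAt_eq H.mul_zero H.span_le le_rfl <| le_antisymm (Submodule.map_mono H.span_le)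
    (by rw [H.map_evalAt_span]; exact le_top)

theorem weight_eq {l : Fin N} {k : ι} (h : (Z l).1 0 k ≠ 0) : w k = s l :=
  (eq_weight_of_apply_zero_ne (H.homogeneous l) h).symm

variable [DecidableEq ι]

/-- At 0 a field of degree s_l has components only in coordinates of weight s_l. The matrix of the
frame is thus block diagonal, and being invertible it is invertible on each block. -/
theorem span_weight (t : ℝ) :
    Submodule.span ℝ ((fun l => (Z l).1 0) '' {l | (s l : ℝ) = t}) =
      Submodule.span ℝ ((fun k => (Pi.single k 1 : ι → ℝ)) '' {k | w k = t}) := by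
  classical
  apply le_antisymm
  · rw [Submodule.span_le]
    rintro _ ⟨l, hl, rfl⟩
    simp only [SetLike.mem_coe]
    rw [pi_eq_sum_univ' ((Z l).1 0)]
    refine Submodule.sum_mem _ fun k _ => ?_
    by_cases hk : (Z l).1 0 k = 0
    · rw [hk, zero_smul]; exact Submodule.zero_mem _
    · exact Submodule.smul_mem _ _ (Submodule.subset_span ⟨k, (H.weight_eq hk).trans hl, rfl⟩)
  · rw [Submodule.span_le]
    rintro _ ⟨k, hk, rfl⟩
    obtain ⟨c, hc⟩ := (Submodule.mem_span_range_iff_exists_fun ℝ).1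
      (H.top_le_span (Submodule.mem_top (x := (Pi.single k 1 : ι → ℝ))))
    have : (Pi.single k 1 : ι → ℝ) = ∑ l, if (s l : ℝ) = t then c l • (Z l).1 0 else 0 := by
      funext j
      have hj := congrFun hc j
      rw [Finset.sum_apply] at hj ⊢
      by_cases hjt : w j = t
      · rw [← hj]
        refine Finset.sum_congr rfl fun l _ => ?_
        split_ifs with hl
        · rfl
        · have : (Z l).1 0 j = 0 := by
            by_contra h
            exact hl ((H.weight_eq h).symm.trans hjt)
          simp [this]
      · have hjk : j ≠ k := fun h => hjt (h ▸ hk)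
        rw [Pi.single_eq_of_ne hjk, Finset.sum_eq_zero]
        intro l _
        split_ifs with hl
        · have : (Z l).1 0 j = 0 := by
            by_contra h
            exact hjt ((H.weight_eq h).trans hl)
          simp [this]
        · rfl
    simp only [SetLike.mem_coe]
    rw [this]
    refine Submodule.sum_mem _ fun l _ => ?_
    split_ifs with hl
    · exact Submodule.smul_mem _ _ (Submodule.subset_span ⟨l, hl, rfl⟩)
    · exact Submodule.zero_mem _

theorem range_weight : Set.range w = (fun k : ℕ => (k : ℝ)) '' Set.range s := by
  ext t
  constructor
  · rintro ⟨k, rfl⟩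
    have h := H.span_weight (w k)
    have hk : (Pi.single k 1 : ι → ℝ) ∈
        Submodule.span ℝ ((fun l => (Z l).1 0) '' {l | (s l : ℝ) = w k}) := by
      rw [h]; exact Submodule.subset_span ⟨k, rfl, rfl⟩
    by_contra hne
    have : {l | (s l : ℝ) = w k} = ∅ := by
      rw [Set.eq_empty_iff_forall_notMem]
      exact fun l hl => hne ⟨s l, ⟨l, rfl⟩, hl⟩
    rw [this, Set.image_empty, Submodule.span_empty, Submodule.mem_bot] at hk
    simpa using congrFun hk k
  · rintro ⟨_, ⟨l, rfl⟩, rfl⟩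
    have h : (Z l).1 0 ≠ 0 := H.linInd.ne_zero l
    obtain ⟨k, hk⟩ := Function.ne_iff.1 h
    exact ⟨k, H.weight_eq hk⟩

theorem ncard_weight (t : ℝ) : {k | w k = t}.ncard = {l | (s l : ℝ) = t}.ncard := by
  classical
  have h := H.span_weight t
  rw [Set.image_eq_range, Set.image_eq_range] at h
  have h1 : LinearIndependent ℝ fun l : {l | (s l : ℝ) = t} => (Z l).1 0 :=
    H.linInd.comp _ Subtype.val_injective
  have h2 : LinearIndependent ℝ fun k : {k | w k = t} => (Pi.single (k : ι) 1 : ι → ℝ) := by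
    have := (Pi.basisFun ℝ ι).linearIndependent
    have h3 := this.comp (fun k : {k | w k = t} => (k : ι)) Subtype.val_injective
    convert h3 using 1
    funext k
    simp
  have h3 := finrank_span_eq_card h1
  have h4 := finrank_span_eq_card h2
  rw [← Nat.card_coe_set_eq, ← Nat.card_coe_set_eq, Nat.card_eq_fintype_card,
    Nat.card_eq_fintype_card, ← h3, ← h4, h]

variable {m : ℕ} (hle : m ≤ N) (hs : ∀ l, s l = 1 ↔ l.1 < m)

include hs

theorem span_jacobianGenerators :
    Submodule.span ℝ (Set.range fun k => Z (Fin.castLE hle k)) =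
      Submodule.span ℝ (jacobianGenerators mul w) := by
  refine eq_of_map_evalAt_eq H.mul_zero ?_ ?_ ?_
  · rw [Submodule.span_le]
    rintro _ ⟨l, rfl⟩
    exact H.leftInv _
  · rw [Submodule.span_le]
    exact fun V hV => hV.1
  · rw [Submodule.map_span, Submodule.map_span, ← Set.range_comp]
    have h1 : Set.range (⇑(evalAt 0) ∘ fun k => Z (Fin.castLE hle k)) =
        (fun l => (Z l).1 0) '' {l | (s l : ℝ) = 1} := by
      ext v
      constructor
      · rintro ⟨k, rfl⟩
        exact ⟨Fin.castLE hle k, by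
          simp only [Set.mem_ofPred_eq, Nat.cast_eq_one, hs]; exact k.2, rfl⟩
      · rintro ⟨l, hl, rfl⟩
        simp only [Set.mem_ofPred_eq, Nat.cast_eq_one, hs] at hl
        exact ⟨⟨l.1, hl⟩, rfl⟩
    have h2 : ⇑(evalAt 0) '' jacobianGenerators mul w =
        (fun k => (Pi.single k 1 : ι → ℝ)) '' {k | w k = 1} := by
      ext v
      constructor
      · rintro ⟨V, ⟨_, k, hk, hV⟩, rfl⟩
        exact ⟨k, hk, hV.symm⟩
      · rintro ⟨k, hk, rfl⟩
        have : (Pi.single k 1 : ι → ℝ) ∈ (Submodule.span ℝ (Set.range Z)).map (evalAt 0) := by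
          rw [H.map_evalAt_span]; trivial
        obtain ⟨V, hV, hVk⟩ := this
        exact ⟨V, ⟨H.span_le hV, k, hk, hVk⟩, hVk⟩
    rw [h1, h2, H.span_weight]

theorem lieSpan_jacobianGenerators :
    LieSubalgebra.lieSpan ℝ (SmoothVF ι) (jacobianGenerators mul w) =
      lieGen fun k => Z (Fin.castLE hle k) :=
  LieSubalgebra.lieSpan_eq_of_span_eq (H.span_jacobianGenerators hle hs).symm

variable {r : ℕ} (hr : 1 ≤ r) (hsr : Set.range s = Set.Icc 1 r)
  (hgen : (lieGen fun k => Z (Fin.castLE hle k)).toSubmodule = leftInvariant mul)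

include hr hsr hgen

/-- No layer exceeds r because all weights are at most r. Layer r is non-zero: some Z_l has degree
r, and if that layer vanished, generation would put Z_l into the sum of fields of other degrees,
against their independence. -/
theorem isNilpotent_and_nilpotencyLength :
    LieRing.IsNilpotent ↥(lieGen fun k => Z (Fin.castLE hle k)) ∧
      LieModule.nilpotencyLength ↥(lieGen fun k => Z (Fin.castLE hle k))
        ↥(lieGen fun k => Z (Fin.castLE hle k)) = r := by
  have hw : ∀ i, ∃ k ∈ Set.Icc 1 r, (k : ℝ) = w i := fun i => by
    have : w i ∈ Set.range w := ⟨i, rfl⟩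
    rwa [H.range_weight, hsr] at this
  have hZ : ∀ k, IsHomogeneousVF w 1 (Z (Fin.castLE hle k)) := fun k => by
    have h := H.homogeneous (Fin.castLE hle k)
    rwa [(hs (Fin.castLE hle k)).2 k.2, Nat.cast_one] at h
  refine isNilpotent_and_nilpotencyLength_lieGen _ hr (fun hbot => ?_) fun k hk => ?_
  · have hr' : r ∈ Set.range s := by rw [hsr]; exact ⟨hr, le_rfl⟩
    obtain ⟨l, hl⟩ := hr'
    have h1 : Z l ∈ ⨆ j, ⨆ _ : j ≠ r, homogeneousVF w (j : ℝ) := by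
      have h2 : Z l ∈ (lieGen fun k => Z (Fin.castLE hle k)).toSubmodule := by
        rw [hgen]; exact H.leftInv l
      rw [lieGen_eq_iSup] at h2
      refine (iSup_le fun j => ?_ : _ ≤ ⨆ j, ⨆ _ : j ≠ r, homogeneousVF w (j : ℝ)) h2
      by_cases hj : j = r
      · rw [hj, hbot]; exact bot_le
      · exact (layer_le_homogeneousVF hZ j).trans
          (le_iSup₂ (f := fun j (_ : j ≠ r) => homogeneousVF w (j : ℝ)) j hj)
    have h2 : Z l ∈ homogeneousVF w (r : ℝ) := hl ▸ H.homogeneous l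
    exact H.linearIndependent.ne_zero l
      (Submodule.disjoint_def.1 (iSupIndep_homogeneousVF (σ := w) r) _ h2 h1)
  · refine layer_eq_bot hZ (fun i => ?_) fun i => ?_
    · obtain ⟨j, hj, hi⟩ := hw i
      rw [← hi]; exact_mod_cast hj.1
    · obtain ⟨j, hj, hi⟩ := hw i
      rw [← hi]; exact_mod_cast lt_of_le_of_lt hj.2 hk

theorem isHomogeneousCarnotGroup : IsHomogeneousCarnotGroup mul w m r where
  smooth_mul := H.smooth_mul
  assoc := H.assoc
  zero_mul := H.zero_mul
  mul_zero := H.mul_zero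
  exists_inv := H.exists_inv
  dil_mul := H.dil_mul
  weights := by rw [H.range_weight, hsr]
  card_generators := by
    rw [H.ncard_weight]
    have : {l | (s l : ℝ) = 1} = Set.range (Fin.castLE hle) := by
      ext l
      simp only [Set.mem_ofPred_eq, Nat.cast_eq_one, hs]
      exact ⟨fun h => ⟨⟨l.1, h⟩, rfl⟩, by rintro ⟨k, rfl⟩; exact k.2⟩
    rw [this, ← Set.image_univ, Set.ncard_image_of_injective _ (Fin.castLE_injective hle),
      Set.ncard_univ, Nat.card_eq_fintype_card, Fintype.card_fin]
  generates := by rw [H.lieSpan_jacobianGenerators hle hs, hgen]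
  nilpotent := by
    rw [H.lieSpan_jacobianGenerators hle hs]
    exact (H.isNilpotent_and_nilpotencyLength hle hs hr hsr hgen).1
  step := by
    rw [H.lieSpan_jacobianGenerators hle hs]
    exact (H.isNilpotent_and_nilpotencyLength hle hs hr hsr hgen).2

omit hs hr hsr hgen [DecidableEq ι] in
/-- The fields `Z_1, …, Z_m` generate the left-invariant fields if the frame `Z` is related to a
basis of `Lie{X_1, …, X_m}` by a surjective smooth map. -/
theorem lieGen_eq_leftInvariant {n p : ℕ} {X : Fin m → SmoothVF (Fin n)}
    (F : LiftingFrame X N p) {φ : (ι → ℝ) → (Fin n → ℝ)} (hφ : ContDiff ℝ ∞ φ)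
    (hsurj : Function.Surjective φ) (hrel : ∀ l, Related φ (Z l) (F.field l)) :
    (lieGen fun k => Z (Fin.castLE F.le k)).toSubmodule = leftInvariant mul := by
  have hle : lieGen (fun k => Z (Fin.castLE F.le k)) ≤ leftInvariantLie H.smooth_mul_left := by
    refine LieSubalgebra.lieSpan_le.2 ?_
    rintro _ ⟨k, rfl⟩
    exact H.leftInv _
  refine le_antisymm hle ?_
  -- Relatedness survives sums, multiples and brackets, so an expression of V in the X_k lifts to
  -- the same expression in the Z_k.
  have hlift : ∀ V ∈ lieGen X, ∃ U ∈ lieGen (fun k => Z (Fin.castLE F.le k)), Related φ U V := by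
    intro V hV
    refine LieSubalgebra.lieSpan_induction (R := ℝ)
      (p := fun V _ => ∃ U ∈ lieGen (fun k => Z (Fin.castLE F.le k)), Related φ U V)
      ?_ ?_ ?_ ?_ ?_ hV
    · rintro _ ⟨k, rfl⟩
      exact ⟨_, LieSubalgebra.subset_lieSpan ⟨k, rfl⟩, F.basis_eq k ▸ hrel _⟩
    · exact ⟨0, Submodule.zero_mem _, fun x => map_zero _⟩
    · rintro A B _ _ ⟨U, hU, h1⟩ ⟨W, hW, h2⟩
      exact ⟨U + W, add_mem hU hW, fun x => by
        change fderiv ℝ φ x (U.1 x + W.1 x) = A.1 (φ x) + B.1 (φ x)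
        rw [map_add, h1, h2]⟩
    · rintro c A _ ⟨U, hU, h1⟩
      exact ⟨c • U, Submodule.smul_mem _ _ hU, fun x => by
        change fderiv ℝ φ x (c • U.1 x) = c • A.1 (φ x)
        rw [map_smul, h1]⟩
    · rintro A B _ _ ⟨U, hU, h1⟩ ⟨W, hW, h2⟩
      exact ⟨⁅U, W⁆, LieSubalgebra.lie_mem _ hU hW, h1.lie hφ h2⟩
  rw [← H.span_eq, Submodule.span_le]
  rintro _ ⟨l, rfl⟩
  obtain ⟨U, hU, hrelU⟩ := hlift _ (F.basis l).2
  have hU' : U ∈ Submodule.span ℝ (Set.range Z) := by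
    rw [H.span_eq]; exact hle hU
  obtain ⟨c, rfl⟩ := (Submodule.mem_span_range_iff_exists_fun ℝ).1 hU'
  -- The lift U of X_l is left-invariant, so U = ∑ c_k Z_k. Pushing it down by the surjective φ
  -- expresses X_l in the basis, which forces c to be the l-th unit vector and U = Z_l.
  have h1 : F.basis l = ∑ k, c k • F.basis k := by
    refine Subtype.ext (Subtype.ext (funext fun y => ?_))
    obtain ⟨x, rfl⟩ := hsurj y
    rw [← hrelU x]
    simp only [AddSubmonoidClass.coe_finsetSum, Finset.sum_apply, map_sum,
      SetLike.val_smul, Pi.smul_apply, map_smul, hrel _ x]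
    rfl
  have h2 : ∀ k, c k = if l = k then 1 else 0 := by
    intro k
    have h := congrArg (fun V => F.basis.equivFun V k) h1
    simp only [← Module.Basis.equivFun_symm_apply, LinearEquiv.apply_symm_apply,
      Module.Basis.equivFun_self] at h
    exact h.symm
  have h3 : ∑ k, c k • Z k = Z l := by simp [h2]
  rw [h3] at hU
  exact hU

end IsHomogeneousFrame
end

noncomputable section

open SmoothVF

/-! ### The step -/

section Step

variable {n m : ℕ} {σ : Fin n → ℝ} {X : Fin m → SmoothVF (Fin n)}

theorem map_evalAt_lieGen_eq_top (hH : HormanderAt X 0) :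
    (lieGen X).toSubmodule.map (evalAt 0) = ⊤ := by
  have h : (lieGen X).toSubmodule.map (evalAt 0) =
      Submodule.span ℝ {v : Fin n → ℝ | ∃ V ∈ lieGen X, V.1 0 = v} := by
    rw [← Submodule.span_eq ((lieGen X).toSubmodule.map (evalAt 0))]
    rfl
  rw [h]
  apply Submodule.eq_top_of_finrank_eq
  rw [Module.finrank_fin_fun]
  exact hH

/-- A field of degree d has a non-zero i-th component at 0 only if d = σ_i. Without a non-zero layer
of that degree all fields of 𝔞 would have zero i-th component at 0, against Hörmander's condition.
-/
theorem exists_layer_of_hormanderAt (hX : ∀ k, IsHomogeneousVF σ 1 (X k)) (hH : HormanderAt X 0)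
    (i : Fin n) : ∃ k : ℕ, (k : ℝ) = σ i ∧ layer X k ≠ ⊥ := by
  by_contra! hne
  have h : (lieGen X).toSubmodule.map (evalAt 0) ≤
      LinearMap.ker (LinearMap.proj (R := ℝ) (φ := fun _ : Fin n => ℝ) i) := by
    rw [lieGen_eq_iSup, Submodule.map_iSup]
    refine iSup_le fun k => ?_
    rintro _ ⟨V, hV, rfl⟩
    rw [LinearMap.mem_ker]
    by_contra h0
    have h1 := eq_weight_of_apply_zero_ne (layer_le_homogeneousVF hX k hV) (k := i) h0
    have h2 : V ∈ (⊥ : Submodule ℝ _) := hne k h1 ▸ hV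
    rw [Submodule.mem_bot] at h2
    exact h0 (by rw [h2]; rfl)
  rw [map_evalAt_lieGen_eq_top hH] at h
  have h1 : (Pi.single i 1 : Fin n → ℝ) ∈
    LinearMap.ker (LinearMap.proj (R := ℝ) (φ := fun _ : Fin n => ℝ) i) := h trivial
  simp at h1

theorem exists_step (hX : ∀ k, IsHomogeneousVF σ 1 (X k)) (hH : HormanderAt X 0)
    (hσ : ∀ k, 0 < σ k) (i : Fin n) (hi : ∀ k, σ k ≤ σ i) :
    ∃ r : ℕ, (r : ℝ) = σ i ∧ 1 ≤ r ∧ ∀ k, layer X k ≠ ⊥ ↔ k ∈ Set.Icc 1 r := by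
  obtain ⟨r, hr, hne⟩ := exists_layer_of_hormanderAt hX hH i
  have hr1 : 1 ≤ r := by
    have := hσ i
    rw [← hr] at this
    exact_mod_cast this
  refine ⟨r, hr, hr1, fun k => ⟨fun hk => ⟨?_, ?_⟩, fun hk h => ?_⟩⟩
  · rcases k with _ | k
    · exact absurd rfl hk
    · omega
  · by_contra h
    refine hk (layer_eq_bot hX hσ fun j => lt_of_le_of_lt (hi j) ?_)
    rw [← hr]
    exact_mod_cast not_le.1 h
  · exact hne (layer_eq_bot_of_le X hk.1 hk.2 h)

/-- The coordinate x_k has degree σ_k ≤ r < r + 1. This fixes the order K = r + 1 at which all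
exponentials are truncated. -/
theorem coord_mem_killed (hX : ∀ k, IsHomogeneousVF σ 1 (X k)) (hσ : ∀ k, 0 < σ k) {r : ℕ}
    (hr : ∀ k, σ k ≤ r) (k : Fin n) : (fun x : Fin n → ℝ => x k) ∈ killed X (r + 1) := by
  refine mem_killed_of_homogeneous hX hσ (lt_of_le_of_lt (hr k) ?_) (isHomogeneousFn_coord k)
    (contDiff_coord k)
  push_cast
  linarith

variable {N p : ℕ} (F : LiftingFrame X N p) {r : ℕ}
  (hr : ∀ k, layer X k ≠ ⊥ ↔ k ∈ Set.Icc 1 r)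

include hr in
theorem LiftingFrame.range_s : Set.range F.s = Set.Icc 1 r := by
  ext k
  rw [← hr]
  constructor
  · rintro ⟨l, rfl⟩ h
    have h1 := F.field_mem_layer l
    rw [h] at h1
    exact F.basis.ne_zero l (Subtype.ext h1)
  · intro h
    by_contra h1
    refine h ?_
    rw [← F.span_layer, Submodule.span_eq_bot]
    rintro _ ⟨l, hl, _⟩
    exact absurd ⟨l, hl⟩ h1

theorem LiftingFrame.linearIndependent_field : LinearIndependent ℝ F.field :=
  F.basis.linearIndependent.map' (lieGen X).toSubmodule.subtype (Submodule.ker_subtype _)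

/-- The basis fields with s_l = 1 and the first m basis fields both span the first layer.
Subfamilies of an independent family with equal spans have the same indices. -/
theorem LiftingFrame.s_eq_one_iff (l : Fin N) : F.s l = 1 ↔ l.1 < m := by
  have h1 : Submodule.span ℝ (F.field '' {l | F.s l = 1}) =
      Submodule.span ℝ (F.field '' {l | l.1 < m}) := by
    have h2 : F.field '' {l | F.s l = 1} =
        {V : SmoothVF (Fin n) | ∃ l, F.s l = 1 ∧ V = (F.basis l : SmoothVF (Fin n))} := by
      ext V
      exact ⟨by rintro ⟨l, hl, rfl⟩; exact ⟨l, hl, rfl⟩, by rintro ⟨l, hl, rfl⟩; exact ⟨l, hl, rfl⟩⟩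
    have h3 : F.field '' {l | l.1 < m} = Set.range X := by
      ext V
      constructor
      · rintro ⟨l, hl, rfl⟩
        exact ⟨⟨l.1, hl⟩, (F.basis_eq _).symm⟩
      · rintro ⟨k, rfl⟩
        exact ⟨Fin.castLE F.le k, k.2, F.basis_eq k⟩
    rw [h2, h3, F.span_layer]
    rfl
  have h := F.linearIndependent_field
  constructor
  · intro hl
    by_contra hlm
    refine h.notMem_span_image (s := {l | l.1 < m}) (x := l) hlm ?_
    rw [← h1]
    exact Submodule.subset_span ⟨l, hl, rfl⟩
  · intro hl
    by_contra hlm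
    refine h.notMem_span_image (s := {l | F.s l = 1}) (x := l) hlm ?_
    rw [h1]
    exact Submodule.subset_span ⟨l, hl, rfl⟩

end Step

/-! ### Existence of the choices -/

section Existence

variable {ι : Type*} [Fintype ι] {m : ℕ} {X : Fin m → SmoothVF ι}

/-- A family adapted to the first `k` layers. -/
theorem exists_adapted_family (hX : LinearIndependent ℝ X) (hind : iSupIndep (layer X)) (k : ℕ)
    (hk : 1 ≤ k) : ∃ (N : ℕ) (b : Fin N → SmoothVF ι) (s : Fin N → ℕ) (hle : m ≤ N),
      LinearIndependent ℝ b ∧ Monotone s ∧ (∀ j, b (Fin.castLE hle j) = X j) ∧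
      (∀ l, b l ∈ layer X (s l)) ∧ (∀ l, s l ≤ k) ∧
      ∀ j ≤ k, layer X j ≤ Submodule.span ℝ (b '' {l | s l = j}) := by
  induction k, hk using Nat.le_induction with
  | base =>
    refine ⟨m, X, fun _ => 1, le_rfl, hX, monotone_const, fun j => rfl,
      fun l => Submodule.subset_span ⟨l, rfl⟩, fun _ => le_rfl, fun j hj => ?_⟩
    interval_cases j
    · exact bot_le
    · have : {l : Fin m | (1 : ℕ) = 1} = Set.univ := by simp
      rw [this, Set.image_univ]
      exact le_rfl
  | succ k hk ih =>
    obtain ⟨N, b, s, hle, hb, hs, hbX, hbl, hsk, hspan⟩ := ih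
    have hfin : Module.Finite ℝ ↥(layer X (k + 1)) := Module.Finite.iff_fg.2 (layer_fg X (k + 1))
    let c := Module.finBasis ℝ ↥(layer X (k + 1))
    let d := Module.finrank ℝ ↥(layer X (k + 1))
    let c' : Fin d → SmoothVF ι := fun l => (c l : SmoothVF ι)
    have hc : LinearIndependent ℝ c' :=
      c.linearIndependent.map' (layer X (k + 1)).subtype (Submodule.ker_subtype _)
    have hcspan : Submodule.span ℝ (Set.range c') = layer X (k + 1) := by
      have : Set.range c' = (layer X (k + 1)).subtype '' Set.range c := by
        rw [← Set.range_comp]; rfl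
      rw [this, ← Submodule.map_span, c.span_eq, Submodule.map_top, Submodule.range_subtype]
    -- The fields found so far lie in layers of index at most k, which are independent of layer k +
    -- 1.
    have hdisj : Disjoint (Submodule.span ℝ (Set.range b)) (Submodule.span ℝ (Set.range c')) := by
      rw [hcspan]
      refine (hind (k + 1)).symm.mono_left ?_
      rw [Submodule.span_le]
      rintro _ ⟨l, rfl⟩
      exact (le_iSup₂ (f := fun j (_ : j ≠ k + 1) => layer X j) (s l)
        (by have := hsk l; omega)) (hbl l)
    have happ : Fin.append b c' = Sum.elim b c' ∘ finSumFinEquiv.symm := by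
      funext l
      refine Fin.addCases (fun l => ?_) (fun l => ?_) l <;> simp
    refine ⟨N + d, Fin.append b c', Fin.append s fun _ => k + 1, hle.trans (Nat.le_add_right _ _),
      ?_, ?_, fun j => ?_, fun l => ?_, fun l => ?_, fun j hj => ?_⟩
    · rw [happ]
      exact (hb.sum_type hc hdisj).comp _ finSumFinEquiv.symm.injective
    · intro a₁ a₂
      refine Fin.addCases (fun l => ?_) (fun l => ?_) a₁ <;>
        refine Fin.addCases (fun l' => ?_) (fun l' => ?_) a₂ <;> intro h
      · rw [Fin.append_left, Fin.append_left]
        exact hs h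
      · simpa using (hsk l).trans (Nat.le_succ k)
      · exfalso
        rw [Fin.le_def] at h
        simp at h
        omega
      · simp
    · rw [← hbX, show Fin.castLE (hle.trans (Nat.le_add_right N d)) j =
        Fin.castAdd d (Fin.castLE hle j) from rfl, Fin.append_left]
    · refine Fin.addCases (fun l => ?_) (fun l => ?_) l
      · simpa using hbl l
      · rw [Fin.append_right, Fin.append_right]
        exact (c l).2
    · refine Fin.addCases (fun l => ?_) (fun l => ?_) l
      · simpa using (hsk l).trans (Nat.le_succ k)
      · simp
    · rcases Nat.lt_or_ge k j with hkj | hkj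
      · obtain rfl : j = k + 1 := by omega
        rw [← hcspan]
        refine Submodule.span_mono ?_
        rintro _ ⟨l, rfl⟩
        exact ⟨Fin.natAdd N l, by simp, by simp⟩
      · refine (hspan j hkj).trans (Submodule.span_mono ?_)
        rintro _ ⟨l, hl, rfl⟩
        exact ⟨Fin.castAdd d l, by simpa using hl, by simp⟩

end Existence

/-- An adapted family through layer r exhausts 𝔞. By Hörmander's condition its values at 0 span ℝ^n,
so n of them form a basis; the chosen indices and their complement are then listed in increasing
order. -/
theorem exists_liftingFrame {n m : ℕ} {σ : Fin n → ℝ} {X : Fin m → SmoothVF (Fin n)}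
    (hX : LinearIndependent ℝ X) (hhom : ∀ k, IsHomogeneousVF σ 1 (X k)) (hH : HormanderAt X 0)
    {r : ℕ} (h1 : 1 ≤ r) (hr : ∀ k, r < k → layer X k = ⊥) :
    ∃ p, Module.finrank ℝ ↥(lieGen X) = n + p ∧
      Nonempty (LiftingFrame X (Module.finrank ℝ ↥(lieGen X)) p) := by
  classical
  obtain ⟨N, b, s, hle, hb, hs, hbX, hbl, hsr, hspan⟩ :=
    exists_adapted_family hX (iSupIndep_layer hhom) r h1
  let b' : Fin N → ↥(lieGen X) := fun l => ⟨b l, layer_le_lieGen X _ (hbl l)⟩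
  have hb' : LinearIndependent ℝ b' := LinearIndependent.of_comp (lieGen X).toSubmodule.subtype hb
  have hbspan : (lieGen X).toSubmodule ≤ Submodule.span ℝ (Set.range b) := by
    rw [lieGen_eq_iSup]
    refine iSup_le fun j => ?_
    rcases Nat.lt_or_ge r j with hj | hj
    · rw [hr j hj]; exact bot_le
    · exact (hspan j hj).trans (Submodule.span_mono (Set.image_subset_range _ _))
  have hb'span : ⊤ ≤ Submodule.span ℝ (Set.range b') := by
    rintro V -
    have h2 : Submodule.span ℝ (Set.range b) =
        (Submodule.span ℝ (Set.range b')).map (lieGen X).toSubmodule.subtype := by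
      rw [Submodule.map_span, ← Set.range_comp]; rfl
    have h3 := hbspan V.2
    rw [h2] at h3
    obtain ⟨W, hW, hWV⟩ := h3
    have : W = V := Subtype.ext hWV
    exact this ▸ hW
  let B : Module.Basis (Fin N) ℝ ↥(lieGen X) := Module.Basis.mk hb' hb'span
  have hB : ∀ l, (B l : SmoothVF (Fin n)) = b l := fun l => by
    rw [Module.Basis.mk_apply]
  have hN : Module.finrank ℝ ↥(lieGen X) = N := by
    rw [Module.finrank_eq_card_basis B, Fintype.card_fin]
  have hev : Submodule.span ℝ (Set.range fun l => (b l).1 0) = ⊤ := by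
    rw [eq_top_iff, ← map_evalAt_lieGen_eq_top hH]
    refine (Submodule.map_mono hbspan).trans ?_
    rw [Submodule.map_span, ← Set.range_comp]
    exact le_rfl
  obtain ⟨κ, a, ha, haspan, hali⟩ := exists_linearIndependent' ℝ fun l => (b l).1 0
  have : Finite κ := Finite.of_injective a ha
  have : Fintype κ := Fintype.ofFinite κ
  have hκ : Fintype.card κ = n := by
    rw [← finrank_span_eq_card hali, haspan, hev, finrank_top, Module.finrank_fin_fun]
  let S : Finset (Fin N) := Finset.univ.image a
  have hS : S.card = n := by
    rw [Finset.card_image_of_injective _ ha, Finset.card_univ, hκ]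
  have hnN : n ≤ N := by
    rw [← hS]
    exact (Finset.card_le_univ S).trans (by rw [Fintype.card_fin])
  have hSc : Sᶜ.card = N - n := by rw [Finset.card_compl, hS, Fintype.card_fin]
  refine ⟨N - n, by omega, ?_⟩
  rw [hN]
  have hmem : ∀ k : Fin n, ∃ t : κ, a t = S.orderEmbOfFin hS k := fun k => by
    have := Finset.orderEmbOfFin_mem S hS k
    obtain ⟨t, -, ht⟩ := Finset.mem_image.1 this
    exact ⟨t, ht⟩
  choose f hf using hmem
  exact ⟨{
    basis := B
    le := hle
    basis_eq := fun k => by rw [hB, hbX]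
    s := s
    s_mono := hs
    span_layer := fun k => by
      apply le_antisymm
      · rw [Submodule.span_le]
        rintro _ ⟨l, rfl, rfl⟩
        rw [hB]
        exact hbl l
      · rcases Nat.lt_or_ge r k with hk | hk
        · rw [hr k hk]; exact bot_le
        · refine (hspan k hk).trans (Submodule.span_mono ?_)
          rintro _ ⟨l, hl, rfl⟩
          exact ⟨l, hl, (hB l).symm⟩
    i := S.orderEmbOfFin hS
    i_mono := (S.orderEmbOfFin hS).strictMono
    linInd := by
      have hfi : Function.Injective f := fun k l h => by
        apply (S.orderEmbOfFin hS).injective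
        rw [← hf, ← hf, h]
      have h := hali.comp f hfi
      have h2 : (fun k : Fin n => (B (S.orderEmbOfFin hS k) : SmoothVF (Fin n)).1 0) =
          ((fun l => (b l).1 0) ∘ a) ∘ f := by
        funext k
        simp only [Function.comp_apply, hf, hB]
      rw [h2]
      exact h
    j := Sᶜ.orderEmbOfFin hSc
    j_mono := (Sᶜ.orderEmbOfFin hSc).strictMono
    range_j := by
      rw [Finset.range_orderEmbOfFin, Finset.range_orderEmbOfFin, Finset.coe_compl] }⟩

end

noncomputable section

open SmoothVF

/-! ### Differential operators and liftings -/

section DifferentialOperators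

variable {ι : Type*} [Fintype ι] [DecidableEq ι]

theorem apply_eq_sum_single {M : Type*} [AddCommGroup M] [Module ℝ M] [TopologicalSpace M]
    (L : (ι → ℝ) →L[ℝ] M) (v : ι → ℝ) : L v = ∑ i, v i • L (Pi.single i 1) := by
  conv_lhs => rw [pi_eq_sum_univ' v, map_sum]
  exact Finset.sum_congr rfl fun i _ => map_smul L _ _

theorem isSmoothPDO_op (V : SmoothVF ι) : IsSmoothPDO V.op := by
  refine ⟨1, fun k J x => if h : k = 1 then V.1 x (J ⟨0, by omega⟩) else 0, fun k J => ?_,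
    fun f _ x => ?_⟩
  · by_cases h : k = 1
    · simp only [h, dif_pos]
      exact contDiff_pi.1 V.contDiff _
    · simp only [h, dif_neg, not_false_iff]
      exact contDiff_const
  · rw [Finset.sum_range_succ, Finset.sum_range_one]
    simp only [zero_ne_one, dif_neg, not_false_iff, zero_mul, Finset.sum_const_zero, zero_add,
      dif_pos, iteratedFDeriv_one_apply]
    rw [SmoothVF.op, apply_eq_sum_single, ← (Equiv.funUnique (Fin 1) ι).sum_comp]
    rfl

omit [DecidableEq ι] in
theorem op_op (V : SmoothVF ι) {f : (ι → ℝ) → ℝ} (hf : ContDiff ℝ ∞ f) (x : ι → ℝ) :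
    V.op (V.op f) x =
      fderiv ℝ (fderiv ℝ f) x (V.1 x) (V.1 x) + fderiv ℝ f x (fderiv ℝ V.1 x (V.1 x)) := by
  have h1 : DifferentiableAt ℝ (fderiv ℝ f) x :=
    (hf.fderiv_right (m := ∞) (by simp)).differentiable (by simp) x
  have h2 := h1.hasFDerivAt.clm_apply (V.differentiableAt x).hasFDerivAt
  change fderiv ℝ (fun y => fderiv ℝ f y (V.1 y)) x (V.1 x) = _
  rw [h2.fderiv]
  simp [add_comm]

theorem isSmoothPDO_sumSq {m : ℕ} (V : Fin m → SmoothVF ι) : IsSmoothPDO (sumSq V) := by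
  -- The coefficients come from `op_op`: V_i V_j in second order and the derivative of V along V in
  -- first order.
  refine ⟨2, fun k J x => if h : k = 2 then
      ∑ t, (V t).1 x (J ⟨0, by omega⟩) * (V t).1 x (J ⟨1, by omega⟩)
    else if h : k = 1 then ∑ t, fderiv ℝ (V t).1 x ((V t).1 x) (J ⟨0, by omega⟩) else 0,
    fun k J => ?_, fun f hf x => ?_⟩
  · by_cases h : k = 2
    · simp only [h, dif_pos]
      exact ContDiff.sum fun t _ =>
        (contDiff_pi.1 (V t).contDiff _).mul (contDiff_pi.1 (V t).contDiff _)
    by_cases h1 : k = 1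
    · simp only [h1, OfNat.one_ne_ofNat, dif_pos, dif_neg, not_false_iff]
      refine ContDiff.sum fun t _ => ?_
      have := ((V t).contDiff.fderiv_right (m := ∞) (by simp)).clm_apply (V t).contDiff
      exact contDiff_pi.1 this _
    · simp only [h, h1, dif_neg, not_false_iff]
      exact contDiff_const
  · rw [Finset.sum_range_succ, Finset.sum_range_succ, Finset.sum_range_one]
    simp only [OfNat.zero_ne_ofNat, OfNat.one_ne_ofNat, zero_ne_one, dif_neg, not_false_iff,
      zero_mul, Finset.sum_const_zero, zero_add, dif_pos, iteratedFDeriv_one_apply,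
      iteratedFDeriv_two_apply]
    rw [← (Equiv.funUnique (Fin 1) ι).symm.sum_comp, ← (finTwoArrowEquiv ι).symm.sum_comp,
      Fintype.sum_prod_type, sumSq]
    simp only [op_op _ hf, Finset.sum_add_distrib]
    rw [add_comm]
    congr 1
    · simp only [Finset.sum_mul]
      rw [Finset.sum_comm]
      refine Finset.sum_congr rfl fun t _ => ?_
      rw [apply_eq_sum_single (fderiv ℝ f x)]
      rfl
    · simp only [Finset.sum_mul]
      have h : ∀ t, (fderiv ℝ (fderiv ℝ f) x ((V t).1 x)) ((V t).1 x) =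
          ∑ i, ∑ j, (V t).1 x i * (V t).1 x j *
            fderiv ℝ (fderiv ℝ f) x (Pi.single i 1) (Pi.single j 1) := by
        intro t
        rw [apply_eq_sum_single (fderiv ℝ (fderiv ℝ f) x), _root_.sum_apply]
        refine Finset.sum_congr rfl fun i _ => ?_
        rw [_root_.smul_apply, apply_eq_sum_single (fderiv ℝ (fderiv ℝ f) x _),
          Finset.smul_sum]
        exact Finset.sum_congr rfl fun j _ => by simp only [smul_eq_mul]; ring
      simp only [h]
      rw [Finset.sum_comm]
      refine Finset.sum_congr rfl fun i _ => ?_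
      rw [Finset.sum_comm]
      rfl

end DifferentialOperators

theorem isLifting_op {n p : ℕ} {Z : SmoothVF (Fin n ⊕ Fin p)} {V : SmoothVF (Fin n)}
    (h : Related projX Z V) : IsLifting Z.op V.op :=
  ⟨isSmoothPDO_op Z, fun _ hf z => congrFun (h.op contDiff_projX hf) z⟩

theorem isLifting_sumSq {n p m : ℕ} {Z : Fin m → SmoothVF (Fin n ⊕ Fin p)}
    {V : Fin m → SmoothVF (Fin n)} (h : ∀ k, Related projX (Z k) (V k)) :
    IsLifting (sumSq Z) (sumSq V) := by
  refine ⟨isSmoothPDO_sumSq Z, fun f hf z => ?_⟩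
  refine Finset.sum_congr rfl fun k _ => ?_
  rw [(h k).op contDiff_projX hf, (h k).op contDiff_projX ((V k).op_contDiff hf)]
  rfl

/-! ### Folland's group and the lifted group as homogeneous Carnot groups -/

namespace LiftingFrame

variable {n m N p : ℕ} {X : Fin m → SmoothVF (Fin n)} (F : LiftingFrame X N p) {K : ℕ}
  (hK : ∀ k : Fin n, (fun x : Fin n → ℝ => x k) ∈ killed X K)

theorem isHomogeneousFrame_fieldJ :
    IsHomogeneousFrame F.mulA F.weightA F.s (F.fieldJ hK) where
  smooth_mul := F.contDiff_mulA hK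
  assoc := F.mulA_assoc hK
  zero_mul := F.zero_mulA hK
  mul_zero := F.mulA_zero hK
  exists_inv := ⟨fun a => -a, contDiff_neg, fun a => ⟨F.neg_mulA hK a, F.mulA_neg hK a⟩⟩
  dil_mul := fun lam _ => F.dil_mulA hK lam
  leftInv := F.fieldJ_mem_leftInvariant hK
  linInd := by
    simp only [F.fieldJ_zero hK]
    convert (Pi.basisFun ℝ (Fin N)).linearIndependent using 1
    funext l
    simp
  top_le_span := by
    simp only [F.fieldJ_zero hK]
    rw [← (Pi.basisFun ℝ (Fin N)).span_eq]
    refine Submodule.span_mono ?_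
    rintro _ ⟨l, rfl⟩
    exact ⟨l, by simp⟩
  homogeneous := F.fieldJ_homogeneous hK

variable {σ : Fin n → ℝ} (hX : ∀ k, IsHomogeneousVF σ 1 (X k)) (hσ : ∀ k, 0 < σ k)

theorem isHomogeneousFrame_fieldZ :
    IsHomogeneousFrame F.mulG (F.weightG σ) F.s (F.fieldZ hK hX hσ) where
  smooth_mul := F.contDiff_mulG hK hX hσ
  assoc := F.mulG_assoc hK hX hσ
  zero_mul := F.zero_mulG hK hX hσ
  mul_zero := F.mulG_zero hK hX hσ
  exists_inv := F.exists_inv_mulG hK hX hσ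
  dil_mul := fun _ hlam => F.dil_mulG hK hX hσ hlam
  leftInv := F.fieldZ_mem_leftInvariant hK hX hσ
  linInd := by
    simp only [F.fieldZ_zero hK hX hσ]
    have h := (F.isHomogeneousFrame_fieldJ hK).linInd
    simp only [F.fieldJ_zero hK] at h
    exact h.map' (fderiv ℝ F.T 0 : (Fin N → ℝ) →ₗ[ℝ] (Fin n ⊕ Fin p → ℝ))
      (LinearMap.ker_eq_bot.2 (F.bijective_fderiv_T hK).1)
  top_le_span := by
    simp only [F.fieldZ_zero hK hX hσ]
    have h := (F.isHomogeneousFrame_fieldJ hK).top_le_span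
    simp only [F.fieldJ_zero hK] at h
    have h2 := Submodule.map_mono (f := (fderiv ℝ F.T 0 : (Fin N → ℝ) →ₗ[ℝ] (Fin n ⊕ Fin p → ℝ))) h
    rw [Submodule.map_top, LinearMap.range_eq_top.2 (F.bijective_fderiv_T hK).2,
      Submodule.map_span, ← Set.range_comp] at h2
    exact h2
  homogeneous := F.fieldZ_homogeneous hK hX hσ

include hK hX hσ in
theorem surjective_proj : Function.Surjective F.proj := by
  intro x
  obtain ⟨a, ha⟩ := (F.T_diffeomorphism hK hX hσ).1.2 (Sum.elim x 0)
  exact ⟨a, funext fun k => congrFun ha (Sum.inl k)⟩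

include hX hσ in
-- The generation criterion is used with π for Folland's group; for 𝔾 the projection to ℝ^n takes
-- its place. Surjectivity of π comes from that of T.
theorem lieGen_fieldJ :
    (lieGen fun k => F.fieldJ hK (Fin.castLE F.le k)).toSubmodule = leftInvariant F.mulA :=
  (F.isHomogeneousFrame_fieldJ hK).lieGen_eq_leftInvariant F (F.contDiff_proj hK)
    (F.surjective_proj hK hX hσ) (F.fieldJ_related hK)

theorem lieGen_fieldZ :
    (lieGen fun k => F.fieldZ hK hX hσ (Fin.castLE F.le k)).toSubmodule = leftInvariant F.mulG :=
  (F.isHomogeneousFrame_fieldZ hK hX hσ).lieGen_eq_leftInvariant F contDiff_projX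
    (fun x => ⟨Sum.elim x 0, rfl⟩) (F.fieldZ_related_projX hK hX hσ)

end LiftingFrame

theorem theorem3p3 {n m : ℕ} (hn : 0 < n) (σ : Fin n → ℝ)
    (hσ1 : σ ⟨0, hn⟩ = 1) (hσ : Monotone σ)
    (X : Fin m → SmoothVF (Fin n)) (hX : LinearIndependent ℝ X)
    (hH1 : ∀ k, IsHomogeneousVF σ 1 (X k)) (hH2 : HormanderAt X 0) :
    -- the Lie algebra has finite dimension, its elements are complete vector fields,
    -- and the choices which enter the construction can be made
    FiniteDimensional ℝ ↥(lieGen X) ∧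
    (∀ V ∈ lieGen X, ∀ x, ∃ γ, IsGlobalCurveFrom V x γ) ∧
    (∃ p, Module.finrank ℝ ↥(lieGen X) = n + p ∧
      Nonempty (LiftingFrame X (Module.finrank ℝ ↥(lieGen X)) p)) ∧
    ∃ r : ℕ, (r : ℝ) = σ ⟨n - 1, Nat.sub_lt hn one_pos⟩ ∧
    -- whatever the choices are
    ∀ (N p : ℕ) (F : LiftingFrame X N p),
      -- Folland's group is a homogeneous Carnot group
      IsHomogeneousCarnotGroup F.mulA F.weightA m r ∧
      -- `T` is a diffeomorphism of `ℝ^N` which intertwines the dilations and the group laws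
      (Function.Bijective F.T ∧ ContDiff ℝ ∞ F.T ∧ ContDiff ℝ ∞ F.Tinv) ∧
      (∀ lam : ℝ, 0 < lam → ∀ a, F.T (dil F.weightA lam a) = dil (F.weightG σ) lam (F.T a)) ∧
      (∀ a b, F.T (F.mulA a b) = F.mulG (F.T a) (F.T b)) ∧
      -- `𝔾` is a homogeneous Carnot group
      IsHomogeneousCarnotGroup F.mulG (F.weightG σ) m r ∧
      -- the fields `Z_1, …, Z_N`
      ∃ Z : Fin N → SmoothVF (Fin n ⊕ Fin p),
        (∀ l z, (Z l).1 z = F.Z l z) ∧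
        LinearIndependent ℝ Z ∧
        Submodule.span ℝ (Set.range Z) = leftInvariant F.mulG ∧
        (lieGen fun k => Z (Fin.castLE F.le k)).toSubmodule = leftInvariant F.mulG ∧
        Submodule.span ℝ (Set.range fun k => Z (Fin.castLE F.le k)) =
          Submodule.span ℝ (jacobianGenerators F.mulG (F.weightG σ)) ∧
        (∀ l, IsHomogeneousVF (F.weightG σ) (F.s l) (Z l)) ∧
        (∃ R : Fin N → SmoothVF (Fin n ⊕ Fin p),
          (∀ l z k, (R l).1 z (Sum.inl k) = 0) ∧
          ∀ l, Z l = (F.field l).extend p + R l) ∧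
        (∀ l, IsLifting (Z l).op (F.field l).op) ∧
        IsLifting (sumSq fun k => Z (Fin.castLE F.le k)) (sumSq X) := by
  have hpos : ∀ k, 0 < σ k := fun k => by
    have h := hσ (show (⟨0, hn⟩ : Fin n) ≤ k from Nat.zero_le _)
    rw [hσ1] at h
    linarith
  have hlast : ∀ k, σ k ≤ σ ⟨n - 1, Nat.sub_lt hn one_pos⟩ := fun k =>
    hσ (show k ≤ (⟨n - 1, Nat.sub_lt hn one_pos⟩ : Fin n) from Nat.le_sub_one_of_lt k.2)
  obtain ⟨r, hr, hr1, hlayer⟩ := exists_step hH1 hH2 hpos _ hlast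
  have hbot : ∀ k, r < k → layer X k = ⊥ := fun k hk => by
    by_contra h
    exact absurd ((hlayer k).1 h).2 (not_le.2 hk)
  have hK := coord_mem_killed hH1 hpos (r := r) fun k => by rw [hr]; exact hlast k
  refine ⟨finiteDimensional_lieGen hbot,
    fun V hV x => ⟨_, isGlobalCurveFrom_flow hK ⟨V, hV⟩ x⟩,
    exists_liftingFrame hX hH1 hH2 hr1 hbot, r, hr, fun N p F => ?_⟩
  have hs := F.s_eq_one_iff
  have hsr := F.range_s hlayer
  have HA := F.isHomogeneousFrame_fieldJ hK
  have HG := F.isHomogeneousFrame_fieldZ hK hH1 hpos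
  have hT := F.T_diffeomorphism hK hH1 hpos
  have hrel := F.fieldZ_related_projX hK hH1 hpos
  refine ⟨HA.isHomogeneousCarnotGroup F.le hs hr1 hsr (F.lieGen_fieldJ hK hH1 hpos),
    ⟨hT.1, F.contDiff_T hK, hT.2⟩, fun lam hlam => F.T_dil hK hH1 hlam,
    F.T_mulA hK hH1 hpos,
    HG.isHomogeneousCarnotGroup F.le hs hr1 hsr (F.lieGen_fieldZ hK hH1 hpos),
    F.fieldZ hK hH1 hpos, fun _ _ => rfl, HG.linearIndependent, HG.span_eq,
    F.lieGen_fieldZ hK hH1 hpos, HG.span_jacobianGenerators F.le hs, HG.homogeneous,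
    ⟨fun l => F.fieldZ hK hH1 hpos l - (F.field l).extend p, fun l z k => ?_,
      fun l => (add_sub_cancel _ _).symm⟩,
    fun l => isLifting_op (hrel l), isLifting_sumSq fun k => ?_⟩
  -- The remainder is defined as the difference Z_l − X_l; its x-components vanish because Z_l and
  -- X_l agree there.
  · change (F.fieldZ hK hH1 hpos l).1 z (Sum.inl k) - (F.field l).1 (projX z) k = 0
    rw [F.fieldZ_inl, sub_self]
  · have := hrel (Fin.castLE F.le k)
    rwa [show F.field (Fin.castLE F.le k) = X k from F.basis_eq k] at this

end
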